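/- **Setting.** A two-terminal directed series-parallel graph with terminals $s\neq t$ is a directed multigraph obtained from single edges by series joins and parallel joins. Let $G=(V,E)$ be such a graph with $m$ edges, let $(s_i,t_i,d_i)_{i\le k}$ be commodities with rational demands $d_i\ge 0$, and let $f^*=(f^{*i})_{i\le k}$ be a feasible rational target multicommodity flow; we also write $f^*_e=\sum_i f^{*i}_e$. Each edge $e$ has an unknown delay function $l^*_e:\mathbb R_{\ge 0}\to\mathbb R_{\ge 0}$, continuous and strictly increasing. For tolls $\tau\in\mathbb{R}_{\ge0}^E$, a Wardrop equilibrium is a feasible flow $g$ such that for every commodity $i$ and all $s_i$-$t_i$ paths $P,Q$ with $g^i_e>0$ for all $e\in P$ we have $\sum_{e\in P}(l^*_e(g_e)+\tau_e)\le\sum_{e\in Q}(l^*_e(g_e)+\tau_e)$; its total-flow vector $(g_e)_e$ is unique and is denoted $f(l^*,\tau)$. The tolls $\tau$ *induce* $f^*$ if $f(l^*,\tau)_e=f^*_e$ for all $e$. The oracle receives nonnegative rational tolls $\tau$ and returns the exact vector $f(l^*,\tau)$; its entries may be irrational, and the algorithm may compare them with rational numbers. Apart from this, running time is counted in bit operations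 on rational data. The algorithm is given $G$, $s$, $t$, $(s_i,t_i,d_i)_i$, $f^*$ and an integer $U\ge1$ (in binary) bounding the accuracy of the unknown data, and has access to the oracle, but not to $l^*$. **Theorem.** 1. There are an oracle algorithm, a polynomial $p$ and a constant $C$ such that for every such instance in which, for any two $s$-$t$ paths $P,Q$, the difference $\sum_{e\in P}l^*_e(f^*_e)-\sum_{e\in Q}l^*_e(f^*_e)$ is an integer multiple of $1/U$ of absolute value at most $mU$ (for example, whenever every $l^*_e(f^*_e)$ is a multiple of $1/U$ in $[0,U]$), the algorithm computes nonnegative rational tolls that induce $f^*$, in time at most $p(\text{input length})$ and with at most $C\,m\,(1+\lfloor\log_2(mU)\rfloor)=\tilde O(m)$ oracle queries. 2. The same holds (with some algorithm, polynomial and constant) for standard linear delay functions, that is, whenever $l^*_e(x)=a_ex+b_e$ with $a_e\in(0,U]$, $b_e\in[0,U]$, $f^*_e\in[0,U]$, and all $a_e,b_e,f^*_e$ are multiples of $1/U$. -/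

import Mathlib

namespace SepaTolls

/-! ### Networks, series-parallel graphs, routing games -/

/-- A finite directed multigraph with nodes `Fin n` and edges `Fin m`. -/
structure Network where
  n : ℕ
  m : ℕ
  tail : Fin m → Fin n
  head : Fin m → Fin n

/-- The nodes incident to an edge of `A`. -/
def Network.verts (G : Network) (A : Finset (Fin G.m)) : Finset (Fin G.n) :=
  A.image G.tail ∪ A.image G.head

/-- `G.SepaPart A s t`: the edges in `A`, with their end nodes, form a two-terminal directed
series-parallel graph with terminals `s` and `t`. -/
inductive Network.SepaPart (G : Network) : Finset (Fin G.m) → Fin G.n → Fin G.n → Prop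
  | edge (e : Fin G.m) : G.tail e ≠ G.head e → G.SepaPart {e} (G.tail e) (G.head e)
  | series {A B : Finset (Fin G.m)} {s v t : Fin G.n} :
      G.SepaPart A s v → G.SepaPart B v t → Disjoint A B →
      G.verts A ∩ G.verts B = {v} → G.SepaPart (A ∪ B) s t
  | parallel {A B : Finset (Fin G.m)} {s t : Fin G.n} :
      G.SepaPart A s t → G.SepaPart B s t → Disjoint A B →
      G.verts A ∩ G.verts B = {s, t} → G.SepaPart (A ∪ B) s t

/-- `G` is a two-terminal directed series-parallel graph with terminals `s` and `t`. -/
def Network.IsSepa (G : Network) (s t : Fin G.n) : Prop :=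
  G.SepaPart Finset.univ s t ∧ G.verts Finset.univ = Finset.univ

/-- `G.IsPath u v P`: the edge list `P` is a directed path from `u` to `v`. (Series-parallel graphs
are acyclic, so no node can be visited twice.) -/
inductive Network.IsPath (G : Network) : Fin G.n → Fin G.n → List (Fin G.m) → Prop
  | nil (v : Fin G.n) : G.IsPath v v []
  | cons (e : Fin G.m) {w : Fin G.n} {P : List (Fin G.m)} :
      G.IsPath (G.head e) w P → G.IsPath (G.tail e) w (e :: P)

/-- Total cost of a path under the edge costs `c`. -/
def pathCost {m : ℕ} (c : Fin m → ℝ) (P : List (Fin m)) : ℝ := (P.map c).sum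

/-- Flow leaving `v` minus flow entering `v`. -/
noncomputable def Network.netOut (G : Network) (h : Fin G.m → ℝ) (v : Fin G.n) : ℝ :=
  (∑ e with G.tail e = v, h e) - ∑ e with G.head e = v, h e

/-- What the algorithm is given: a network with two terminals, `k` commodities, a target
multicommodity flow, and the estimate `U` that bounds the encoding length of the unknown data. -/
structure Input where
  G : Network
  s : Fin G.n
  t : Fin G.n
  k : ℕ
  source : Fin k → Fin G.n
  sink : Fin k → Fin G.n
  demand : Fin k → ℚ
  target : Fin k → Fin G.m → ℚ
  U : ℕ

/-- A multicommodity flow that routes every commodity. -/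
def Input.Feasible (I : Input) (g : Fin I.k → Fin I.G.m → ℝ) : Prop :=
  ∀ i, (∀ e, 0 ≤ g i e) ∧
    (∀ v, v ≠ I.source i → v ≠ I.sink i → I.G.netOut (g i) v = 0) ∧
    I.G.netOut (g i) (I.source i) = I.demand i

/-- The total-flow vector of a multicommodity flow. -/
def total {k m : ℕ} (g : Fin k → Fin m → ℝ) (e : Fin m) : ℝ := ∑ i, g i e

/-- The target flow, with real values. -/
def Input.targetFlow (I : Input) : Fin I.k → Fin I.G.m → ℝ := fun i e => (I.target i e : ℝ)

/-- `g` is a Wardrop equilibrium of the routing game with delay functions `l`. -/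
def Input.IsWardrop (I : Input) (l : Fin I.G.m → ℝ → ℝ) (g : Fin I.k → Fin I.G.m → ℝ) : Prop :=
  I.Feasible g ∧
    ∀ i P Q, I.G.IsPath (I.source i) (I.sink i) P → I.G.IsPath (I.source i) (I.sink i) Q →
      (∀ e ∈ P, 0 < g i e) →
      pathCost (fun e => l e (total g e)) P ≤ pathCost (fun e => l e (total g e)) Q

/-- The delay functions after imposing the tolls `τ`. -/
def tolled {m : ℕ} (l : Fin m → ℝ → ℝ) (τ : Fin m → ℚ) : Fin m → ℝ → ℝ :=
  fun e x => l e x + (τ e : ℝ)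

/-- The tolls `τ` induce the target flow: the equilibrium exists, and its total flow is the target's
total flow on every edge. -/
def Input.Enforces (I : Input) (l : Fin I.G.m → ℝ → ℝ) (τ : Fin I.G.m → ℚ) : Prop :=
  (∃ g, I.IsWardrop (tolled l τ) g) ∧
    ∀ g, I.IsWardrop (tolled l τ) g → total g = total I.targetFlow

/-- `O` answers each vector of nonnegative rational tolls with the (total) equilibrium flow that
these tolls induce. -/
def Input.IsEquilibriumOracle (I : Input) (l : Fin I.G.m → ℝ → ℝ)
    (O : (Fin I.G.m → ℚ) → Fin I.G.m → ℝ) : Prop :=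
  ∀ τ, (∀ e, 0 ≤ τ e) → ∃ g, I.IsWardrop (tolled l τ) g ∧ total g = O τ

/-- Delay functions are nonnegative, continuous and strictly increasing on `[0, ∞)`. -/
def IsDelay (f : ℝ → ℝ) : Prop :=
  (∀ x, 0 ≤ x → 0 ≤ f x) ∧ ContinuousOn f (Set.Ici 0) ∧ StrictMonoOn f (Set.Ici 0)

/-- `x` is a nonnegative integer multiple of `1 / U` and at most `U`. -/
def HasGrid (U : ℕ) (x : ℝ) : Prop := 0 ≤ x ∧ x ≤ U ∧ ∃ z : ℤ, x = z / U

/-- A series-parallel network with nonnegative demands, a feasible target flow and `U ≥ 1`. -/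
def Input.Valid (I : Input) : Prop :=
  I.G.IsSepa I.s I.t ∧ (∀ i, 0 ≤ I.demand i) ∧ I.Feasible I.targetFlow ∧ 0 < I.U

/-- Encoding-length promise for arbitrary delay functions: at the target flow, the delays of any two
`s`-`t` paths differ by a multiple of `1 / U` and by at most `m * U`. This holds whenever each delay
`l e (f* e)` is a multiple of `1 / U` in `[0, U]`, and whenever some tolls that are multiples of
`1 / U` in `[0, U]` make all `s`-`t` paths equally costly at the target flow. -/
def Input.DelaysOnGrid (I : Input) (l : Fin I.G.m → ℝ → ℝ) : Prop :=
  ∀ P Q, I.G.IsPath I.s I.t P → I.G.IsPath I.s I.t Q →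
    ∃ z : ℤ, |z| ≤ I.G.m * I.U ^ 2 ∧
      pathCost (fun e => l e (total I.targetFlow e)) P -
        pathCost (fun e => l e (total I.targetFlow e)) Q = z / I.U

/-- Standard linear delay functions `a e * x + b e`, with a target flow of the same accuracy. -/
def Input.StandardLinear (I : Input) (l : Fin I.G.m → ℝ → ℝ) : Prop :=
  (∀ e, HasGrid I.U (total I.targetFlow e)) ∧
    ∃ a b : Fin I.G.m → ℝ, ∀ e, 0 < a e ∧ HasGrid I.U (a e) ∧ HasGrid I.U (b e) ∧
      ∀ x, 0 ≤ x → l e x = a e * x + b e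

/-! ### Oracle programs and their running time -/

/-- Data: rational numbers, exact real numbers as returned by the oracle, and nested pairs. -/
inductive Val where
  | nil : Val
  | num (q : ℚ) : Val
  | real (x : ℝ) : Val
  | pair (a b : Val) : Val

/-- Bit length of a datum. A real number is an opaque token: programs can move it and compare it with
rational numbers, and nothing else. -/
def Val.size : Val → ℕ
  | .nil => 1
  | .num q => 1 + Nat.size q.num.natAbs + Nat.size q.den
  | .real _ => 1
  | .pair a b => 1 + a.size + b.size

/-- Lists as nested pairs. -/
def Val.ofList : List Val → Val
  | [] => .nil
  | a :: as => .pair a (Val.ofList as)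

/-- Elementary operations. -/
inductive Prim where
  | ident | nil | const (q : ℚ) | fst | snd | isPair
  | add | sub | mul | div | floor | cmp

/-- `-1`, `0` or `1`, as `a < b`, `a = b` or `a > b`. -/
noncomputable def cmpReal (a b : ℝ) : ℚ := if a < b then -1 else if b < a then 1 else 0

/-- Effect of the elementary operations; the result is `nil` on ill-typed arguments. -/
noncomputable def Prim.eval : Prim → Val → Val
  | .ident, x => x
  | .nil, _ => .nil
  | .const q, _ => .num q
  | .fst, .pair a _ => a
  | .snd, .pair _ b => b
  | .isPair, .pair _ _ => .num 1
  | .isPair, _ => .num 0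
  | .add, .pair (.num a) (.num b) => .num (a + b)
  | .sub, .pair (.num a) (.num b) => .num (a - b)
  | .mul, .pair (.num a) (.num b) => .num (a * b)
  | .div, .pair (.num a) (.num b) => .num (a / b)
  | .floor, .num a => .num ⌊a⌋
  | .cmp, .pair (.num a) (.num b) => .num (cmpReal a b)
  | .cmp, .pair (.real a) (.num b) => .num (cmpReal a b)
  | _, _ => .nil

/-- Programs. A program transforms one datum: `pair p q` sends `x` to `(p x, q x)`, `comp p q` runs
`p` and then `q`, `ite c p q` and `loop c p` branch and iterate as long as the value of `c` is not the
number `0`, and `query` calls the oracle. -/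
inductive Prog where
  | prim (f : Prim)
  | pair (p q : Prog)
  | comp (p q : Prog)
  | ite (c p q : Prog)
  | loop (c p : Prog)
  | query

/-- A toll vector as a datum. -/
def tollVal {m : ℕ} (τ : Fin m → ℚ) : Val := Val.ofList (List.ofFn fun e => Val.num (τ e))

/-- An oracle answer as a datum. -/
def flowVal {m : ℕ} (x : Fin m → ℝ) : Val := Val.ofList (List.ofFn fun e => Val.real (x e))

/-- `Run O p x y t q`: with oracle `O`, program `p` halts on `x` with result `y`, in time `t` and with
`q` oracle queries. Every elementary operation and every query is charged for the bit length of the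
data that it reads and writes, so `t` bounds bit complexity up to a polynomial. A query must be a list
of `m` nonnegative rational tolls; otherwise the program is stuck. -/
inductive Run {m : ℕ} (O : (Fin m → ℚ) → Fin m → ℝ) : Prog → Val → Val → ℕ → ℕ → Prop
  | prim (f : Prim) (x : Val) :
      Run O (.prim f) x (f.eval x) (1 + x.size + (f.eval x).size) 0
  | pair {p q : Prog} {x y z : Val} {t t' a a' : ℕ} :
      Run O p x y t a → Run O q x z t' a' → Run O (.pair p q) x (.pair y z) (t + t' + 1) (a + a')
  | comp {p q : Prog} {x y z : Val} {t t' a a' : ℕ} :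
      Run O p x y t a → Run O q y z t' a' → Run O (.comp p q) x z (t + t' + 1) (a + a')
  | ite_true {c p q : Prog} {x b y : Val} {t t' a a' : ℕ} :
      Run O c x b t a → b ≠ .num 0 → Run O p x y t' a' →
      Run O (.ite c p q) x y (t + t' + 1) (a + a')
  | ite_false {c p q : Prog} {x y : Val} {t t' a a' : ℕ} :
      Run O c x (.num 0) t a → Run O q x y t' a' →
      Run O (.ite c p q) x y (t + t' + 1) (a + a')
  | loop_stop {c p : Prog} {x : Val} {t a : ℕ} :
      Run O c x (.num 0) t a → Run O (.loop c p) x x (t + 1) a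
  | loop_step {c p : Prog} {x b y z : Val} {t t' t'' a a' a'' : ℕ} :
      Run O c x b t a → b ≠ .num 0 → Run O p x y t' a' → Run O (.loop c p) y z t'' a'' →
      Run O (.loop c p) x z (t + t' + t'' + 1) (a + a' + a'')
  | query (τ : Fin m → ℚ) : (∀ e, 0 ≤ τ e) →
      Run O .query (tollVal τ) (flowVal (O τ)) (1 + (tollVal τ).size + (flowVal (O τ)).size) 1

/-- A node as a datum. -/
def nodeVal {n : ℕ} (v : Fin n) : Val := .num ((v : ℕ) : ℚ)

/-- The input as a datum: number of nodes, edge list, terminals, commodities, target flow (one list of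
edge values for each commodity) and `U`. -/
def Input.encode (I : Input) : Val :=
  Val.ofList
    [.num (I.G.n : ℚ),
     Val.ofList (List.ofFn fun e => Val.pair (nodeVal (I.G.tail e)) (nodeVal (I.G.head e))),
     nodeVal I.s,
     nodeVal I.t,
     Val.ofList (List.ofFn fun i =>
       Val.ofList [nodeVal (I.source i), nodeVal (I.sink i), .num (I.demand i)]),
     Val.ofList (List.ofFn fun i => tollVal (I.target i)),
     .num (I.U : ℚ)]

/-- On input `I`, with any equilibrium oracle for the unknown delay functions `l`, the program `A`
outputs nonnegative tolls that induce the target flow, in time at most `p` of the input length, with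
at most `C * m * (log₂ (m * U) + 1)` queries. -/
def Input.SolvedBy (I : Input) (l : Fin I.G.m → ℝ → ℝ) (A : Prog) (p : Polynomial ℕ) (C : ℕ) :
    Prop :=
  ∀ O, I.IsEquilibriumOracle l O →
    ∃ (τ : Fin I.G.m → ℚ) (time queries : ℕ),
      Run O A I.encode (tollVal τ) time queries ∧
      (∀ e, 0 ≤ τ e) ∧ I.Enforces l τ ∧
      time ≤ p.eval I.encode.size ∧
      queries ≤ C * I.G.m * (Nat.log 2 (I.G.m * I.U) + 1)

end SepaTolls

/-!
A two-terminal series-parallel network is described by a binary tree of series and parallel joins,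
and the tolls are found by one bisection for each parallel join.

*Tolls.* Call the first branch of a parallel join its reference branch, and the path that takes the
reference branch of every join the reference path. The *cut* of a subtree consists of the edges that
leave its source; every path through the subtree uses exactly one of them. With `M = m U²`, a
parallel join of `A` and `B` puts the constant `M (r_B + 1) / U` on the cut of `A` and `z / U` on
the cut of `B`, where `r_B` is the number of parallel joins inside `B` and `z` is a search variable
of the join. All paths through the network cost the same at the target flow if each `z` has the
value `U (l_A - l_B) + M (r_A + 1)`, where `l_A` and `l_B` are the delays of the reference paths of
the two branches. Those two paths are parts of two `s`-`t` paths that agree elsewhere, so by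
hypothesis `U (l_A - l_B)` is an integer of absolute value at most `M`, and the target value is a
natural number not exceeding `M (m + 1)` (`STree.IsTarget.exists_nat`). The offsets serve to make it
nonnegative.

*What a query tells.* The answer to a query determines the sign of the flow error, equilibrium minus
target, on each edge. The difference of two flows with the same demands is a circulation, so its
value on a subtree is the same on both parts of a series join, and it adds up over a parallel join.
A join *fires* if the sign on `B` is nonzero and differs from the sign on `A`. If no join inside a
subtree fires, then the error at the first edge of its reference path has the sign of the error of
its value, and there is no error at all inside if that value is zero. By monotonicity of the delays,
a positive value then makes every path through the subtree more expensive than at the target, and a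
negative value makes some path cheaper. For the innermost join that fires, this comparison, together
with the equilibrium condition, shows whether its variable is too small or too large
(`STree.quiet_or_first_fires`); the equilibrium condition applies since a branch with positive
error, or with error zero but used by the target flow, contains a cheapest path. The reference
branch is chosen so that the target flow uses it whenever it uses the other branch; this settles the
case where the error is zero on `A` but not on `B`. If no join fires at all, the value at the root
is zero, and the equilibrium flow is the target flow. Applied to two equilibria, the same argument
gives uniqueness of the equilibrium flow (`STree.total_eq_of_val_eq_zero`, `Partial.enforces`), so
that the tolls which were found induce the target flow, whatever equilibrium is considered.

*Number of queries.* Each query but the last halves the interval of one search variable. There are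
at most `m` variables, and each interval starts with length `M (m + 1) + 1`, so the total bit length
of the intervals bounds the number of queries (`Bracketed.step`, `exists_run_loop`).

*Finding the tree.* The tree is built by reductions: two items with the same ends are joined in
parallel, and two items that meet in an inner vertex with no other item are joined in series.
Reductions preserve series-parallel graphs, and each such graph with more than one edge admits one
(`SP.exists_reduction`). A list of polynomial length that contains every possible reduction often
enough therefore leads to a single item.

*Running time.* The predicate `PT` says that a program computes a function in polynomial time
without queries. It is closed under composition, pairing, case distinction and folds along a list
whose accumulator stays polynomially bounded; everything the algorithm computes is put together from
these.

*Standard linear delays.* If the coefficients and the target flow are multiples of `1 / U` in `[0,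
U]`, then delays at the target flow are multiples of `1 / U²` and at most `U² + U`. The algorithm
for the accuracy `2 U²` therefore applies (`exists_solver_linear`).
-/

namespace SepaTolls

/-! ### Encodings of data -/

/-- Types whose elements are represented as data of the programming language. -/
class Enc (α : Type) where
  enc : α → Val

instance : Enc ℚ := ⟨Val.num⟩
instance : Enc ℝ := ⟨Val.real⟩
instance : Enc ℕ := ⟨fun n => Val.num (n : ℚ)⟩
instance : Enc Bool := ⟨fun b => Val.num (if b then 1 else 0)⟩
instance : Enc Unit := ⟨fun _ => Val.nil⟩
instance {α β : Type} [Enc α] [Enc β] : Enc (α × β) := ⟨fun x => .pair (Enc.enc x.1) (Enc.enc x.2)⟩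
instance {α : Type} [Enc α] : Enc (List α) := ⟨fun l => Val.ofList (l.map Enc.enc)⟩

/-- Bit length of the encoding. -/
def sz {α : Type} [Enc α] (a : α) : ℕ := (Enc.enc a).size

open Enc (enc)

variable {α β γ δ σ : Type} [Enc α] [Enc β] [Enc γ] [Enc δ] [Enc σ]

theorem sz_pair (a : α) (b : β) : sz (a, b) = 1 + sz a + sz b := rfl

theorem sz_nil : sz ([] : List α) = 1 := rfl

theorem sz_cons (a : α) (l : List α) : sz (a :: l) = 1 + sz a + sz l := rfl

theorem sz_le_of_mem {a : α} {l : List α} (h : a ∈ l) : sz a ≤ sz l := by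
  induction l with
  | nil => simp at h
  | cons b l ih =>
    rw [sz_cons]
    rcases List.mem_cons.1 h with rfl | h
    · omega
    · have := ih h; omega

theorem length_le_sz (l : List α) : l.length ≤ sz l := by
  induction l with
  | nil => simp
  | cons b l ih => rw [sz_cons, List.length_cons]; omega

theorem sz_append (l l' : List α) : sz (l ++ l') + 1 = sz l + sz l' := by
  induction l with
  | nil => simp [sz_nil]; omega
  | cons b l ih => simp only [List.cons_append, sz_cons]; omega

theorem sz_le_of_sublist {l l' : List α} (h : l.Sublist l') : sz l ≤ sz l' := by
  induction h with
  | slnil => exact le_rfl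
  | cons a _ ih => rw [sz_cons]; omega
  | cons_cons a _ ih => rw [sz_cons, sz_cons]; omega

theorem sz_le_of_isPrefix {l l' : List α} (h : l <+: l') : sz l ≤ sz l' :=
  sz_le_of_sublist h.sublist

theorem sz_list_le {l : List α} {b : ℕ} (h : ∀ a ∈ l, sz a ≤ b) :
    sz l ≤ 1 + l.length * (b + 1) := by
  induction l with
  | nil => simp [sz_nil]
  | cons a l ih =>
    have h1 := ih fun x hx => h x (List.mem_cons_of_mem _ hx)
    have h2 := h a List.mem_cons_self
    rw [sz_cons, List.length_cons, add_mul]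
    omega

theorem sz_reverse (l : List α) : sz l.reverse = sz l := by
  induction l with
  | nil => rfl
  | cons a l ih =>
    have := sz_append l.reverse [a]
    rw [List.reverse_cons, sz_cons]
    rw [sz_cons, sz_nil] at this
    omega

theorem sz_nat (n : ℕ) : sz n = 2 + Nat.size n := by
  have : sz n = 1 + Nat.size ((n : ℚ).num.natAbs) + Nat.size ((n : ℚ).den) := rfl
  rw [this]
  simp
  omega

theorem sz_nat_mono {a b : ℕ} (h : a ≤ b) : sz a ≤ sz b := by
  rw [sz_nat, sz_nat]
  have := Nat.size_le_size h
  omega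

theorem Nat.size_le_self' (n : ℕ) : Nat.size n ≤ n := by
  rw [Nat.size_le]; exact Nat.lt_two_pow_self

theorem sz_nat_le (n : ℕ) : sz n ≤ n + 2 := by
  rw [sz_nat]
  have := Nat.size_le_self' n
  omega

theorem sz_bool_le (b : Bool) : sz b ≤ 3 := by
  cases b <;> simp [sz, enc, Val.size]

/-! ### Polynomially bounded quantities -/

theorem eval_nat_mono (q : Polynomial ℕ) {a b : ℕ} (h : a ≤ b) : q.eval a ≤ q.eval b := by
  rw [Polynomial.eval_eq_sum, Polynomial.eval_eq_sum]
  exact Finset.sum_le_sum fun i _ => Nat.mul_le_mul_left _ (Nat.pow_le_pow_left h i)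

/-- `F` is bounded by a polynomial in the encoding length of its argument. -/
def PBdd (F : γ → ℕ) : Prop := ∃ q : Polynomial ℕ, ∀ c, F c ≤ q.eval (sz c)

theorem PBdd.mono {F F' : γ → ℕ} (h : PBdd F') (hle : ∀ c, F c ≤ F' c) : PBdd F := by
  obtain ⟨q, hq⟩ := h
  exact ⟨q, fun c => (hle c).trans (hq c)⟩

theorem PBdd.const (n : ℕ) : PBdd (fun _ : γ => n) := ⟨Polynomial.C n, fun c => by simp⟩

theorem PBdd.sz : PBdd (fun c : γ => sz c) := ⟨Polynomial.X, fun c => by simp⟩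

theorem PBdd.add {F F' : γ → ℕ} (h : PBdd F) (h' : PBdd F') : PBdd (fun c => F c + F' c) := by
  obtain ⟨q, hq⟩ := h
  obtain ⟨q', hq'⟩ := h'
  exact ⟨q + q', fun c => by rw [Polynomial.eval_add]; exact add_le_add (hq c) (hq' c)⟩

theorem PBdd.mul {F F' : γ → ℕ} (h : PBdd F) (h' : PBdd F') : PBdd (fun c => F c * F' c) := by
  obtain ⟨q, hq⟩ := h
  obtain ⟨q', hq'⟩ := h'
  exact ⟨q * q', fun c => by rw [Polynomial.eval_mul]; exact Nat.mul_le_mul (hq c) (hq' c)⟩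

theorem PBdd.eval {F : γ → ℕ} (h : PBdd F) (r : Polynomial ℕ) : PBdd (fun c => r.eval (F c)) := by
  obtain ⟨q, hq⟩ := h
  exact ⟨r.comp q, fun c => by rw [Polynomial.eval_comp]; exact eval_nat_mono r (hq c)⟩

/-! ### Polynomial-time functions -/

theorem Run.size_le {m : ℕ} {O : (Fin m → ℚ) → Fin m → ℝ} {p : Prog} {x y : Val} {t q : ℕ}
    (h : Run O p x y t q) : x.size ≤ t ∧ y.size ≤ t := by
  induction h with
  | prim f x => omega
  | query τ _ => omega
  | pair _ _ ih ih' =>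
    refine ⟨by omega, ?_⟩
    simp only [Val.size]
    omega
  | _ => omega

/-- `f` is computed by a program without oracle queries in polynomial time. -/
def PT (f : α → β) : Prop :=
  ∃ (P : Prog) (T : α → ℕ), PBdd T ∧
    ∀ (a : α) {m : ℕ} (O : (Fin m → ℚ) → Fin m → ℝ),
      ∃ t, t ≤ T a ∧ Run O P (enc a) (enc (f a)) t 0

/-- The output of a polynomial-time function has polynomial length. -/
theorem PT.pbdd {f : α → β} (h : PT f) : PBdd (fun a => sz (f a)) := by
  obtain ⟨P, T, hT, hP⟩ := h
  refine hT.mono fun a => ?_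
  obtain ⟨t, ht, hr⟩ := hP a (m := 0) (fun _ _ => 0)
  exact hr.size_le.2.trans ht

theorem PBdd.comp {F : β → ℕ} {f : α → β} (h : PBdd F) (hf : PT f) : PBdd (fun a => F (f a)) := by
  obtain ⟨q, hq⟩ := h
  exact (hf.pbdd.eval q).mono fun a => hq _

/-- A single elementary operation. -/
theorem PT.of_prim {f : α → β} (op : Prim) (h : ∀ a, op.eval (enc a) = enc (f a))
    (hsz : PBdd (fun a => sz (f a))) : PT f := by
  refine ⟨.prim op, fun a => 1 + sz a + sz (f a), ((PBdd.const 1).add PBdd.sz).add hsz,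
    fun a m O => ⟨_, le_rfl, ?_⟩⟩
  have := Run.prim (O := O) op (enc a)
  rw [h a] at this
  exact this

theorem PT.comp {g : β → γ} {f : α → β} (hg : PT g) (hf : PT f) : PT (fun a => g (f a)) := by
  obtain ⟨P, T, hT, hP⟩ := hf
  obtain ⟨P', T', hT', hP'⟩ := hg
  refine ⟨.comp P P', fun a => T a + T' (f a) + 1,
    (hT.add (hT'.comp ⟨P, T, hT, hP⟩)).add (PBdd.const 1), fun a m O => ?_⟩
  obtain ⟨t, ht, hr⟩ := hP a O
  obtain ⟨t', ht', hr'⟩ := hP' (f a) O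
  exact ⟨t + t' + 1, by simp only; omega, Run.comp hr hr'⟩

theorem PT.mk {f : α → β} {g : α → γ} (hf : PT f) (hg : PT g) : PT (fun a => (f a, g a)) := by
  obtain ⟨P, T, hT, hP⟩ := hf
  obtain ⟨P', T', hT', hP'⟩ := hg
  refine ⟨.pair P P', fun a => T a + T' a + 1, (hT.add hT').add (PBdd.const 1), fun a m O => ?_⟩
  obtain ⟨t, ht, hr⟩ := hP a O
  obtain ⟨t', ht', hr'⟩ := hP' a O
  exact ⟨t + t' + 1, by simp only; omega, Run.pair hr hr'⟩

theorem PT.id : PT (fun a : α => a) := PT.of_prim .ident (fun _ => rfl) PBdd.sz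

/-- Types with the same encoding may be exchanged. -/
theorem PT.cast {f : α → β} (h : ∀ a, enc (f a) = enc a) : PT f :=
  PT.of_prim .ident (fun a => (h a).symm) (PBdd.sz.mono fun a => by simp only [SepaTolls.sz, h]; rfl)

theorem PT.of_eq {f g : α → β} (hf : PT f) (h : ∀ a, f a = g a) : PT g :=
  (funext h : f = g) ▸ hf

theorem PT.fst' : PT (fun a : α × β => a.1) :=
  PT.of_prim .fst (fun _ => rfl) (PBdd.sz.mono fun a => by
    obtain ⟨x, y⟩ := a
    rw [sz_pair]; simp only; omega)

theorem PT.snd' : PT (fun a : α × β => a.2) :=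
  PT.of_prim .snd (fun _ => rfl) (PBdd.sz.mono fun a => by
    obtain ⟨x, y⟩ := a
    rw [sz_pair]; simp only; omega)

theorem PT.fst {f : α → β × γ} (h : PT f) : PT (fun a => (f a).1) := PT.fst'.comp h

theorem PT.snd {f : α → β × γ} (h : PT f) : PT (fun a => (f a).2) := PT.snd'.comp h

theorem PT.constRat (q : ℚ) : PT (fun _ : α => q) :=
  PT.of_prim (.const q) (fun _ => rfl) (PBdd.const _)

theorem PT.constNat (n : ℕ) : PT (fun _ : α => n) :=
  PT.of_prim (.const n) (fun _ => rfl) (PBdd.const _)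

theorem PT.constBool (b : Bool) : PT (fun _ : α => b) :=
  PT.of_prim (.const (if b then 1 else 0)) (fun _ => rfl) (PBdd.const _)

theorem PT.nil : PT (fun _ : α => ([] : List β)) :=
  PT.of_prim .nil (fun _ => rfl) (PBdd.const _)

theorem PT.cons {f : α → β} {g : α → List β} (hf : PT f) (hg : PT g) :
    PT (fun a => f a :: g a) :=
  (PT.cast (α := β × List β) (f := fun x => x.1 :: x.2) fun _ => rfl).comp (hf.mk hg)

theorem PT.ite {b : α → Bool} {f g : α → β} (hb : PT b) (hf : PT f) (hg : PT g) :
    PT (fun a => if b a then f a else g a) := by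
  obtain ⟨B, Tb, hTb, hB⟩ := hb
  obtain ⟨P, T, hT, hP⟩ := hf
  obtain ⟨P', T', hT', hP'⟩ := hg
  refine ⟨.ite B P P', fun a => Tb a + (T a + T' a) + 1, (hTb.add (hT.add hT')).add (PBdd.const 1),
    fun a m O => ?_⟩
  obtain ⟨tb, htb, hrb⟩ := hB a O
  cases hba : b a with
  | true =>
    obtain ⟨t, ht, hr⟩ := hP a O
    refine ⟨tb + t + 1, by simp only; omega, ?_⟩
    rw [hba] at hrb
    simpa [hba] using Run.ite_true (q := P') hrb (by simp [enc]) hr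
  | false =>
    obtain ⟨t, ht, hr⟩ := hP' a O
    refine ⟨tb + t + 1, by simp only; omega, ?_⟩
    rw [hba] at hrb
    have hrb' : Run O B (enc a) (.num 0) tb 0 := by simpa [enc] using hrb
    simpa [hba] using Run.ite_false (p := P) hrb' hr

/-! ### Arithmetic -/

theorem Nat.size_mul_le (a b : ℕ) : Nat.size (a * b) ≤ Nat.size a + Nat.size b := by
  rw [Nat.size_le, pow_add]
  exact Nat.mul_lt_mul'' (Nat.lt_size_self a) (Nat.lt_size_self b)

theorem Nat.size_add_le (a b : ℕ) : Nat.size (a + b) ≤ max (Nat.size a) (Nat.size b) + 1 := by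
  rw [Nat.size_le, pow_succ]
  have h1 := (Nat.lt_size_self a).trans_le
    (Nat.pow_le_pow_right two_pos (le_max_left (Nat.size a) (Nat.size b)))
  have h2 := (Nat.lt_size_self b).trans_le
    (Nat.pow_le_pow_right two_pos (le_max_right (Nat.size a) (Nat.size b)))
  omega

theorem sz_rat (q : ℚ) : sz q = 1 + Nat.size q.num.natAbs + Nat.size q.den := rfl

/-- A fraction in lowest terms is no longer than any other fraction with the same value. -/
theorem sz_rat_le_of_eq_div {q : ℚ} {a : ℤ} {b : ℕ} (hb : b ≠ 0) (h : q = (a : ℚ) / b) :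
    sz q ≤ 1 + Nat.size a.natAbs + Nat.size b := by
  rw [sz_rat]
  have hb' : (b : ℤ) ≠ 0 := by exact_mod_cast hb
  have h' : q = Rat.divInt a (b : ℤ) := by rw [Rat.divInt_eq_div]; simpa using h
  have h1 : q.num.natAbs ≤ a.natAbs := by
    rcases eq_or_ne a 0 with ha | ha
    · subst ha; simp [h]
    · exact Nat.le_of_dvd (Int.natAbs_pos.2 ha)
        (Int.natAbs_dvd_natAbs.2 (by rw [h']; exact Rat.num_dvd a hb'))
  have h2 : q.den ≤ b := by
    refine Nat.le_of_dvd (Nat.pos_of_ne_zero hb) ?_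
    rw [h']
    exact_mod_cast Rat.den_dvd a b
  have := Nat.size_le_size h1
  have := Nat.size_le_size h2
  omega

theorem sz_rat_add (a b : ℚ) : sz (a + b) ≤ 2 * (sz a + sz b) + 2 := by
  have h : a + b = ((a.num * b.den + b.num * a.den : ℤ) : ℚ) / ((a.den * b.den : ℕ) : ℚ) := by
    have h1 : (a.den : ℚ) ≠ 0 := by exact_mod_cast a.den_nz
    have h2 : (b.den : ℚ) ≠ 0 := by exact_mod_cast b.den_nz
    conv_lhs => rw [← Rat.num_div_den a, ← Rat.num_div_den b]
    push_cast
    field_simp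
  have h0 := sz_rat_le_of_eq_div (Nat.mul_ne_zero a.den_nz b.den_nz) h
  have h1 : Nat.size (a.num * b.den + b.num * a.den : ℤ).natAbs ≤
      max (Nat.size (a.num.natAbs * b.den)) (Nat.size (b.num.natAbs * a.den)) + 1 := by
    refine le_trans (Nat.size_le_size ?_) (Nat.size_add_le _ _)
    refine (Int.natAbs_add_le _ _).trans ?_
    simp [Int.natAbs_mul]
  have h2 := Nat.size_mul_le a.num.natAbs b.den
  have h3 := Nat.size_mul_le b.num.natAbs a.den
  have h4 := Nat.size_mul_le a.den b.den
  rw [sz_rat a, sz_rat b]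
  omega

theorem sz_rat_mul (a b : ℚ) : sz (a * b) ≤ sz a + sz b := by
  have h : a * b = ((a.num * b.num : ℤ) : ℚ) / ((a.den * b.den : ℕ) : ℚ) := by
    have h1 : (a.den : ℚ) ≠ 0 := by exact_mod_cast a.den_nz
    have h2 : (b.den : ℚ) ≠ 0 := by exact_mod_cast b.den_nz
    conv_lhs => rw [← Rat.num_div_den a, ← Rat.num_div_den b]
    push_cast
    field_simp
  have h0 := sz_rat_le_of_eq_div (Nat.mul_ne_zero a.den_nz b.den_nz) h
  rw [Int.natAbs_mul] at h0
  have h2 := Nat.size_mul_le a.num.natAbs b.num.natAbs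
  have h4 := Nat.size_mul_le a.den b.den
  rw [sz_rat a, sz_rat b]
  omega

theorem sz_rat_div (a b : ℚ) : sz (a / b) ≤ sz a + sz b + 3 := by
  rcases eq_or_ne b 0 with hb | hb
  · subst hb
    rw [div_zero]
    have : sz (0 : ℚ) = 2 := by simp [sz_rat]
    omega
  have hbn : b.num.natAbs ≠ 0 := by simpa using hb
  have h : a / b = ((a.num * (b.num.sign * b.den) : ℤ) : ℚ) / ((a.den * b.num.natAbs : ℕ) : ℚ) := by
    have h1 : (a.den : ℚ) ≠ 0 := by exact_mod_cast a.den_nz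
    have h2 : (b.den : ℚ) ≠ 0 := by exact_mod_cast b.den_nz
    have h3 : (b.num.natAbs : ℚ) ≠ 0 := by exact_mod_cast hbn
    have h4 : (b.num : ℚ) ≠ 0 := by exact_mod_cast Rat.num_ne_zero.2 hb
    have h5 : (b.num.sign : ℚ) * b.num = b.num.natAbs := by
      have := Int.sign_mul_self_eq_natAbs b.num
      exact_mod_cast (congrArg (Int.cast : ℤ → ℚ) this).trans (Int.cast_natCast _)
    conv_lhs => rw [← Rat.num_div_den a, ← Rat.num_div_den b]
    push_cast
    rw [div_div_div_eq, div_eq_div_iff (by positivity) (by positivity), ← h5]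
    ring
  have h0 := sz_rat_le_of_eq_div (Nat.mul_ne_zero a.den_nz hbn) h
  have hs : (a.num * (b.num.sign * b.den) : ℤ).natAbs = a.num.natAbs * b.den := by
    have : b.num ≠ 0 := Rat.num_ne_zero.2 hb
    simp [Int.natAbs_mul, Int.natAbs_sign_of_ne_zero this]
  rw [hs] at h0
  have h2 := Nat.size_mul_le a.num.natAbs b.den
  have h4 := Nat.size_mul_le a.den b.num.natAbs
  rw [sz_rat a, sz_rat b]
  omega

theorem PT.ratAdd {f g : α → ℚ} (hf : PT f) (hg : PT g) : PT (fun a => f a + g a) :=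
  (PT.of_prim (f := fun x : ℚ × ℚ => x.1 + x.2) .add (fun _ => rfl)
    (((PBdd.const 2).mul PBdd.sz).add (PBdd.const 2) |>.mono fun x => by
      have := sz_rat_add x.1 x.2
      obtain ⟨a, b⟩ := x
      rw [sz_pair]; simp only at *; omega)).comp (hf.mk hg)

theorem PT.ratMul {f g : α → ℚ} (hf : PT f) (hg : PT g) : PT (fun a => f a * g a) :=
  (PT.of_prim (f := fun x : ℚ × ℚ => x.1 * x.2) .mul (fun _ => rfl)
    (PBdd.sz.mono fun x => by
      have := sz_rat_mul x.1 x.2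
      obtain ⟨a, b⟩ := x
      rw [sz_pair]; simp only at *; omega)).comp (hf.mk hg)

theorem PT.ratDiv {f g : α → ℚ} (hf : PT f) (hg : PT g) : PT (fun a => f a / g a) :=
  (PT.of_prim (f := fun x : ℚ × ℚ => x.1 / x.2) .div (fun _ => rfl)
    ((PBdd.sz.add (PBdd.const 2)).mono fun x => by
      have := sz_rat_div x.1 x.2
      obtain ⟨a, b⟩ := x
      rw [sz_pair]; simp only at *; omega)).comp (hf.mk hg)

theorem PT.natCast {f : α → ℕ} (hf : PT f) : PT (fun a => (f a : ℚ)) :=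
  (PT.cast (f := fun n : ℕ => (n : ℚ)) fun _ => rfl).comp hf

theorem PT.natOfRat {f : α → ℕ} (hf : PT (fun a => (f a : ℚ))) : PT f := hf

theorem PT.natAdd {f g : α → ℕ} (hf : PT f) (hg : PT g) : PT (fun a => f a + g a) :=
  PT.natOfRat (by simpa using hf.natCast.ratAdd hg.natCast)

theorem PT.natMul {f g : α → ℕ} (hf : PT f) (hg : PT g) : PT (fun a => f a * g a) :=
  PT.natOfRat (by simpa using hf.natCast.ratMul hg.natCast)

theorem PT.ratFloor {f : α → ℚ} (hf : PT f) : PT (fun a => ((⌊f a⌋ : ℤ) : ℚ)) := by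
  refine (PT.of_prim (f := fun q : ℚ => ((⌊q⌋ : ℤ) : ℚ)) .floor (fun _ => rfl)
    ((PBdd.sz.add (PBdd.const 1)).mono fun q => ?_)).comp hf
  have h1 : ⌊q⌋.natAbs ≤ q.num.natAbs := by
    have : ⌊q⌋ = q.num / q.den := by rw [← Rat.floor_def]; rfl
    rw [this]
    exact Int.natAbs_ediv_le_natAbs _ _
  have h2 := Nat.size_le_size h1
  rw [sz_rat, sz_rat]
  simp only [Rat.num_intCast, Rat.den_intCast, Nat.size_one]
  omega

theorem PT.half {f : α → ℕ} (hf : PT f) : PT (fun a => f a / 2) := by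
  refine PT.natOfRat ?_
  have h : ∀ a, ((f a / 2 : ℕ) : ℚ) = ((⌊(f a : ℚ) / 2⌋ : ℤ) : ℚ) := fun a => by
    have : ⌊(f a : ℚ) / 2⌋ = ((f a / 2 : ℕ) : ℤ) := by
      have := Rat.floor_intCast_div_natCast (f a : ℤ) 2
      push_cast at this ⊢
      exact this
    rw [this, Int.cast_natCast]
  simp only [h]
  exact (hf.natCast.ratDiv (PT.constRat 2)).ratFloor

theorem sz_cmp_le (a b : ℝ) : sz (cmpReal a b) ≤ 3 := by
  unfold cmpReal
  split_ifs <;> simp [sz_rat]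

theorem PT.cmpRat {f g : α → ℚ} (hf : PT f) (hg : PT g) :
    PT (fun a => cmpReal (f a) (g a)) :=
  (PT.of_prim (f := fun x : ℚ × ℚ => cmpReal x.1 x.2) .cmp (fun _ => rfl)
    ((PBdd.const 3).mono fun _ => sz_cmp_le _ _)).comp (hf.mk hg)

theorem PT.cmpRealRat {f : α → ℝ} {g : α → ℚ} (hf : PT f) (hg : PT g) :
    PT (fun a => cmpReal (f a) (g a)) :=
  (PT.of_prim (f := fun x : ℝ × ℚ => cmpReal x.1 x.2) .cmp (fun _ => rfl)
    ((PBdd.const 3).mono fun _ => sz_cmp_le _ _)).comp (hf.mk hg)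

/-! ### Boolean operations -/

theorem cmpReal_eq_zero_iff (a b : ℝ) : cmpReal a b = 0 ↔ a = b := by
  unfold cmpReal
  split_ifs with h h'
  · simp [h.ne]
  · simp [h'.ne']
  · simp [le_antisymm (not_lt.1 h') (not_lt.1 h)]

theorem cmpReal_eq_neg_one_iff (a b : ℝ) : cmpReal a b = -1 ↔ a < b := by
  unfold cmpReal
  split_ifs with h h'
  · simp [h]
  · simp only [h, iff_false]; norm_num
  · simp [h]

/-- Branching on whether a rational number is zero. -/
theorem PT.iteRat {b : α → ℚ} {f g : α → β} (hb : PT b) (hf : PT f) (hg : PT g) :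
    PT (fun a => if b a = 0 then g a else f a) := by
  obtain ⟨B, Tb, hTb, hB⟩ := hb
  obtain ⟨P, T, hT, hP⟩ := hf
  obtain ⟨P', T', hT', hP'⟩ := hg
  refine ⟨.ite B P P', fun a => Tb a + (T a + T' a) + 1, (hTb.add (hT.add hT')).add (PBdd.const 1),
    fun a m O => ?_⟩
  obtain ⟨tb, htb, hrb⟩ := hB a O
  by_cases hba : b a = 0
  · obtain ⟨t, ht, hr⟩ := hP' a O
    refine ⟨tb + t + 1, by simp only; omega, ?_⟩
    rw [hba] at hrb
    have hrb' : Run O B (enc a) (.num 0) tb 0 := by simpa [enc] using hrb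
    simpa [hba] using Run.ite_false (p := P) hrb' hr
  · obtain ⟨t, ht, hr⟩ := hP a O
    refine ⟨tb + t + 1, by simp only; omega, ?_⟩
    simpa [hba] using Run.ite_true (q := P') hrb (by simpa [enc] using hba) hr

theorem PT.ratEq {f g : α → ℚ} (hf : PT f) (hg : PT g) : PT (fun a => decide (f a = g a)) := by
  have := (PT.cmpRat hf hg).iteRat (PT.constBool false) (PT.constBool true)
  refine this.of_eq fun a => ?_
  by_cases h : f a = g a <;> simp [cmpReal_eq_zero_iff, h]

theorem PT.ratLt {f g : α → ℚ} (hf : PT f) (hg : PT g) : PT (fun a => decide (f a < g a)) := by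
  have := ((PT.cmpRat hf hg).ratAdd (PT.constRat 1)).iteRat (PT.constBool false) (PT.constBool true)
  refine this.of_eq fun a => ?_
  by_cases h : f a < g a <;>
    simp [← eq_neg_iff_add_eq_zero, cmpReal_eq_neg_one_iff, h]

theorem PT.natEq {f g : α → ℕ} (hf : PT f) (hg : PT g) : PT (fun a => decide (f a = g a)) := by
  simpa using hf.natCast.ratEq hg.natCast

theorem PT.and {f g : α → Bool} (hf : PT f) (hg : PT g) : PT (fun a => f a && g a) := by
  refine ((hf.ite hg (PT.constBool false))).of_eq fun a => ?_
  cases f a <;> simp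

theorem PT.or {f g : α → Bool} (hf : PT f) (hg : PT g) : PT (fun a => f a || g a) := by
  refine ((hf.ite (PT.constBool true) hg)).of_eq fun a => ?_
  cases f a <;> simp

theorem PT.not {f : α → Bool} (hf : PT f) : PT (fun a => !f a) := by
  refine ((hf.ite (PT.constBool false) (PT.constBool true))).of_eq fun a => ?_
  cases f a <;> simp

/-! ### Lists -/

/-- Case distinction on a list. -/
theorem PT.listCases {l : γ → List α} {f : γ → β} {g : γ × α × List α → β} (hl : PT l)
    (hf : PT f) (hg : PT g) :
    PT (fun c => match l c with
      | [] => f c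
      | a :: l' => g (c, a, l')) := by
  have hl0 := hl
  obtain ⟨L, Tl, hTl, hL⟩ := hl
  obtain ⟨P, T, hT, hP⟩ := hf
  obtain ⟨P', T', ⟨q, hq⟩, hP'⟩ := hg
  have hsz := PBdd.sz (γ := γ) |>.add hl0.pbdd
  refine ⟨.ite (.comp L (.prim .isPair)) (.comp (.pair (.prim .ident) L) P') P,
    fun c => (Tl c + (1 + sz (l c) + 3) + 1) + (T c + ((1 + sz c + sz c + Tl c + 1) +
      q.eval (1 + (sz c + sz (l c))) + 1)) + 1, ?_, fun c m O => ?_⟩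
  · refine PBdd.add (PBdd.add (PBdd.add (hTl.add ?_) (PBdd.const 1)) (hT.add ?_)) (PBdd.const 1)
    · exact ((PBdd.const 1).add hl0.pbdd).add (PBdd.const 3)
    · refine PBdd.add (PBdd.add ?_ (((PBdd.const 1).add hsz).eval q)) (PBdd.const 1)
      exact (((PBdd.const 1).add PBdd.sz).add PBdd.sz |>.add hTl).add (PBdd.const 1)
  obtain ⟨tl, htl, hrl⟩ := hL c O
  cases hlc : l c with
  | nil =>
    obtain ⟨t, ht, hr⟩ := hP c O
    rw [hlc] at hrl
    have h1 := Run.comp hrl (Run.prim .isPair (enc ([] : List α)))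
    have h2 := Run.ite_false (p := .comp (.pair (.prim .ident) L) P') h1 hr
    refine ⟨_, ?_, by simp only [hlc]; exact h2⟩
    have e1 : (enc ([] : List α)).size = 1 := rfl
    have e2 : (Prim.isPair.eval (enc ([] : List α))).size = 2 := by
      simp [enc, Prim.eval, Val.ofList, Val.size]
    simp only [e1, e2]
    omega
  | cons a l' =>
    rw [hlc] at hrl
    have h1 := Run.comp hrl (Run.prim .isPair (enc (a :: l')))
    have h3 := Run.pair (Run.prim (O := O) .ident (enc c)) hrl
    obtain ⟨t, ht, hr⟩ := hP' (c, a, l') O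
    have h4 := Run.comp h3 hr
    have h2 := Run.ite_true (q := P) h1 (by simp [enc, Prim.eval, Val.ofList]) h4
    simp only [Nat.add_zero] at h2
    refine ⟨_, ?_, by simp only [hlc]; exact h2⟩
    have e1 : (enc (a :: l')).size = sz (a :: l') := rfl
    have e2 : (Prim.isPair.eval (enc (a :: l'))).size = 3 := by
      simp [enc, Prim.eval, Val.ofList, Val.size]
    have e3 : (Prim.ident.eval (enc c)).size = sz c := rfl
    have e4 : (enc c).size = sz c := rfl
    have e5 := hq (c, a, l')
    rw [sz_pair, sz_pair, sz_cons] at *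
    simp only [e1, e2, e3, e4]
    have e7 : sz (l c) = 1 + sz a + sz l' := by rw [hlc, sz_cons]
    have e6 : q.eval (1 + sz c + (1 + sz a + sz l')) = q.eval (1 + (sz c + sz (l c))) := by
      rw [e7, add_assoc]
    omega

end SepaTolls
namespace SepaTolls
open Enc (enc)
variable {α β γ δ σ : Type} [Enc α] [Enc β] [Enc γ] [Enc δ] [Enc σ]

/-- The loop behind `PT.foldl`: the state is the context, the rest of the list and the accumulator. -/
theorem run_fold {step : γ × σ × α → σ} {S : Prog} {m : ℕ} {O : (Fin m → ℚ) → Fin m → ℝ}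
    {c : γ} {B b : ℕ}
    (hS : ∀ s a, sz s ≤ b → sz a ≤ b → ∃ t, t ≤ B ∧ Run O S (enc (c, s, a)) (enc (step (c, s, a))) t 0)
    (l : List α) (s : σ) (hl : sz l ≤ b) (hs : ∀ l', l' <+: l → sz (l'.foldl (fun s a => step (c, s, a)) s) ≤ b) :
    ∃ t, t ≤ (l.length + 1) * (100 * (sz c + b + 1) + B) ∧
      Run O (.loop (.comp (.comp (.prim .snd) (.prim .fst)) (.prim .isPair))
        (.pair (.prim .fst) (.pair (.comp (.comp (.prim .snd) (.prim .fst)) (.prim .snd))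
          (.comp (.pair (.prim .fst) (.pair (.comp (.prim .snd) (.prim .snd))
            (.comp (.comp (.prim .snd) (.prim .fst)) (.prim .fst)))) S))))
        (enc (c, l, s)) (enc (c, ([] : List α), l.foldl (fun s a => step (c, s, a)) s)) t 0 := by
  have hsnd : ∀ x y : Val, Run O (.prim .snd) (.pair x y) y (1 + (1 + x.size + y.size) + y.size) 0 :=
    fun x y => Run.prim .snd (.pair x y)
  have hfst : ∀ x y : Val, Run O (.prim .fst) (.pair x y) x (1 + (1 + x.size + y.size) + x.size) 0 :=
    fun x y => Run.prim .fst (.pair x y)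
  induction l generalizing s with
  | nil =>
    have h1 := Run.comp (Run.comp (hsnd (enc c) (.pair .nil (enc s))) (hfst .nil (enc s)))
      (Run.prim (O := O) .isPair .nil)
    have h2 := Run.loop_stop (p := (.pair (.prim .fst) (.pair (.comp (.comp (.prim .snd) (.prim .fst)) (.prim .snd))
          (.comp (.pair (.prim .fst) (.pair (.comp (.prim .snd) (.prim .snd))
            (.comp (.comp (.prim .snd) (.prim .fst)) (.prim .fst)))) S)))) h1
    refine ⟨_, ?_, h2⟩
    have e1 : (enc c).size = sz c := rfl
    have e2 : (enc s).size = sz s := rfl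
    have := hs [] List.nil_prefix
    simp only [List.foldl_nil] at this
    simp only [Val.size, e1, e2, Prim.eval, List.length_nil, Rat.num_zero, Rat.den_zero,
      Int.natAbs_zero, Nat.size_zero, Nat.size_one]
    omega
  | cons a l ih =>
    rw [sz_cons] at hl
    have hs0 := hs [] List.nil_prefix
    simp only [List.foldl_nil] at hs0
    obtain ⟨t, ht, hr⟩ := hS s a hs0 (by omega)
    obtain ⟨t', ht', hr'⟩ := ih (step (c, s, a)) (by omega) fun l' hl' => by
      have := hs (a :: l') (by simpa using hl')
      simpa using this
    have g := hsnd (enc c) (.pair (.pair (enc a) (enc l)) (enc s))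
    have g' := Run.comp g (hfst (.pair (enc a) (enc l)) (enc s))
    have h1 := Run.comp g' (Run.prim (O := O) .isPair (.pair (enc a) (enc l)))
    have h3 := Run.pair (hfst (enc c) (.pair (.pair (enc a) (enc l)) (enc s)))
      (Run.pair (Run.comp g' (hsnd (enc a) (enc l)))
        (Run.comp (Run.pair (hfst (enc c) (.pair (.pair (enc a) (enc l)) (enc s)))
          (Run.pair (Run.comp g (hsnd (.pair (enc a) (enc l)) (enc s)))
            (Run.comp g' (hfst (enc a) (enc l))))) hr))
    have h4 := Run.loop_step h1 (by simp [Prim.eval]) h3 hr'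
    refine ⟨_, ?_, h4⟩
    have e1 : (enc c).size = sz c := rfl
    have e2 : (enc s).size = sz s := rfl
    have e3 : (enc a).size = sz a := rfl
    have e4 : (enc l).size = sz l := rfl
    have e5 : (l.length + 1 + 1) * (100 * (sz c + b + 1) + B) =
      (l.length + 1) * (100 * (sz c + b + 1) + B) + (100 * (sz c + b + 1) + B) := by ring
    simp only [Val.size, e1, e2, e3, e4, Prim.eval, List.length_cons, Rat.num_one, Rat.den_one,
      Int.natAbs_one, Nat.size_one, e5]
    omega

/-- Iteration over a list. The accumulator has to stay of polynomial length. -/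
theorem PT.foldl {l : γ → List α} {i : γ → σ} {step : γ × σ × α → σ}
    (hl : PT l) (hi : PT i) (hstep : PT step) {F : γ → ℕ} (hF : PBdd F)
    (hbd : ∀ c l', l' <+: l c → sz (l'.foldl (fun s a => step (c, s, a)) (i c)) ≤ F c) :
    PT (fun c => (l c).foldl (fun s a => step (c, s, a)) (i c)) := by
  have hl0 := hl.pbdd
  have hi0 := hi.pbdd
  obtain ⟨L, Tl, hTl, hL⟩ := hl
  obtain ⟨J, Ti, hTi, hJ⟩ := hi
  obtain ⟨S, Ts, ⟨q, hq⟩, hS⟩ := hstep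
  let b : γ → ℕ := fun c => F c + sz (l c)
  let B : γ → ℕ := fun c => q.eval (1 + sz c + (1 + b c + b c))
  have hb : PBdd b := hF.add hl0
  have hB : PBdd B :=
    (((PBdd.const 1).add PBdd.sz).add (((PBdd.const 1).add hb).add hb)).eval q
  refine ⟨.comp (.comp (.pair (.prim .ident) (.pair L J)) (.loop (.comp (.comp (.prim .snd) (.prim .fst)) (.prim .isPair))
        (.pair (.prim .fst) (.pair (.comp (.comp (.prim .snd) (.prim .fst)) (.prim .snd))
          (.comp (.pair (.prim .fst) (.pair (.comp (.prim .snd) (.prim .snd))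
            (.comp (.comp (.prim .snd) (.prim .fst)) (.prim .fst)))) S)))))
        (.comp (.prim .snd) (.prim .snd)),
    fun c => (sz c + 1) * 20 + Tl c + Ti c + (sz (l c) + 1) * (100 * (sz c + b c + 1) + B c) + 20 * b c, ?_,
    fun c m O => ?_⟩
  · refine PBdd.add (PBdd.add (PBdd.add (PBdd.add ?_ hTl) hTi) ?_) ((PBdd.const 20).mul hb)
    · exact (PBdd.sz.add (PBdd.const 1)).mul (PBdd.const 20)
    · exact (hl0.add (PBdd.const 1)).mul
        (((PBdd.const 100).mul ((PBdd.sz.add hb).add (PBdd.const 1))).add hB)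
  obtain ⟨tl, htl, hrl⟩ := hL c O
  obtain ⟨ti, hti, hri⟩ := hJ c O
  obtain ⟨t, ht, hr⟩ := run_fold (O := O) (step := step) (S := S) (c := c) (B := B c) (b := b c)
    (fun s a hs ha => by
      obtain ⟨t, ht, hr⟩ := hS (c, s, a) O
      refine ⟨t, ht.trans ((hq _).trans (eval_nat_mono q ?_)), hr⟩
      rw [sz_pair, sz_pair]
      omega) (l c) (i c) (Nat.le_add_left _ _)
    (fun l' hl' => (hbd c l' hl').trans (Nat.le_add_right _ _))
  set r := (l c).foldl (fun s a => step (c, s, a)) (i c) with hrdef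
  have hrb : sz r ≤ b c := (hbd c (l c) List.prefix_rfl).trans (Nat.le_add_right _ _)
  have h1 := Run.comp (Run.comp (Run.pair (Run.prim (O := O) .ident (enc c)) (Run.pair hrl hri)) hr)
    (Run.comp (Run.prim .snd (enc (c, ([] : List α), r))) (Run.prim .snd (enc (([] : List α), r))))
  refine ⟨_, ?_, h1⟩
  have e1 : (enc c).size = sz c := rfl
  have e2 : (Prim.ident.eval (enc c)).size = sz c := rfl
  have e3 : (enc (c, ([] : List α), r)).size = 1 + sz c + (1 + 1 + sz r) := rfl
  have e4 : (enc (([] : List α), r)).size = 1 + 1 + sz r := rfl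
  have e5 : (Prim.snd.eval (enc (c, ([] : List α), r))).size = 1 + 1 + sz r := rfl
  have e6 : (Prim.snd.eval (enc (([] : List α), r))).size = sz r := rfl
  have e7 := Nat.mul_le_mul_right (100 * (sz c + b c + 1) + B c)
    (Nat.add_le_add_right (length_le_sz (l c)) 1)
  simp only [e1, e2, e3, e4, e5, e6]
  omega

theorem PT.reverse {l : γ → List α} (hl : PT l) : PT (fun c => (l c).reverse) := by
  have := (PT.foldl (γ := List α) (l := fun c => c) (i := fun _ => ([] : List α))
    (step := fun x => x.2.2 :: x.2.1) PT.id PT.nil (PT.id.snd.snd.cons PT.id.snd.fst)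
    (F := fun c => sz c) PBdd.sz (fun c l' hl' => ?_)).comp hl
  · simpa [List.foldl_flip_cons_eq_append] using this
  · have := sz_le_of_isPrefix hl'
    simp only [List.foldl_flip_cons_eq_append, List.append_nil]
    rw [List.map_id', sz_reverse]
    exact this

theorem PT.append {l l' : γ → List α} (hl : PT l) (hl' : PT l') : PT (fun c => l c ++ l' c) := by
  have := (PT.foldl (γ := List α × List α) (l := fun c => c.1) (i := fun c => c.2)
    (step := fun x => x.2.2 :: x.2.1) PT.id.fst PT.id.snd (PT.id.snd.snd.cons PT.id.snd.fst)
    (F := fun c => sz c) PBdd.sz (fun c l' hl' => ?_)).comp (hl.reverse.mk hl')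
  · simpa [List.foldl_flip_cons_eq_append] using this
  · obtain ⟨a, b⟩ := c
    have := sz_le_of_isPrefix hl'
    simp only [List.foldl_flip_cons_eq_append, List.map_id']
    have := sz_append l'.reverse b
    rw [sz_reverse] at this
    rw [sz_pair]
    simp only at *
    omega

theorem sz_flatMap_le {α β : Type} [Enc β] {f : α → List β} {b : ℕ} (l : List α) (h : ∀ a ∈ l, sz (f a) ≤ b) :
    sz (l.flatMap f) ≤ 1 + l.length * b := by
  induction l with
  | nil => simp [sz_nil]
  | cons a l ih =>
    have h1 := ih fun x hx => h x (List.mem_cons_of_mem _ hx)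
    have h2 := h a List.mem_cons_self
    have h3 := sz_append (f a) (l.flatMap f)
    rw [List.flatMap_cons, List.length_cons, add_mul]
    omega

theorem PT.flatMap {l : γ → List α} {f : γ × α → List β} (hl : PT l) (hf : PT f) :
    PT (fun c => (l c).flatMap fun a => f (c, a)) := by
  obtain ⟨q, hq⟩ := hf.pbdd
  have key : ∀ (c : γ) (l' : List α) (s : List β),
      l'.foldl (fun s a => s ++ f (c, a)) s = s ++ l'.flatMap fun a => f (c, a) := by
    intro c l'
    induction l' with
    | nil => simp
    | cons a l' ih => intro s; simp [ih]
  have := PT.foldl (γ := γ) (l := l) (i := fun _ => ([] : List β))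
    (step := fun x => x.2.1 ++ f (x.1, x.2.2)) hl PT.nil
    (PT.id.snd.fst.append (hf.comp (PT.id.fst.mk PT.id.snd.snd)))
    (F := fun c => 1 + sz (l c) * q.eval (1 + sz c + sz (l c)))
    ((PBdd.const 1).add (hl.pbdd.mul ((((PBdd.const 1).add PBdd.sz).add hl.pbdd).eval q)))
    (fun c l' hl' => ?_)
  · simpa only [key, List.nil_append] using this
  · simp only [key, List.nil_append]
    refine (sz_flatMap_le l' (b := q.eval (1 + sz c + sz (l c))) fun a ha => ?_).trans ?_
    · refine (hq _).trans (eval_nat_mono q ?_)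
      have := sz_le_of_mem (hl'.subset ha)
      rw [sz_pair]
      omega
    · have := Nat.mul_le_mul_right (q.eval (1 + sz c + sz (l c)))
        (hl'.length_le.trans (length_le_sz (l c)))
      omega

theorem PT.map {l : γ → List α} {f : γ × α → β} (hl : PT l) (hf : PT f) :
    PT (fun c => (l c).map fun a => f (c, a)) := by
  have := hl.flatMap (hf.cons PT.nil)
  simpa only [List.map_eq_flatMap] using this

theorem PT.filter {l : γ → List α} {f : γ × α → Bool} (hl : PT l) (hf : PT f) :
    PT (fun c => (l c).filter fun a => f (c, a)) := by
  have := hl.flatMap (hf.ite (PT.id.snd.cons PT.nil) PT.nil)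
  refine this.of_eq fun c => ?_
  induction l c with
  | nil => rfl
  | cons a l ih =>
    rw [List.flatMap_cons, ih, List.filter_cons]
    split_ifs <;> simp

theorem PT.any {l : γ → List α} {f : γ × α → Bool} (hl : PT l) (hf : PT f) :
    PT (fun c => (l c).any fun a => f (c, a)) := by
  have := (hl.filter hf).listCases (PT.constBool false) (PT.constBool (α := γ × α × List α) true)
  refine this.of_eq fun c => ?_
  induction l c with
  | nil => rfl
  | cons a l ih =>
    rw [List.filter_cons, List.any_cons, ← ih]
    cases f (c, a) <;> simp

/-- Membership in a list of natural numbers. -/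
theorem PT.natMem {l : γ → List ℕ} {x : γ → ℕ} (hl : PT l) (hx : PT x) :
    PT (fun c => decide (x c ∈ l c)) := by
  have := hl.any (f := fun y => decide (x y.1 = y.2)) ((hx.comp PT.id.fst).natEq PT.id.snd)
  refine this.of_eq fun c => ?_
  rw [Bool.eq_iff_iff]
  simp

theorem PT.length {l : γ → List α} (hl : PT l) : PT (fun c => (l c).length) := by
  have key : ∀ (l' : List α) (n : ℕ), l'.foldl (fun s _ => s + 1) n = n + l'.length := by
    intro l'
    induction l' with
    | nil => simp
    | cons a l' ih => intro n; simp [ih]; omega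
  have := PT.foldl (γ := γ) (l := l) (i := fun _ => 0) (step := fun x => x.2.1 + 1) hl
    (PT.constNat 0) (PT.id.snd.fst.natAdd (PT.constNat 1)) (F := fun c => sz (l c) + 2)
    (hl.pbdd.add (PBdd.const 2)) (fun c l' hl' => ?_)
  · simpa only [key, zero_add] using this
  · simp only [key, zero_add]
    have := sz_nat_le l'.length
    have := hl'.length_le
    have := length_le_sz (l c)
    omega

theorem PT.mapIdx {l : γ → List α} {f : γ × ℕ × α → β} (hl : PT l) (hf : PT f) :
    PT (fun c => (l c).mapIdx fun i a => f (c, i, a)) := by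
  obtain ⟨q, hq⟩ := hf.pbdd
  have key : ∀ (c : γ) (l' : List α), l'.foldl
      (fun (s : ℕ × List β) a => (s.1 + 1, f (c, s.1, a) :: s.2)) (0, []) =
      (l'.length, (l'.mapIdx fun i a => f (c, i, a)).reverse) := by
    intro c l'
    induction l' using List.reverseRecOn with
    | nil => simp
    | append_singleton l' a ih => simp [ih, List.mapIdx_append]
  have := (PT.foldl (γ := γ) (l := l) (i := fun _ => (0, ([] : List β)))
    (step := fun x => (x.2.1.1 + 1, f (x.1, x.2.1.1, x.2.2) :: x.2.1.2)) hl
    ((PT.constNat 0).mk PT.nil)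
    ((PT.id.snd.fst.fst.natAdd (PT.constNat 1)).mk
      ((hf.comp (PT.id.fst.mk (PT.id.snd.fst.fst.mk PT.id.snd.snd))).cons PT.id.snd.fst.snd))
    (F := fun c => 1 + (sz (l c) + 2) + (1 + sz (l c) *
      (q.eval (1 + sz c + (1 + (sz (l c) + 2) + sz (l c))) + 1)))
    (((PBdd.const 1).add (hl.pbdd.add (PBdd.const 2))).add ((PBdd.const 1).add
      (hl.pbdd.mul ((((((PBdd.const 1).add PBdd.sz).add (((PBdd.const 1).add (hl.pbdd.add
        (PBdd.const 2))).add hl.pbdd)).eval q)).add (PBdd.const 1)))))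
    (fun c l' hl' => ?_)).snd.reverse
  · simpa only [key, List.reverse_reverse] using this
  · have h1 := hl'.length_le
    have h2 := length_le_sz (l c)
    have h3 := sz_nat_le l'.length
    simp only [key, sz_pair, sz_reverse]
    have h4 := sz_list_le (l := l'.mapIdx fun i a => f (c, i, a))
      (b := q.eval (1 + sz c + (1 + (sz (l c) + 2) + sz (l c)))) fun a ha => by
        obtain ⟨i, hi, rfl⟩ := List.mem_mapIdx.1 ha
        refine (hq _).trans (eval_nat_mono q ?_)
        have h5 := sz_le_of_mem (hl'.subset (List.getElem_mem hi))
        have h6 := sz_nat_le i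
        rw [sz_pair, sz_pair]
        omega
    rw [List.length_mapIdx] at h4
    have h7 := Nat.mul_le_mul_right (q.eval (1 + sz c + (1 + (sz (l c) + 2) + sz (l c))) + 1)
      (h1.trans h2)
    omega

theorem PT.getD {l : γ → List α} {i : γ → ℕ} {d : γ → α} (hl : PT l) (hi : PT i) (hd : PT d) :
    PT (fun c => (l c).getD (i c) (d c)) := by
  have := ((hl.mapIdx (f := fun x => (x.2.1, x.2.2)) (PT.id.snd.fst.mk PT.id.snd.snd)).filter
    (f := fun x => decide (x.2.1 = i x.1)) (PT.id.snd.fst.natEq (hi.comp PT.id.fst))).listCases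
    hd (g := fun x => x.2.1.2) PT.id.snd.fst.snd
  refine this.of_eq fun c => ?_
  have key : ∀ (n k : ℕ) (l' : List α), ((l'.mapIdx fun j a => (j + k, a)).filter
      fun x => decide (x.1 = n + k)) = (l'[n]?).toList.map fun a => (n + k, a) := by
    intro n k l'
    induction l' generalizing n k with
    | nil => simp
    | cons a l' ih =>
      cases n with
      | zero =>
        simp only [List.mapIdx_cons, List.filter_cons, zero_add, decide_true, if_true,
          List.getElem?_cons_zero, Option.toList_some, List.map_cons, List.map_nil]
        congr 1
        rw [List.filter_eq_nil_iff]
        intro x hx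
        obtain ⟨j, hj, rfl⟩ := List.mem_mapIdx.1 hx
        simp
      | succ n =>
        have := ih n (k + 1)
        simp only [List.mapIdx_cons, List.filter_cons, List.getElem?_cons_succ]
        rw [if_neg (by simp)]
        have e : ∀ j : ℕ, j + 1 + k = j + (k + 1) := fun j => by omega
        simp only [e]
        exact this
  have h := key (i c) 0 (l c)
  simp only [add_zero] at h
  simp only [h]
  rw [List.getD_eq_getElem?_getD]
  cases (l c)[i c]? <;> simp

theorem PT.set {l : γ → List α} {i : γ → ℕ} {v : γ → α} (hl : PT l) (hi : PT i) (hv : PT v) :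
    PT (fun c => (l c).set (i c) (v c)) := by
  have := hl.mapIdx (f := fun x => if decide (i x.1 = x.2.1) then v x.1 else x.2.2)
    (((hi.comp PT.id.fst).natEq PT.id.snd.fst).ite (hv.comp PT.id.fst) PT.id.snd.snd)
  refine this.of_eq fun c => ?_
  apply List.ext_getElem?
  intro j
  rw [List.getElem?_mapIdx, List.getElem?_set]
  rcases h : (l c)[j]? with _ | a
  · have := List.getElem?_eq_none_iff.1 h
    split_ifs <;> simp
    omega
  · have := (List.getElem?_eq_some_iff.1 h).1
    split_ifs <;> simp_all

/-- Denominators multiply and absolute values add up, so the length of a sum is linear in the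
length of the list. -/
theorem sz_sum_le (l : List ℚ) : sz l.sum ≤ 3 * sz l + 3 := by
  have key : ∃ (a : ℤ) (b : ℕ), b ≠ 0 ∧ l.sum = (a : ℚ) / b ∧ Nat.size b ≤ sz l ∧
      a.natAbs ≤ 2 ^ sz l * b := by
    induction l with
    | nil => exact ⟨0, 1, one_ne_zero, by simp, by simp [sz_nil], by simp⟩
    | cons q l ih =>
      obtain ⟨a, b, hb, h, h1, h2⟩ := ih
      refine ⟨q.num * b + a * q.den, q.den * b, Nat.mul_ne_zero q.den_nz hb, ?_, ?_, ?_⟩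
      · rw [List.sum_cons, h]
        conv_lhs => rw [← Rat.num_div_den q]
        have h1 : (q.den : ℚ) ≠ 0 := by exact_mod_cast q.den_nz
        have h2 : (b : ℚ) ≠ 0 := by exact_mod_cast hb
        push_cast
        field_simp
      · have := Nat.size_mul_le q.den b
        rw [sz_cons, sz_rat]
        omega
      · have h3 : q.num.natAbs ≤ 2 ^ sz q := by
          refine (Nat.lt_size_self _).le.trans (Nat.pow_le_pow_right two_pos ?_)
          rw [sz_rat]; omega
        have h4 : 1 ≤ q.den := Nat.pos_of_ne_zero q.den_nz
        have h5 : (2 : ℕ) ^ sz q + 2 ^ sz l ≤ 2 ^ sz (q :: l) := by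
          rw [sz_cons]
          have e1 : (2 : ℕ) ^ sz q ≤ 2 ^ (sz q + sz l) := Nat.pow_le_pow_right two_pos (by omega)
          have e2 : (2 : ℕ) ^ sz l ≤ 2 ^ (sz q + sz l) := Nat.pow_le_pow_right two_pos (by omega)
          have e3 : (2 : ℕ) ^ (1 + sz q + sz l) = 2 * 2 ^ (sz q + sz l) := by
            rw [add_assoc, pow_add, pow_one]
          omega
        calc (q.num * b + a * q.den : ℤ).natAbs
            ≤ (q.num * b : ℤ).natAbs + (a * q.den : ℤ).natAbs := Int.natAbs_add_le _ _
          _ = q.num.natAbs * b + a.natAbs * q.den := by simp [Int.natAbs_mul]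
          _ ≤ 2 ^ sz q * (q.den * b) + (2 ^ sz l * b) * q.den := by
              gcongr
              exact Nat.le_mul_of_pos_left _ h4
          _ = (2 ^ sz q + 2 ^ sz l) * (q.den * b) := by ring
          _ ≤ 2 ^ sz (q :: l) * (q.den * b) := by gcongr
  obtain ⟨a, b, hb, h, h1, h2⟩ := key
  have h3 := sz_rat_le_of_eq_div hb h
  have h4 : Nat.size a.natAbs ≤ sz l + 1 + Nat.size b := by
    refine (Nat.size_le_size h2).trans ((Nat.size_mul_le _ _).trans ?_)
    rw [Nat.size_pow]
  omega

theorem PT.sum {l : γ → List ℚ} (hl : PT l) : PT (fun c => (l c).sum) := by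
  have := PT.foldl (γ := γ) (l := l) (i := fun _ => (0 : ℚ)) (step := fun x => x.2.1 + x.2.2) hl
    (PT.constRat 0) (PT.id.snd.fst.ratAdd PT.id.snd.snd) (F := fun c => 3 * sz (l c) + 3)
    (((PBdd.const 3).mul hl.pbdd).add (PBdd.const 3)) (fun c l' hl' => ?_)
  · simpa only [← List.sum_eq_foldl] using this
  · simp only [← List.sum_eq_foldl]
    have := sz_sum_le l'
    have := sz_le_of_isPrefix hl'
    omega

end SepaTolls
namespace SepaTolls

/-! ### Reductions of series-parallel graphs -/

section Reduction

variable {V : Type}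

/-- `x` is an end of an arc in `M`. -/
def On (x : V) (M : Multiset (V × V)) : Prop := ∃ a ∈ M, a.1 = x ∨ a.2 = x

theorem on_add {x : V} {A B : Multiset (V × V)} : On x (A + B) ↔ On x A ∨ On x B := by
  simp only [On, Multiset.mem_add, or_and_right, exists_or]

theorem on_cons {x u v : V} {A : Multiset (V × V)} :
    On x ((u, v) ::ₘ A) ↔ u = x ∨ v = x ∨ On x A := by
  simp [On, or_and_right, exists_or, or_assoc]

theorem on_singleton {x u v : V} : On x ({(u, v)} : Multiset (V × V)) ↔ u = x ∨ v = x := by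
  simp [On]

theorem not_on_zero {x : V} : ¬ On x (0 : Multiset (V × V)) := by simp [On]

/-- Multisets of arcs that form a two-terminal series-parallel graph. -/
inductive SP : Multiset (V × V) → V → V → Prop
  | edge {s t : V} : s ≠ t → SP {(s, t)} s t
  | ser {A B : Multiset (V × V)} {s x t : V} : SP A s x → SP B x t →
      (∀ y, On y A → On y B → y = x) → SP (A + B) s t
  | par {A B : Multiset (V × V)} {s t : V} : SP A s t → SP B s t →
      (∀ y, On y A → On y B → y = s ∨ y = t) → SP (A + B) s t

theorem SP.on {M : Multiset (V × V)} {s t : V} (h : SP M s t) : On s M ∧ On t M := by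
  induction h with
  | edge _ => simp [On]
  | ser _ _ _ ihA ihB => exact ⟨on_add.2 (.inl ihA.1), on_add.2 (.inr ihB.2)⟩
  | par _ _ _ ihA _ => exact ⟨on_add.2 (.inl ihA.1), on_add.2 (.inl ihA.2)⟩

theorem SP.ne {M : Multiset (V × V)} {s t : V} (h : SP M s t) : s ≠ t := by
  induction h with
  | edge h => exact h
  | ser hA hB hAB ihA ihB =>
    rintro rfl
    exact ihA (hAB _ hA.on.1 hB.on.2)
  | par _ _ _ ihA _ => exact ihA

theorem on_fst {M : Multiset (V × V)} {u v : V} (h : (u, v) ∈ M) : On u M := ⟨_, h, .inl rfl⟩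

theorem on_snd {M : Multiset (V × V)} {u v : V} (h : (u, v) ∈ M) : On v M := ⟨_, h, .inr rfl⟩

theorem SP.arc {M : Multiset (V × V)} {s t : V} (h : SP M s t) :
    ∀ u v, (u, v) ∈ M → u ≠ v ∧ v ≠ s ∧ u ≠ t := by
  induction h with
  | edge h =>
    intro u v huv
    simp only [Multiset.mem_singleton, Prod.mk.injEq] at huv
    obtain ⟨rfl, rfl⟩ := huv
    exact ⟨h, h.symm, h⟩
  | ser hA hB hAB ihA ihB =>
    intro u v huv
    rcases Multiset.mem_add.1 huv with huv | huv
    · refine ⟨(ihA u v huv).1, (ihA u v huv).2.1, ?_⟩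
      rintro rfl
      exact hB.ne (hAB _ (on_fst huv) hB.on.2).symm
    · refine ⟨(ihB u v huv).1, ?_, (ihB u v huv).2.2⟩
      rintro rfl
      exact hA.ne (hAB _ hA.on.1 (on_snd huv))
  | par hA hB hAB ihA ihB =>
    intro u v huv
    rcases Multiset.mem_add.1 huv with huv | huv
    · exact ihA u v huv
    · exact ihB u v huv

/-- Two distinguished elements of a sum: both left, both right, or one on each side. -/
theorem cons_cons_eq_add {α : Type} {a b : α} {M A B : Multiset α} (h : A + B = a ::ₘ b ::ₘ M) :
    (∃ A', A = a ::ₘ b ::ₘ A' ∧ M = A' + B) ∨ (∃ B', B = a ::ₘ b ::ₘ B' ∧ M = A + B') ∨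
    (∃ A' B', A = a ::ₘ A' ∧ B = b ::ₘ B' ∧ M = A' + B') ∨
    (∃ A' B', A = b ::ₘ A' ∧ B = a ::ₘ B' ∧ M = A' + B') := by
  have ha : a ∈ A + B := by rw [h]; exact Multiset.mem_cons_self _ _
  rcases Multiset.mem_add.1 ha with ha | ha
  · obtain ⟨A', rfl⟩ := Multiset.exists_cons_of_mem ha
    rw [Multiset.cons_add, Multiset.cons_inj_right] at h
    have hb : b ∈ A' + B := by rw [h]; exact Multiset.mem_cons_self _ _
    rcases Multiset.mem_add.1 hb with hb | hb
    · obtain ⟨A'', rfl⟩ := Multiset.exists_cons_of_mem hb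
      rw [Multiset.cons_add, Multiset.cons_inj_right] at h
      exact .inl ⟨A'', rfl, h.symm⟩
    · obtain ⟨B', rfl⟩ := Multiset.exists_cons_of_mem hb
      rw [Multiset.add_cons, Multiset.cons_inj_right] at h
      exact .inr (.inr (.inl ⟨A', B', rfl, rfl, h.symm⟩))
  · obtain ⟨B', rfl⟩ := Multiset.exists_cons_of_mem ha
    rw [Multiset.add_cons, Multiset.cons_inj_right] at h
    have hb : b ∈ A + B' := by rw [h]; exact Multiset.mem_cons_self _ _
    rcases Multiset.mem_add.1 hb with hb | hb
    · obtain ⟨A', rfl⟩ := Multiset.exists_cons_of_mem hb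
      rw [Multiset.cons_add, Multiset.cons_inj_right] at h
      exact .inr (.inr (.inr ⟨A', B', rfl, rfl, h.symm⟩))
    · obtain ⟨B'', rfl⟩ := Multiset.exists_cons_of_mem hb
      rw [Multiset.add_cons, Multiset.cons_inj_right] at h
      exact .inr (.inl ⟨B'', rfl, h.symm⟩)

theorem cons_eq_add {α : Type} {a : α} {M A B : Multiset α} (h : A + B = a ::ₘ M) :
    (∃ A', A = a ::ₘ A' ∧ M = A' + B) ∨ (∃ B', B = a ::ₘ B' ∧ M = A + B') := by
  have ha : a ∈ A + B := by rw [h]; exact Multiset.mem_cons_self _ _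
  rcases Multiset.mem_add.1 ha with ha | ha
  · obtain ⟨A', rfl⟩ := Multiset.exists_cons_of_mem ha
    rw [Multiset.cons_add, Multiset.cons_inj_right] at h
    exact .inl ⟨A', rfl, h.symm⟩
  · obtain ⟨B', rfl⟩ := Multiset.exists_cons_of_mem ha
    rw [Multiset.add_cons, Multiset.cons_inj_right] at h
    exact .inr ⟨B', rfl, h.symm⟩

theorem singleton_eq_cons {α : Type} {a b : α} {M : Multiset α} (h : {b} = a ::ₘ M) :
    a = b ∧ M = 0 := by
  have := congrArg Multiset.card h
  simp only [Multiset.card_singleton, Multiset.card_cons] at this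
  have hM : M = 0 := Multiset.card_eq_zero.1 (by omega)
  subst hM
  simpa [eq_comm] using h

/-- An arc between the terminals can be removed from a series-parallel graph with further arcs. -/
theorem SP.remove_terminal_arc {M : Multiset (V × V)} {s t : V} (h : SP M s t) :
    ∀ M', M = (s, t) ::ₘ M' → M' = 0 ∨ SP M' s t := by
  induction h with
  | edge h =>
    intro M' hM
    exact .inl (singleton_eq_cons hM).2
  | ser hA hB hAB ihA ihB =>
    intro M' hM
    exfalso
    rcases cons_eq_add hM with ⟨A', rfl, -⟩ | ⟨B', rfl, -⟩
    · exact hB.ne (hAB _ (on_snd (Multiset.mem_cons_self _ _)) hB.on.2).symm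
    · exact hA.ne (hAB _ hA.on.1 (on_fst (Multiset.mem_cons_self _ _)))
  | @par A B s t hA hB hAB ihA ihB =>
    intro M' hM
    right
    rcases cons_eq_add hM with ⟨A', rfl, rfl⟩ | ⟨B', rfl, rfl⟩
    · rcases ihA A' rfl with rfl | h
      · simpa using hB
      · exact h.par hB fun y h1 h2 => hAB y (on_cons.2 (.inr (.inr h1))) h2
    · rcases ihB B' rfl with rfl | h
      · simpa using hA
      · exact hA.par h fun y h1 h2 => hAB y h1 (on_cons.2 (.inr (.inr h2)))

/-- Merging two parallel arcs of a series-parallel graph leaves it series-parallel. -/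
theorem SP.merge_parallel {M : Multiset (V × V)} {s t : V} (h : SP M s t) :
    ∀ u v M', M = (u, v) ::ₘ (u, v) ::ₘ M' → SP ((u, v) ::ₘ M') s t := by
  have hon : ∀ {u v y : V} {A : Multiset (V × V)}, On y ((u, v) ::ₘ A) → On y ((u, v) ::ₘ (u, v) ::ₘ A) :=
    fun h => on_cons.2 (.inr (.inr h))
  induction h with
  | edge h =>
    intro u v M' hM
    simpa using (singleton_eq_cons hM).2
  | @ser A B s x t hA hB hAB ihA ihB =>
    intro u v M' hM
    have hsplit : ∀ A' B', A = (u, v) ::ₘ A' → B = (u, v) ::ₘ B' → False := by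
      rintro A' B' rfl rfl
      have h1 := hAB u (on_fst (Multiset.mem_cons_self _ _)) (on_fst (Multiset.mem_cons_self _ _))
      have h2 := hAB v (on_snd (Multiset.mem_cons_self _ _)) (on_snd (Multiset.mem_cons_self _ _))
      exact (hA.arc u v (Multiset.mem_cons_self _ _)).1 (h1.trans h2.symm)
    rcases cons_cons_eq_add hM with ⟨A', rfl, rfl⟩ | ⟨B', rfl, rfl⟩ | ⟨A', B', hA', hB', -⟩ |
      ⟨A', B', hA', hB', -⟩
    · rw [← Multiset.cons_add]
      exact (ihA u v A' rfl).ser hB fun y h1 h2 => hAB y (hon h1) h2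
    · rw [← Multiset.add_cons]
      exact hA.ser (ihB u v B' rfl) fun y h1 h2 => hAB y h1 (hon h2)
    · exact (hsplit A' B' hA' hB').elim
    · exact (hsplit A' B' hA' hB').elim
  | @par A B s t hA hB hAB ihA ihB =>
    intro u v M' hM
    have hsplit : ∀ A' B', A = (u, v) ::ₘ A' → B = (u, v) ::ₘ B' →
        SP ((u, v) ::ₘ (A' + B')) s t := by
      rintro A' B' rfl rfl
      have h1 := hAB u (on_fst (Multiset.mem_cons_self _ _)) (on_fst (Multiset.mem_cons_self _ _))
      have h2 := hAB v (on_snd (Multiset.mem_cons_self _ _)) (on_snd (Multiset.mem_cons_self _ _))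
      obtain ⟨-, h3, h4⟩ := hA.arc u v (Multiset.mem_cons_self _ _)
      obtain rfl := h1.resolve_right h4
      obtain rfl := h2.resolve_left h3
      rw [← Multiset.cons_add]
      rcases hB.remove_terminal_arc B' rfl with rfl | h
      · simpa using hA
      · exact hA.par h fun y h1 h2 => hAB y h1 (on_cons.2 (.inr (.inr h2)))
    rcases cons_cons_eq_add hM with ⟨A', rfl, rfl⟩ | ⟨B', rfl, rfl⟩ | ⟨A', B', hA', hB', rfl⟩ |
      ⟨A', B', hA', hB', rfl⟩
    · rw [← Multiset.cons_add]
      exact (ihA u v A' rfl).par hB fun y h1 h2 => hAB y (hon h1) h2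
    · rw [← Multiset.add_cons]
      exact hA.par (ihB u v B' rfl) fun y h1 h2 => hAB y h1 (hon h2)
    · exact hsplit A' B' hA' hB'
    · exact hsplit A' B' hA' hB'

/-- If a single arc enters the sink, it can be removed, unless it is the whole graph. -/
theorem SP.remove_last_arc {M : Multiset (V × V)} {s t : V} (h : SP M s t) :
    ∀ u M', M = (u, t) ::ₘ M' → ¬ On t M' → (M' = 0 ∧ u = s) ∨ SP M' s u := by
  induction h with
  | edge h =>
    intro u M' hM _
    have := singleton_eq_cons hM
    simp only [Prod.mk.injEq, and_true] at this
    exact .inl ⟨this.2, this.1⟩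
  | @ser A B s x t hA hB hAB ihA ihB =>
    intro u M' hM hon
    rcases cons_eq_add hM with ⟨A', rfl, rfl⟩ | ⟨B', rfl, rfl⟩
    · exact (hon (on_add.2 (.inr hB.on.2))).elim
    · right
      rcases ihB u B' rfl fun h => hon (on_add.2 (.inr h)) with ⟨rfl, rfl⟩ | h
      · simpa using hA
      · exact hA.ser h fun y h1 h2 => hAB y h1 (on_cons.2 (.inr (.inr h2)))
  | @par A B s t hA hB hAB ihA ihB =>
    intro u M' hM hon
    exfalso
    rcases cons_eq_add hM with ⟨A', rfl, rfl⟩ | ⟨B', rfl, rfl⟩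
    · exact hon (on_add.2 (.inr hB.on.2))
    · exact hon (on_add.2 (.inl hA.on.2))

/-- If a single arc leaves the source, it can be removed, unless it is the whole graph. -/
theorem SP.remove_first_arc {M : Multiset (V × V)} {s t : V} (h : SP M s t) :
    ∀ w M', M = (s, w) ::ₘ M' → ¬ On s M' → (M' = 0 ∧ w = t) ∨ SP M' w t := by
  induction h with
  | edge h =>
    intro u M' hM _
    have := singleton_eq_cons hM
    simp only [Prod.mk.injEq, true_and] at this
    exact .inl ⟨this.2, this.1⟩
  | @ser A B s x t hA hB hAB ihA ihB =>
    intro u M' hM hon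
    rcases cons_eq_add hM with ⟨A', rfl, rfl⟩ | ⟨B', rfl, rfl⟩
    · right
      rcases ihA u A' rfl fun h => hon (on_add.2 (.inl h)) with ⟨rfl, rfl⟩ | h
      · simpa using hB
      · exact h.ser hB fun y h1 h2 => hAB y (on_cons.2 (.inr (.inr h1))) h2
    · exact (hon (on_add.2 (.inl hA.on.1))).elim
  | @par A B s t hA hB hAB ihA ihB =>
    intro u M' hM hon
    exfalso
    rcases cons_eq_add hM with ⟨A', rfl, rfl⟩ | ⟨B', rfl, rfl⟩
    · exact hon (on_add.2 (.inr hB.on.1))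
    · exact hon (on_add.2 (.inl hA.on.1))

/-- Merging the two arcs at an inner node of degree two leaves the graph series-parallel. -/
theorem SP.merge_series {M : Multiset (V × V)} {s t : V} (h : SP M s t) :
    ∀ u v w M', M = (u, v) ::ₘ (v, w) ::ₘ M' → ¬ On v M' → v ≠ s → v ≠ t →
      SP ((u, w) ::ₘ M') s t := by
  have hon : ∀ {u v w y : V} {A : Multiset (V × V)}, On y ((u, w) ::ₘ A) →
      On y ((u, v) ::ₘ (v, w) ::ₘ A) := by
    intro u v w y A h
    simp only [on_cons] at h ⊢
    tauto
  induction h with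
  | edge h =>
    intro u v w M' hM
    simpa using (singleton_eq_cons hM).2
  | @ser A B s x t hA hB hAB ihA ihB =>
    intro u v w M' hM hv hvs hvt
    rcases cons_cons_eq_add hM with ⟨A', rfl, rfl⟩ | ⟨B', rfl, rfl⟩ | ⟨A', B', rfl, rfl, rfl⟩ |
      ⟨A', B', rfl, rfl, rfl⟩
    · rw [← Multiset.cons_add]
      refine (ihA u v w A' rfl (fun h => hv (on_add.2 (.inl h))) hvs ?_).ser hB
        fun y h1 h2 => hAB y (hon h1) h2
      rintro rfl
      exact hv (on_add.2 (.inr hB.on.1))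
    · rw [← Multiset.add_cons]
      refine hA.ser (ihB u v w B' rfl (fun h => hv (on_add.2 (.inr h))) ?_ hvt)
        fun y h1 h2 => hAB y h1 (hon h2)
      rintro rfl
      exact hv (on_add.2 (.inl hA.on.2))
    · have hvx := hAB v (on_snd (Multiset.mem_cons_self _ _)) (on_fst (Multiset.mem_cons_self _ _))
      subst hvx
      have huv := (hA.arc u v (Multiset.mem_cons_self _ _)).1
      have hvw := (hB.arc v w (Multiset.mem_cons_self _ _)).1
      have hvA : ¬ On v A' := fun h => hv (on_add.2 (.inl h))
      have hvB : ¬ On v B' := fun h => hv (on_add.2 (.inr h))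
      have huB : ∀ y, On y ((u, v) ::ₘ A') → y ≠ v → ¬ On y ((v, w) ::ₘ B') :=
        fun y h1 h2 h3 => h2 (hAB y h1 h3)
      have huw : u ≠ w := by
        rintro rfl
        exact huB u (on_fst (Multiset.mem_cons_self _ _)) huv (on_snd (Multiset.mem_cons_self _ _))
      have h1 : SP ((u, w) ::ₘ A') s w := by
        rcases hA.remove_last_arc u A' rfl hvA with ⟨rfl, rfl⟩ | h
        · simpa using SP.edge huw
        · rw [← Multiset.singleton_add, add_comm]
          refine h.ser (SP.edge huw) fun y h1 h2 => ?_
          rcases on_singleton.1 h2 with rfl | rfl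
          · rfl
          · exact (huB w (on_cons.2 (.inr (.inr h1))) hvw.symm (on_snd (Multiset.mem_cons_self _ _))).elim
      rw [← Multiset.cons_add]
      rcases hB.remove_first_arc w B' rfl hvB with ⟨rfl, rfl⟩ | h
      · simpa using h1
      · refine h1.ser h fun y h2 h3 => ?_
        rcases on_cons.1 h2 with rfl | h2 | h2
        · exact (huB u (on_fst (Multiset.mem_cons_self _ _)) huv (on_cons.2 (.inr (.inr h3)))).elim
        · exact h2.symm
        · have := hAB y (on_cons.2 (.inr (.inr h2))) (on_cons.2 (.inr (.inr h3)))
          subst this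
          exact (hvA h2).elim
    · have hvx := hAB v (on_fst (Multiset.mem_cons_self _ _)) (on_snd (Multiset.mem_cons_self _ _))
      exact ((hA.arc v w (Multiset.mem_cons_self _ _)).2.2 hvx).elim
  | @par A B s t hA hB hAB ihA ihB =>
    intro u v w M' hM hv hvs hvt
    rcases cons_cons_eq_add hM with ⟨A', rfl, rfl⟩ | ⟨B', rfl, rfl⟩ | ⟨A', B', rfl, rfl, rfl⟩ |
      ⟨A', B', rfl, rfl, rfl⟩
    · rw [← Multiset.cons_add]
      exact (ihA u v w A' rfl (fun h => hv (on_add.2 (.inl h))) hvs hvt).par hB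
        fun y h1 h2 => hAB y (hon h1) h2
    · rw [← Multiset.add_cons]
      exact hA.par (ihB u v w B' rfl (fun h => hv (on_add.2 (.inr h))) hvs hvt)
        fun y h1 h2 => hAB y h1 (hon h2)
    · have := hAB v (on_snd (Multiset.mem_cons_self _ _)) (on_fst (Multiset.mem_cons_self _ _))
      tauto
    · have := hAB v (on_fst (Multiset.mem_cons_self _ _)) (on_snd (Multiset.mem_cons_self _ _))
      tauto

/-- A series-parallel graph with more than one arc admits a parallel or a series reduction. -/
theorem SP.exists_reduction {M : Multiset (V × V)} {s t : V} (h : SP M s t) :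
    M = {(s, t)} ∨ (∃ u v M', M = (u, v) ::ₘ (u, v) ::ₘ M') ∨
      ∃ u v w M', M = (u, v) ::ₘ (v, w) ::ₘ M' ∧ ¬ On v M' ∧ v ≠ s ∧ v ≠ t := by
  induction h with
  | edge h => exact .inl rfl
  | @ser A B s x t hA hB hAB ihA ihB =>
    right
    rcases ihA with rfl | ⟨u, v, M', rfl⟩ | ⟨u, v, w, M', rfl, h1, h2, h3⟩
    · rcases ihB with rfl | ⟨u, v, M', rfl⟩ | ⟨u, v, w, M', rfl, h1, h2, h3⟩
      · exact .inr ⟨s, x, t, 0, rfl, not_on_zero, hA.ne.symm, hB.ne⟩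
      · exact .inl ⟨u, v, {(s, x)} + M', by rw [Multiset.add_cons, Multiset.add_cons]⟩
      · refine .inr ⟨u, v, w, {(s, x)} + M', by rw [Multiset.add_cons, Multiset.add_cons], ?_, ?_, h3⟩
        · rw [on_add]
          rintro (h | h)
          · exact h2 (hAB v h (on_snd (Multiset.mem_cons_self _ _)))
          · exact h1 h
        · rintro rfl
          exact h2 (hAB v (hA.on.1) (on_snd (Multiset.mem_cons_self _ _)))
    · exact .inl ⟨u, v, M' + B, by rw [Multiset.cons_add, Multiset.cons_add]⟩
    · refine .inr ⟨u, v, w, M' + B, by rw [Multiset.cons_add, Multiset.cons_add], ?_, h2, ?_⟩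
      · rw [on_add]
        rintro (h | h)
        · exact h1 h
        · exact h3 (hAB v (on_snd (Multiset.mem_cons_self _ _)) h)
      · rintro rfl
        exact h3 (hAB v (on_snd (Multiset.mem_cons_self _ _)) hB.on.2)
  | @par A B s t hA hB hAB ihA ihB =>
    right
    rcases ihA with rfl | ⟨u, v, M', rfl⟩ | ⟨u, v, w, M', rfl, h1, h2, h3⟩
    · rcases ihB with rfl | ⟨u, v, M', rfl⟩ | ⟨u, v, w, M', rfl, h1, h2, h3⟩
      · exact .inl ⟨s, t, 0, rfl⟩
      · exact .inl ⟨u, v, {(s, t)} + M', by rw [Multiset.add_cons, Multiset.add_cons]⟩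
      · refine .inr ⟨u, v, w, {(s, t)} + M', by rw [Multiset.add_cons, Multiset.add_cons], ?_, h2, h3⟩
        rw [on_add]
        rintro (h | h)
        · exact (hAB v h (on_snd (Multiset.mem_cons_self _ _))).elim h2 h3
        · exact h1 h
    · exact .inl ⟨u, v, M' + B, by rw [Multiset.cons_add, Multiset.cons_add]⟩
    · refine .inr ⟨u, v, w, M' + B, by rw [Multiset.cons_add, Multiset.cons_add], ?_, h2, h3⟩
      rw [on_add]
      rintro (h | h)
      · exact h1 h
      · exact (hAB v (on_snd (Multiset.mem_cons_self _ _)) h).elim h2 h3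

end Reduction

end SepaTolls
namespace SepaTolls

/-! ### Series-parallel networks -/

namespace Network

variable {G : Network}

theorem on_iff_mem_verts {A : Finset (Fin G.m)} {x : Fin G.n} :
    On x (A.val.map fun e => (G.tail e, G.head e)) ↔ x ∈ G.verts A := by
  simp only [On, verts, Multiset.mem_map, Finset.mem_union, Finset.mem_image, Finset.mem_val]
  constructor
  · rintro ⟨_, ⟨e, he, rfl⟩, h | h⟩
    · exact .inl ⟨e, he, h⟩
    · exact .inr ⟨e, he, h⟩
  · rintro (⟨e, he, h⟩ | ⟨e, he, h⟩)
    · exact ⟨_, ⟨e, he, rfl⟩, .inl h⟩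
    · exact ⟨_, ⟨e, he, rfl⟩, .inr h⟩

theorem SepaPart.sp {A : Finset (Fin G.m)} {s t : Fin G.n} (h : G.SepaPart A s t) :
    SP (A.val.map fun e => (G.tail e, G.head e)) s t := by
  induction h with
  | edge e he => simpa using SP.edge he
  | series _ _ hd hv ihA ihB =>
    rw [Finset.union_val, Multiset.add_eq_union_iff_disjoint.2 (Finset.disjoint_val.2 hd) |>.symm,
      Multiset.map_add]
    refine ihA.ser ihB fun y h1 h2 => ?_
    have := Finset.mem_inter.2 ⟨on_iff_mem_verts.1 h1, on_iff_mem_verts.1 h2⟩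
    rw [hv] at this
    simpa using this
  | parallel _ _ hd hv ihA ihB =>
    rw [Finset.union_val, Multiset.add_eq_union_iff_disjoint.2 (Finset.disjoint_val.2 hd) |>.symm,
      Multiset.map_add]
    refine ihA.par ihB fun y h1 h2 => ?_
    have := Finset.mem_inter.2 ⟨on_iff_mem_verts.1 h1, on_iff_mem_verts.1 h2⟩
    rw [hv] at this
    simpa using this

theorem IsPath.append {u v w : Fin G.n} {P Q : List (Fin G.m)} (hP : G.IsPath u v P)
    (hQ : G.IsPath v w Q) : G.IsPath u w (P ++ Q) := by
  induction hP with
  | nil v => exact hQ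
  | cons e _ ih => exact .cons e (ih hQ)

theorem IsPath.eq_of_nil {u v : Fin G.n} (h : G.IsPath u v []) : u = v := by
  cases h; rfl

theorem isPath_singleton (e : Fin G.m) : G.IsPath (G.tail e) (G.head e) [e] := .cons e (.nil _)

theorem verts_union (A B : Finset (Fin G.m)) : G.verts (A ∪ B) = G.verts A ∪ G.verts B := by
  ext x
  simp only [verts, Finset.mem_union, Finset.mem_image]
  constructor
  · rintro (⟨e, he | he, rfl⟩ | ⟨e, he | he, rfl⟩)
    · exact .inl (.inl ⟨e, he, rfl⟩)
    · exact .inr (.inl ⟨e, he, rfl⟩)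
    · exact .inl (.inr ⟨e, he, rfl⟩)
    · exact .inr (.inr ⟨e, he, rfl⟩)
  · rintro ((⟨e, he, rfl⟩ | ⟨e, he, rfl⟩) | (⟨e, he, rfl⟩ | ⟨e, he, rfl⟩))
    · exact .inl ⟨e, .inl he, rfl⟩
    · exact .inr ⟨e, .inl he, rfl⟩
    · exact .inl ⟨e, .inr he, rfl⟩
    · exact .inr ⟨e, .inr he, rfl⟩

theorem tail_mem_verts {A : Finset (Fin G.m)} {e : Fin G.m} (h : e ∈ A) : G.tail e ∈ G.verts A :=
  Finset.mem_union_left _ (Finset.mem_image_of_mem _ h)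

theorem head_mem_verts {A : Finset (Fin G.m)} {e : Fin G.m} (h : e ∈ A) : G.head e ∈ G.verts A :=
  Finset.mem_union_right _ (Finset.mem_image_of_mem _ h)

theorem SepaPart.terminals {A : Finset (Fin G.m)} {s t : Fin G.n} (h : G.SepaPart A s t) :
    s ∈ G.verts A ∧ t ∈ G.verts A := by
  obtain ⟨h1, h2⟩ := h.sp.on
  exact ⟨on_iff_mem_verts.1 h1, on_iff_mem_verts.1 h2⟩

theorem SepaPart.reach {A : Finset (Fin G.m)} {s t : Fin G.n} (h : G.SepaPart A s t) :
    ∀ w ∈ G.verts A, (∃ P, G.IsPath s w P) ∧ ∃ P, G.IsPath w t P := by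
  induction h with
  | edge e he =>
    intro w hw
    simp only [verts, Finset.image_singleton, Finset.mem_union, Finset.mem_singleton] at hw
    rcases hw with rfl | rfl
    · exact ⟨⟨_, .nil _⟩, ⟨_, isPath_singleton e⟩⟩
    · exact ⟨⟨_, isPath_singleton e⟩, ⟨_, .nil _⟩⟩
  | series hA hB _ _ ihA ihB =>
    intro w hw
    rw [verts_union, Finset.mem_union] at hw
    rcases hw with hw | hw
    · obtain ⟨h1, P, hP⟩ := ihA w hw
      obtain ⟨-, Q, hQ⟩ := ihB _ hB.terminals.1
      exact ⟨h1, _, hP.append hQ⟩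
    · obtain ⟨⟨P, hP⟩, h2⟩ := ihB w hw
      obtain ⟨⟨Q, hQ⟩, -⟩ := ihA _ hA.terminals.2
      exact ⟨⟨_, hQ.append hP⟩, h2⟩
  | parallel hA hB _ _ ihA ihB =>
    intro w hw
    rw [verts_union, Finset.mem_union] at hw
    exact hw.elim (ihA w) (ihB w)

/-- A series-parallel network has a height function that increases along every edge, with
prescribed values at the terminals. -/
theorem SepaPart.exists_height {A : Finset (Fin G.m)} {s t : Fin G.n} (h : G.SepaPart A s t) :
    ∀ a b : ℝ, a < b → ∃ π : Fin G.n → ℝ, π s = a ∧ π t = b ∧ ∀ e ∈ A, π (G.tail e) < π (G.head e) := by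
  induction h with
  | edge e he =>
    intro a b hab
    refine ⟨fun v => if v = G.tail e then a else b, by simp, by simp [he.symm], ?_⟩
    intro e' he'
    rw [Finset.mem_singleton] at he'
    subst he'
    simpa [he.symm] using hab
  | @series A B s v t hA hB _ hv ihA ihB =>
    intro a b hab
    obtain ⟨π, h1, h2, h3⟩ := ihA a ((a + b) / 2) (by linarith)
    obtain ⟨ρ, g1, g2, g3⟩ := ihB ((a + b) / 2) b (by linarith)
    have hB' : ∀ w ∈ G.verts B, (if w ∈ G.verts A then π w else ρ w) = ρ w := by
      intro w hw
      split_ifs with hwA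
      · have := Finset.mem_inter.2 ⟨hwA, hw⟩
        rw [hv, Finset.mem_singleton] at this
        rw [this, h2, g1]
      · rfl
    refine ⟨fun w => if w ∈ G.verts A then π w else ρ w, ?_, ?_, fun e he => ?_⟩
    · simp [hA.terminals.1, h1]
    · simp only
      rw [hB' _ hB.terminals.2, g2]
    · rcases Finset.mem_union.1 he with he | he
      · simpa [tail_mem_verts he, head_mem_verts he] using h3 e he
      · simp only
        rw [hB' _ (tail_mem_verts he), hB' _ (head_mem_verts he)]
        exact g3 e he
  | @parallel A B s t hA hB _ hv ihA ihB =>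
    intro a b hab
    obtain ⟨π, h1, h2, h3⟩ := ihA a b hab
    obtain ⟨ρ, g1, g2, g3⟩ := ihB a b hab
    have hB' : ∀ w ∈ G.verts B, (if w ∈ G.verts A then π w else ρ w) = ρ w := by
      intro w hw
      split_ifs with hwA
      · have := Finset.mem_inter.2 ⟨hwA, hw⟩
        rw [hv, Finset.mem_insert, Finset.mem_singleton] at this
        rcases this with rfl | rfl
        · rw [h1, g1]
        · rw [h2, g2]
      · rfl
    refine ⟨fun w => if w ∈ G.verts A then π w else ρ w, ?_, ?_, fun e he => ?_⟩
    · simp [hA.terminals.1, h1]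
    · simp only
      rw [hB' _ hB.terminals.2, g2]
    · rcases Finset.mem_union.1 he with he | he
      · simpa [tail_mem_verts he, head_mem_verts he] using h3 e he
      · simp only
        rw [hB' _ (tail_mem_verts he), hB' _ (head_mem_verts he)]
        exact g3 e he

/-- Series-parallel networks are acyclic. -/
theorem IsSepa.exists_rank {s t : Fin G.n} (h : G.IsSepa s t) :
    ∃ ρ : Fin G.n → ℕ, (∀ v, ρ v ≤ G.n) ∧ ∀ e, ρ (G.tail e) < ρ (G.head e) := by
  obtain ⟨π, -, -, hπ⟩ := h.1.exists_height 0 1 one_pos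
  refine ⟨fun v => (Finset.univ.filter fun w => π w < π v).card, fun v => ?_, fun e => ?_⟩
  · simpa using Finset.card_le_univ (Finset.univ.filter fun w => π w < π v)
  · have he := hπ e (Finset.mem_univ e)
    refine Finset.card_lt_card (Finset.ssubset_iff_of_subset ?_ |>.2 ⟨G.tail e, ?_, ?_⟩)
    · intro w hw
      simp only [Finset.mem_filter, Finset.mem_univ, true_and] at hw ⊢
      exact hw.trans he
    · simpa using he
    · simp

/-! ### Flows -/

theorem sum_netOut (h : Fin G.m → ℝ) : ∑ v, G.netOut h v = 0 := by
  simp only [netOut, Finset.sum_sub_distrib]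
  rw [Finset.sum_fiberwise, Finset.sum_fiberwise, sub_self]

theorem netOut_sub (h h' : Fin G.m → ℝ) (v : Fin G.n) :
    G.netOut (fun e => h e - h' e) v = G.netOut h v - G.netOut h' v := by
  simp only [netOut, Finset.sum_sub_distrib]
  ring

theorem netOut_sum {k : ℕ} (h : Fin k → Fin G.m → ℝ) (v : Fin G.n) :
    G.netOut (fun e => ∑ i, h i e) v = ∑ i, G.netOut (h i) v := by
  simp only [netOut, Finset.sum_sub_distrib]
  rw [Finset.sum_comm, Finset.sum_comm (s := Finset.univ.filter fun e => G.head e = v)]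

/-- If the net outflow is nonpositive away from `a`, every edge in the support of a nonnegative flow
is reached from `a` within the support. -/
theorem exists_path_to {h : Fin G.m → ℝ} (hh : ∀ e, 0 ≤ h e) {ρ : Fin G.n → ℕ}
    (hρ : ∀ e, ρ (G.tail e) < ρ (G.head e)) {a : Fin G.n}
    (hnet : ∀ v, v ≠ a → G.netOut h v ≤ 0) :
    ∀ (N : ℕ) (e : Fin G.m), ρ (G.tail e) < N → 0 < h e →
      ∃ P, G.IsPath a (G.tail e) P ∧ ∀ e' ∈ P, 0 < h e' := by
  intro N
  induction N with
  | zero => intro e he; omega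
  | succ N ih =>
    intro e he hpos
    by_cases hv : G.tail e = a
    · exact ⟨[], hv ▸ .nil _, by simp⟩
    · have h1 := hnet _ hv
      have h2 : h e ≤ ∑ e' with G.tail e' = G.tail e, h e' :=
        Finset.single_le_sum (fun e' _ => hh e') (by simp)
      have h3 : 0 < ∑ e' with G.head e' = G.tail e, h e' := by
        unfold netOut at h1; linarith
      obtain ⟨e', he', hpos'⟩ := Finset.exists_lt_of_sum_lt (f := fun _ => (0 : ℝ)) (by simpa using h3)
      rw [Finset.mem_filter] at he'
      obtain ⟨P, hP, hP'⟩ := ih e' (by have := hρ e'; rw [he'.2] at this; omega) hpos'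
      refine ⟨P ++ [e'], ?_, ?_⟩
      · have := hP.append (isPath_singleton e')
        rwa [he'.2] at this
      · intro x hx
        rcases List.mem_append.1 hx with hx | hx
        · exact hP' x hx
        · rw [List.mem_singleton.1 hx]; exact hpos'

theorem exists_path_from {h : Fin G.m → ℝ} (hh : ∀ e, 0 ≤ h e) {ρ : Fin G.n → ℕ}
    (hρ : ∀ e, ρ (G.tail e) < ρ (G.head e)) (hρ' : ∀ v, ρ v ≤ G.n) {b : Fin G.n}
    (hnet : ∀ v, v ≠ b → 0 ≤ G.netOut h v) :
    ∀ (N : ℕ) (e : Fin G.m), G.n - ρ (G.head e) < N → 0 < h e →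
      ∃ P, G.IsPath (G.head e) b P ∧ ∀ e' ∈ P, 0 < h e' := by
  intro N
  induction N with
  | zero => intro e he; omega
  | succ N ih =>
    intro e he hpos
    by_cases hv : G.head e = b
    · exact ⟨[], hv ▸ .nil _, by simp⟩
    · have h1 := hnet _ hv
      have h2 : h e ≤ ∑ e' with G.head e' = G.head e, h e' :=
        Finset.single_le_sum (fun e' _ => hh e') (by simp)
      have h3 : 0 < ∑ e' with G.tail e' = G.head e, h e' := by
        unfold netOut at h1; linarith
      obtain ⟨e', he', hpos'⟩ := Finset.exists_lt_of_sum_lt (f := fun _ => (0 : ℝ)) (by simpa using h3)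
      rw [Finset.mem_filter] at he'
      obtain ⟨P, hP, hP'⟩ := ih e' (by
        have h4 := hρ e'
        have h5 := hρ' (G.head e')
        rw [he'.2] at h4; omega) hpos'
      refine ⟨e' :: P, ?_, ?_⟩
      · have := hP.cons e'
        rwa [he'.2] at this
      · intro x hx
        rcases List.mem_cons.1 hx with rfl | hx
        · exact hpos'
        · exact hP' x hx

end Network

theorem pathCost_append {m : ℕ} (c : Fin m → ℝ) (P Q : List (Fin m)) :
    pathCost c (P ++ Q) = pathCost c P + pathCost c Q := by
  simp [pathCost]

theorem pathCost_cons {m : ℕ} (c : Fin m → ℝ) (e : Fin m) (Q : List (Fin m)) :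
    pathCost c (e :: Q) = c e + pathCost c Q := by
  simp [pathCost]

theorem pathCost_add {m : ℕ} (c c' : Fin m → ℝ) (P : List (Fin m)) :
    pathCost (fun e => c e + c' e) P = pathCost c P + pathCost c' P := by
  simp [pathCost, List.sum_map_add]

/-- Net outflows of a feasible flow are determined by the demands. -/
theorem Input.Feasible.netOut_eq {I : Input} {g : Fin I.k → Fin I.G.m → ℝ} (hg : I.Feasible g)
    (i : Fin I.k) (v : Fin I.G.n) :
    I.G.netOut (g i) v = (if v = I.source i then (I.demand i : ℝ) else 0) +
      if v = I.sink i ∧ I.sink i ≠ I.source i then -(I.demand i : ℝ) else 0 := by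
  obtain ⟨-, h1, h2⟩ := hg i
  by_cases hs : v = I.source i
  · subst hs
    rw [h2, if_pos rfl, if_neg (fun h => h.2 h.1.symm), add_zero]
  · rw [if_neg hs, zero_add]
    by_cases ht : v = I.sink i
    · subst ht
      rw [if_pos ⟨rfl, hs⟩]
      have h3 := Network.sum_netOut (g i)
      rw [← Finset.add_sum_erase _ _ (Finset.mem_univ (I.sink i)),
        ← Finset.add_sum_erase _ _ (Finset.mem_erase.2 ⟨Ne.symm hs, Finset.mem_univ (I.source i)⟩),
        h2, Finset.sum_eq_zero] at h3
      · linarith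
      · intro w hw
        simp only [Finset.mem_erase, Finset.mem_univ, and_true] at hw
        exact h1 w hw.1 hw.2
    · rw [if_neg (fun h => ht h.1), h1 v hs ht]

/-- The equilibrium condition passes to segments of paths. -/
theorem Input.IsWardrop.segment {I : Input} {s t : Fin I.G.n} (hG : I.G.IsSepa s t)
    (hdem : ∀ i, 0 ≤ I.demand i) {l : Fin I.G.m → ℝ → ℝ} {g : Fin I.k → Fin I.G.m → ℝ}
    (hg : I.IsWardrop l g) (i : Fin I.k) {u v : Fin I.G.n} {P Q : List (Fin I.G.m)}
    (hP0 : P ≠ []) (hP : I.G.IsPath u v P) (hQ : I.G.IsPath u v Q) (hpos : ∀ e ∈ P, 0 < g i e) :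
    pathCost (fun e => l e (total g e)) P ≤ pathCost (fun e => l e (total g e)) Q := by
  obtain ⟨ρ, hρ', hρ⟩ := hG.exists_rank
  have hd : (0 : ℝ) ≤ I.demand i := by exact_mod_cast hdem i
  have hh := (hg.1 i).1
  have hto : ∃ P₁, I.G.IsPath (I.source i) u P₁ ∧ ∀ e ∈ P₁, 0 < g i e := by
    cases hP with
    | nil => exact (hP0 rfl).elim
    | cons e _ =>
      refine Network.exists_path_to hh hρ (fun v hv => ?_) _ e (Nat.lt_succ_self _)
        (hpos e List.mem_cons_self)
      rw [hg.1.netOut_eq, if_neg hv]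
      split_ifs <;> linarith
  have hfrom : ∃ P₂, I.G.IsPath v (I.sink i) P₂ ∧ ∀ e ∈ P₂, 0 < g i e := by
    have hlast : ∀ {u v : Fin I.G.n} {P : List (Fin I.G.m)}, I.G.IsPath u v P → P ≠ [] →
        ∃ e ∈ P, I.G.head e = v := by
      intro u v P hP
      induction hP with
      | nil => intro h; exact (h rfl).elim
      | @cons e w P hP ih =>
        intro _
        by_cases h : P = []
        · subst h
          exact ⟨e, by simp, hP.eq_of_nil⟩
        · obtain ⟨e', he', h'⟩ := ih h
          exact ⟨e', List.mem_cons_of_mem _ he', h'⟩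
    obtain ⟨e, he, rfl⟩ := hlast hP hP0
    refine Network.exists_path_from hh hρ hρ' (fun v hv => ?_) _ e (Nat.lt_succ_self _) (hpos e he)
    rw [hg.1.netOut_eq, if_neg (c := v = I.sink i ∧ _) (fun h => hv h.1)]
    split_ifs <;> linarith
  obtain ⟨P₁, hP₁, hpos₁⟩ := hto
  obtain ⟨P₂, hP₂, hpos₂⟩ := hfrom
  have h := hg.2 i _ _ ((hP₁.append hP).append hP₂) ((hP₁.append hQ).append hP₂) (by
    intro e he
    rcases List.mem_append.1 he with he | he
    · rcases List.mem_append.1 he with he | he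
      · exact hpos₁ e he
      · exact hpos e he
    · exact hpos₂ e he)
  simp only [pathCost_append] at h
  linarith

/-- The differences of two feasible flows are circulations. -/
theorem Input.Feasible.netOut_sub {I : Input} {g h : Fin I.k → Fin I.G.m → ℝ} (hg : I.Feasible g)
    (hh : I.Feasible h) (i : Fin I.k) (v : Fin I.G.n) :
    I.G.netOut (fun e => g i e - h i e) v = 0 := by
  rw [Network.netOut_sub, hg.netOut_eq, hh.netOut_eq, sub_self]

end SepaTolls
namespace SepaTolls

/-! ### Decomposition trees -/

/-- Binary trees of series and parallel joins of edges. -/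
inductive STree (m : ℕ) where
  | leaf (e : Fin m) : STree m
  | ser (A B : STree m) : STree m
  | par (A B : STree m) : STree m

namespace STree

variable {m : ℕ}

/-- The edges of the tree. -/
def leaves : STree m → List (Fin m)
  | leaf e => [e]
  | ser A B => leaves A ++ leaves B
  | par A B => leaves A ++ leaves B

/-- The first edge of the reference path: this path takes the first branch of every parallel join. -/
def rep : STree m → Fin m
  | leaf e => e
  | ser A _ => rep A
  | par A _ => rep A

/-- The reference path. -/
def ref : STree m → List (Fin m)
  | leaf e => [e]
  | ser A B => ref A ++ ref B
  | par A _ => ref A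

/-- The edges that leave the source of the tree. Every path through the tree uses exactly one. -/
def cut : STree m → List (Fin m)
  | leaf e => [e]
  | ser A _ => cut A
  | par A B => cut A ++ cut B

/-- The number of parallel joins. -/
def npar : STree m → ℕ
  | leaf _ => 0
  | ser A B => npar A + npar B
  | par A B => npar A + npar B + 1

/-- The edge sequences of the paths from source to sink. -/
def paths : STree m → Set (List (Fin m))
  | leaf e => {[e]}
  | ser A B => {P | ∃ P₁ ∈ paths A, ∃ P₂ ∈ paths B, P = P₁ ++ P₂}
  | par A B => paths A ∪ paths B

/-- The value of a flow between the terminals of the tree, read off at the cut. -/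
def val (d : Fin m → ℝ) : STree m → ℝ
  | leaf e => d e
  | ser A _ => val d A
  | par A B => val d A + val d B

/-- Some path through the tree lies in the support of `h`. -/
def Used (h : Fin m → ℝ) (T : STree m) : Prop := ∃ P ∈ T.paths, ∀ e ∈ P, 0 < h e

theorem exists_mem_paths (T : STree m) : T.ref ∈ T.paths := by
  induction T with
  | leaf e => rfl
  | ser A B ihA ihB => exact ⟨_, ihA, _, ihB, rfl⟩
  | par A B ihA _ => exact .inl ihA

theorem ne_nil_of_mem_paths {T : STree m} : ∀ {P : List (Fin m)}, P ∈ T.paths → P ≠ [] := by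
  induction T with
  | leaf e => rintro P rfl; simp
  | ser A B ihA ihB =>
    rintro P ⟨P₁, h₁, P₂, -, rfl⟩
    simp [ihA h₁]
  | par A B ihA ihB =>
    rintro P (h | h)
    · exact ihA h
    · exact ihB h

theorem mem_leaves_of_mem_path {T : STree m} :
    ∀ {P : List (Fin m)}, P ∈ T.paths → ∀ e ∈ P, e ∈ T.leaves := by
  induction T with
  | leaf e => rintro P rfl; simp [leaves]
  | ser A B ihA ihB =>
    rintro P ⟨P₁, h₁, P₂, h₂, rfl⟩ e he
    rcases List.mem_append.1 he with he | he
    · exact List.mem_append_left _ (ihA h₁ e he)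
    · exact List.mem_append_right _ (ihB h₂ e he)
  | par A B ihA ihB =>
    rintro P (h | h) e he
    · exact List.mem_append_left _ (ihA h e he)
    · exact List.mem_append_right _ (ihB h e he)

theorem cut_subset (T : STree m) : ∀ e ∈ T.cut, e ∈ T.leaves := by
  induction T with
  | leaf e => simp [cut, leaves]
  | ser A B ihA ihB => exact fun e he => List.mem_append_left _ (ihA e he)
  | par A B ihA ihB =>
    intro e he
    rcases List.mem_append.1 he with he | he
    · exact List.mem_append_left _ (ihA e he)
    · exact List.mem_append_right _ (ihB e he)

theorem rep_mem_leaves (T : STree m) : T.rep ∈ T.leaves := by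
  induction T with
  | leaf e => simp [rep, leaves]
  | ser A B ihA _ => exact List.mem_append_left _ ihA
  | par A B ihA _ => exact List.mem_append_left _ ihA

theorem npar_lt_length (T : STree m) : T.npar < T.leaves.length := by
  induction T with
  | leaf e => simp [npar, leaves]
  | ser A B ihA ihB => simp only [npar, leaves, List.length_append]; omega
  | par A B ihA ihB => simp only [npar, leaves, List.length_append]; omega

theorem val_sum {k : ℕ} (d : Fin k → Fin m → ℝ) (T : STree m) :
    T.val (fun e => ∑ i, d i e) = ∑ i, T.val (d i) := by
  induction T with
  | leaf e => rfl
  | ser A B ihA _ => exact ihA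
  | par A B ihA ihB => simp only [val, ihA, ihB, Finset.sum_add_distrib]

theorem val_neg (d : Fin m → ℝ) (T : STree m) : T.val (fun e => -d e) = -T.val d := by
  induction T with
  | leaf e => rfl
  | ser A B ihA _ => exact ihA
  | par A B ihA ihB => simp only [val, ihA, ihB]; ring

variable {G : Network}

/-- The vertex in which the paths through the tree start. -/
def src (G : Network) : STree G.m → Fin G.n
  | leaf e => G.tail e
  | ser A _ => src G A
  | par A _ => src G A

/-- The vertex in which the paths through the tree end. -/
def snk (G : Network) : STree G.m → Fin G.n
  | leaf e => G.head e
  | ser _ B => snk G B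
  | par A _ => snk G A

/-- The tree describes joins in the network `G`: terminals match, and circulations of `G` have the
same value on both parts of a series join. Moreover, the first branch of a parallel join is used by
some commodity of the flow `h` if the second one is. -/
def Good (G : Network) {k : ℕ} (h : Fin k → Fin G.m → ℝ) : STree G.m → Prop
  | leaf _ => True
  | ser A B => Good G h A ∧ Good G h B ∧ snk G A = src G B ∧
      ∀ d : Fin G.m → ℝ, (∀ v, G.netOut d v = 0) → val d A = val d B
  | par A B => Good G h A ∧ Good G h B ∧ src G A = src G B ∧ snk G A = snk G B ∧
      ((∃ i, Used (h i) B) → ∃ i, Used (h i) A)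

variable {k : ℕ} {h : Fin k → Fin G.m → ℝ}

theorem Good.isPath {T : STree G.m} (hT : T.Good G h) :
    ∀ {P : List (Fin G.m)}, P ∈ T.paths → G.IsPath (T.src G) (T.snk G) P := by
  induction T with
  | leaf e => rintro P rfl; exact Network.isPath_singleton e
  | ser A B ihA ihB =>
    rintro P ⟨P₁, h₁, P₂, h₂, rfl⟩
    have h1 := ihA hT.1 h₁
    rw [hT.2.2.1] at h1
    exact h1.append (ihB hT.2.1 h₂)
  | par A B ihA ihB =>
    rintro P (hP | hP)
    · exact ihA hT.1 hP
    · have h1 := ihB hT.2.1 hP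
      rw [← hT.2.2.1, ← hT.2.2.2.1] at h1
      exact h1

/-- A circulation with positive value on `T` is positive along some path through `T`. -/
theorem Good.used_of_val_pos {T : STree G.m} (hT : T.Good G h) {d : Fin G.m → ℝ}
    (hd : ∀ v, G.netOut d v = 0) (hv : 0 < T.val d) : T.Used d := by
  induction T with
  | leaf e => exact ⟨[e], rfl, by simpa [val] using hv⟩
  | ser A B ihA ihB =>
    obtain ⟨P₁, h₁, g₁⟩ := ihA hT.1 hv
    obtain ⟨P₂, h₂, g₂⟩ := ihB hT.2.1 (by rw [← hT.2.2.2 d hd]; exact hv)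
    refine ⟨_, ⟨P₁, h₁, P₂, h₂, rfl⟩, fun e he => ?_⟩
    exact (List.mem_append.1 he).elim (g₁ e) (g₂ e)
  | par A B ihA ihB =>
    rcases lt_or_ge 0 (A.val d) with hA | hA
    · obtain ⟨P, hP, g⟩ := ihA hT.1 hA
      exact ⟨P, .inl hP, g⟩
    · obtain ⟨P, hP, g⟩ := ihB hT.2.1 (by simp only [val] at hv; linarith)
      exact ⟨P, .inr hP, g⟩

/-- If `h₀` uses `T` and the change from `h₀` to `g₀` does not lower the value on `T`, then `g₀`
uses `T`. -/
theorem Good.used_of_used {T : STree G.m} (hT : T.Good G h) {g₀ h₀ : Fin G.m → ℝ}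
    (hh : ∀ e, 0 ≤ h₀ e)
    (hd : ∀ v, G.netOut (fun e => g₀ e - h₀ e) v = 0) (hv : 0 ≤ T.val (fun e => g₀ e - h₀ e))
    (hu : T.Used h₀) : T.Used g₀ := by
  have hup : ∀ {S : STree G.m}, S.Good G h → 0 < S.val (fun e => g₀ e - h₀ e) → S.Used g₀ := by
    intro S hS hSv
    obtain ⟨P, hP, hP'⟩ := hS.used_of_val_pos hd hSv
    exact ⟨P, hP, fun e he => by have := hP' e he; have := hh e; linarith⟩
  induction T with
  | leaf e =>
    obtain ⟨P, rfl, hP⟩ := hu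
    refine ⟨[e], rfl, fun e' he' => ?_⟩
    rw [List.mem_singleton.1 he']
    have := hP e (by simp)
    simp only [val] at hv
    linarith
  | ser A B ihA ihB =>
    obtain ⟨P, ⟨P₁, h₁, P₂, h₂, rfl⟩, hP⟩ := hu
    obtain ⟨Q₁, k₁, g₁⟩ := ihA hT.1 hv ⟨P₁, h₁, fun e he => hP e (List.mem_append_left _ he)⟩
    obtain ⟨Q₂, k₂, g₂⟩ := ihB hT.2.1 (by rw [← hT.2.2.2 _ hd]; exact hv)
      ⟨P₂, h₂, fun e he => hP e (List.mem_append_right _ he)⟩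
    exact ⟨_, ⟨Q₁, k₁, Q₂, k₂, rfl⟩, fun e he => (List.mem_append.1 he).elim (g₁ e) (g₂ e)⟩
  | par A B ihA ihB =>
    have inl : A.Used g₀ → (par A B).Used g₀ := fun ⟨P, hP, g⟩ => ⟨P, .inl hP, g⟩
    have inr : B.Used g₀ → (par A B).Used g₀ := fun ⟨P, hP, g⟩ => ⟨P, .inr hP, g⟩
    simp only [val] at hv
    by_cases hA : 0 < A.val (fun e => g₀ e - h₀ e)
    · exact inl (hup hT.1 hA)
    by_cases hB : 0 < B.val (fun e => g₀ e - h₀ e)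
    · exact inr (hup hT.2.1 hB)
    obtain ⟨P, hP | hP, g⟩ := hu
    · exact inl (ihA hT.1 (by linarith) ⟨P, hP, g⟩)
    · exact inr (ihB hT.2.1 (by linarith) ⟨P, hP, g⟩)

/-- Some path through `T` is a cheapest path of the network between the terminals of `T`. -/
def Tight (G : Network) (c : Fin G.m → ℝ) (T : STree G.m) : Prop :=
  ∃ P ∈ T.paths, ∀ Q, G.IsPath (T.src G) (T.snk G) Q → pathCost c P ≤ pathCost c Q

end STree

/-- The flow `g` satisfies the equilibrium condition on all segments of paths, for edge costs `c`, and
differs from the nonnegative flow `h` by circulations. -/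
structure Comparable (G : Network) {k : ℕ} (c : Fin G.m → ℝ) (g h : Fin k → Fin G.m → ℝ) : Prop where
  nonneg : ∀ i e, 0 ≤ g i e
  nonneg' : ∀ i e, 0 ≤ h i e
  circ : ∀ i v, G.netOut (fun e => g i e - h i e) v = 0
  segment : ∀ i u v P Q, P ≠ [] → G.IsPath u v P → G.IsPath u v Q → (∀ e ∈ P, 0 < g i e) →
    pathCost c P ≤ pathCost c Q

namespace Comparable

open STree

variable {G : Network} {k k' : ℕ} {c : Fin G.m → ℝ} {g h : Fin k → Fin G.m → ℝ}
  {h' : Fin k' → Fin G.m → ℝ}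

theorem circ_total (H : Comparable G c g h) (v : Fin G.n) :
    G.netOut (fun e => total g e - total h e) v = 0 := by
  have h1 := Network.netOut_sum (G := G) (fun i e => g i e - h i e) v
  simp only [H.circ, Finset.sum_const_zero, Finset.sum_sub_distrib] at h1
  exact h1

theorem val_total (T : STree G.m) :
    T.val (fun e => total g e - total h e) = ∑ i, T.val (fun e => g i e - h i e) := by
  rw [← STree.val_sum]
  simp only [Finset.sum_sub_distrib]
  rfl

theorem tight_of_used (H : Comparable G c g h) {T : STree G.m} (hT : T.Good G h') (i : Fin k)
    (hu : T.Used (g i)) : T.Tight G c := by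
  obtain ⟨P, hP, hpos⟩ := hu
  exact ⟨P, hP, fun Q hQ => H.segment i _ _ P Q (ne_nil_of_mem_paths hP) (hT.isPath hP) hQ hpos⟩

/-- A branch that gains flow contains a path that some commodity of `g` uses. -/
theorem tight_of_val_pos (H : Comparable G c g h) {T : STree G.m} (hT : T.Good G h')
    (hv : 0 < T.val (fun e => total g e - total h e)) : T.Tight G c := by
  rw [val_total] at hv
  obtain ⟨i, -, hi⟩ := Finset.exists_lt_of_sum_lt (f := fun _ => (0 : ℝ)) (by simpa using hv)
  obtain ⟨P, hP, hpos⟩ := hT.used_of_val_pos (H.circ i) hi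
  exact H.tight_of_used hT i ⟨P, hP, fun e he => by
    have := hpos e he; have := H.nonneg' i e; linarith⟩

/-- A branch that `h` uses and that does not lose flow contains a path that some commodity of `g` uses:
the one that uses it in `h`, or one that gains flow to make up for its loss. -/
theorem tight_of_used_of_val_nonneg (H : Comparable G c g h) {T : STree G.m} (hT : T.Good G h')
    (hu : ∃ i, T.Used (h i)) (hv : 0 ≤ T.val (fun e => total g e - total h e)) :
    T.Tight G c := by
  obtain ⟨i, hi⟩ := hu
  by_cases hvi : 0 ≤ T.val (fun e => g i e - h i e)
  · exact H.tight_of_used hT i (hT.used_of_used (H.nonneg' i) (H.circ i) hvi hi)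
  · rw [val_total, ← Finset.add_sum_erase _ _ (Finset.mem_univ i)] at hv
    obtain ⟨j, -, hj⟩ := Finset.exists_lt_of_sum_lt (s := Finset.univ.erase i)
      (f := fun _ => (0 : ℝ)) (g := fun j => T.val (fun e => g j e - h j e))
      (by simp only [Finset.sum_const_zero]; linarith)
    obtain ⟨P, hP, hpos⟩ := hT.used_of_val_pos (H.circ j) hj
    exact H.tight_of_used hT j ⟨P, hP, fun e he => by
      have := hpos e he; have := H.nonneg' j e; linarith⟩

theorem used_of_val_neg (H : Comparable G c g h) {T : STree G.m} (hT : T.Good G h')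
    (hv : T.val (fun e => total g e - total h e) < 0) : ∃ i, T.Used (h i) := by
  rw [val_total] at hv
  obtain ⟨i, -, hi⟩ := Finset.exists_lt_of_sum_lt (g := fun _ => (0 : ℝ)) (by simpa using hv)
  obtain ⟨P, hP, hpos⟩ := hT.used_of_val_pos (d := fun e => h i e - g i e) (fun v => by
      have := H.circ i v
      rw [Network.netOut_sub] at this ⊢
      linarith) (by
      have := STree.val_neg (fun e => g i e - h i e) T
      simp only [neg_sub] at this
      rw [this]; linarith)
  exact ⟨i, P, hP, fun e he => by have := hpos e he; have := H.nonneg i e; linarith⟩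

end Comparable

/-! ### Uniqueness of the equilibrium flow -/

namespace STree

variable {G : Network} {k k' : ℕ} {h' : Fin k' → Fin G.m → ℝ}

/-- Where the flow value of one equilibrium exceeds that of another one, so does the cost. -/
theorem exists_cheapest_of_val_pos {c c' : Fin G.m → ℝ} {g h : Fin k → Fin G.m → ℝ}
    (H : Comparable G c g h) (hc : ∀ e, total h e < total g e → c' e < c e)
    {T : STree G.m} (hT : T.Good G h') (hv : 0 < T.val (fun e => total g e - total h e)) :
    ∃ P ∈ T.paths, (∀ Q ∈ T.paths, pathCost c P ≤ pathCost c Q) ∧ pathCost c' P < pathCost c P := by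
  induction T with
  | leaf e =>
    refine ⟨[e], rfl, ?_, ?_⟩
    · rintro Q rfl; exact le_rfl
    · simpa [pathCost] using hc e (by simp only [val] at hv; linarith)
  | ser A B ihA ihB =>
    obtain ⟨P₁, h₁, m₁, g₁⟩ := ihA hT.1 hv
    obtain ⟨P₂, h₂, m₂, g₂⟩ := ihB hT.2.1 (by rw [← hT.2.2.2 _ H.circ_total]; exact hv)
    refine ⟨_, ⟨P₁, h₁, P₂, h₂, rfl⟩, ?_, ?_⟩
    · rintro Q ⟨Q₁, k₁, Q₂, k₂, rfl⟩
      rw [pathCost_append, pathCost_append]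
      exact add_le_add (m₁ _ k₁) (m₂ _ k₂)
    · rw [pathCost_append, pathCost_append]
      exact add_lt_add g₁ g₂
  | par A B ihA ihB =>
    have hB := hT.2.1
    have e1 := hT.2.2.1
    have e2 := hT.2.2.2.1
    rcases lt_or_ge 0 (A.val (fun e => total g e - total h e)) with hA | hA
    · obtain ⟨P, hP, hm, hlt⟩ := ihA hT.1 hA
      obtain ⟨P', hP', ht⟩ := H.tight_of_val_pos hT.1 hA
      refine ⟨P, .inl hP, ?_, hlt⟩
      rintro Q (hQ | hQ)
      · exact hm Q hQ
      · exact (hm P' hP').trans (ht Q (by rw [e1, e2]; exact hB.isPath hQ))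
    · have hvB : 0 < B.val (fun e => total g e - total h e) := by
        simp only [val] at hv; linarith
      obtain ⟨P, hP, hm, hlt⟩ := ihB hT.2.1 hvB
      obtain ⟨P', hP', ht⟩ := H.tight_of_val_pos hT.2.1 hvB
      refine ⟨P, .inr hP, ?_, hlt⟩
      rintro Q (hQ | hQ)
      · exact (hm P' hP').trans (ht Q (by rw [← e1, ← e2]; exact hT.1.isPath hQ))
      · exact hm Q hQ

/-- Two equilibria with the same value on a tree agree on all of its edges. -/
theorem total_eq_of_val_eq_zero {c c' : Fin G.m → ℝ} {g h : Fin k → Fin G.m → ℝ}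
    (H : Comparable G c g h) (H' : Comparable G c' h g)
    (hc : ∀ e, total h e < total g e → c' e < c e) (hc' : ∀ e, total g e < total h e → c e < c' e)
    {T : STree G.m} (hT : T.Good G h') (hv : T.val (fun e => total g e - total h e) = 0) :
    ∀ e ∈ T.leaves, total g e = total h e := by
  have hopp : ∀ {A B : STree G.m}, A.Good G h' → B.Good G h' → A.src G = B.src G →
      A.snk G = B.snk G → 0 < A.val (fun e => total g e - total h e) →
      0 < B.val (fun e => total h e - total g e) → False := by
    intro A B hA hB e1 e2 hvA hvB
    obtain ⟨P, hP, hm, hlt⟩ := exists_cheapest_of_val_pos H hc hA hvA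
    obtain ⟨Q, hQ, hm', hlt'⟩ := exists_cheapest_of_val_pos H' hc' hB hvB
    obtain ⟨P', hP', ht⟩ := H.tight_of_val_pos hA hvA
    obtain ⟨Q', hQ', ht'⟩ := H'.tight_of_val_pos hB hvB
    have h1 := (hm P' hP').trans (ht Q (by rw [e1, e2]; exact hB.isPath hQ))
    have h2 := (hm' Q' hQ').trans (ht' P (by rw [← e1, ← e2]; exact hA.isPath hP))
    linarith
  have hneg : ∀ S : STree G.m, S.val (fun e => total h e - total g e) =
      -S.val (fun e => total g e - total h e) := by
    intro S
    rw [← STree.val_neg]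
    simp only [neg_sub]
  induction T with
  | leaf e =>
    intro e' he'
    rw [leaves, List.mem_singleton] at he'
    subst he'
    simp only [val] at hv
    linarith
  | ser A B ihA ihB =>
    intro e he
    rcases List.mem_append.1 he with he | he
    · exact ihA hT.1 hv e he
    · exact ihB hT.2.1 (by rw [← hT.2.2.2 _ H.circ_total]; exact hv) e he
  | par A B ihA ihB =>
    simp only [val] at hv
    rcases lt_trichotomy 0 (A.val (fun e => total g e - total h e)) with hA | hA | hA
    · exact (hopp hT.1 hT.2.1 hT.2.2.1 hT.2.2.2.1 hA (by rw [hneg]; linarith)).elim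
    · intro e he
      rcases List.mem_append.1 he with he | he
      · exact ihA hT.1 hA.symm e he
      · exact ihB hT.2.1 (by linarith) e he
    · exact (hopp hT.2.1 hT.1 hT.2.2.1.symm hT.2.2.2.1.symm (by linarith)
        (by rw [hneg]; linarith)).elim

end STree

end SepaTolls
namespace SepaTolls

/-! ### Tolls for a decomposition tree -/

/-- What the algorithm records about a parallel join of `A` and `B`: the representative edges of both
branches, the cuts of both branches, and the number of parallel joins in `B`. -/
abbrev Rec : Type := ℕ × ℕ × List ℕ × List ℕ × ℕ

namespace Rec

/-- The representative edge of the first branch. -/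
def repA (r : Rec) : ℕ := r.1

/-- The representative edge of the second branch; it serves as the name of the join. -/
def repB (r : Rec) : ℕ := r.2.1

/-- The cut of the first branch. -/
def cutA (r : Rec) : List ℕ := r.2.2.1

/-- The cut of the second branch. -/
def cutB (r : Rec) : List ℕ := r.2.2.2.1

/-- The number of parallel joins inside the second branch. -/
def nparB (r : Rec) : ℕ := r.2.2.2.2

/-- The contribution of a join to the toll of the edge `e`, in units of `1 / U`: an offset on the cut of
the first branch and the search variable `z` of the join on the cut of the second branch. The offset
makes up for the offsets inside the second branch, so that the target value of `z` is nonnegative. -/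
def share (M : ℕ) (z : ℕ → ℕ) (r : Rec) (e : ℕ) : ℕ :=
  (if decide (e ∈ r.cutA) then M * (r.nparB + 1) else 0) +
    (if decide (e ∈ r.cutB) then z r.repB else 0)

/-- A join fires if the sign of the flow error on the second branch is nonzero and differs from the
sign on the first branch. -/
def fires (sg : ℕ → ℚ) (r : Rec) : Bool :=
  !decide (sg r.repB = 0) && !decide (sg r.repA = sg r.repB)

theorem fires_iff {sg : ℕ → ℚ} {r : Rec} :
    r.fires sg = true ↔ sg r.repB ≠ 0 ∧ sg r.repA ≠ sg r.repB := by
  simp [fires]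

end Rec

/-- The numerator of the toll of `e`. -/
def numer (M : ℕ) (z : ℕ → ℕ) (rs : List Rec) (e : ℕ) : ℕ := (rs.map fun r => r.share M z e).sum

theorem numer_append (M : ℕ) (z : ℕ → ℕ) (rs rs' : List Rec) (e : ℕ) :
    numer M z (rs ++ rs') e = numer M z rs e + numer M z rs' e := by
  simp [numer]

namespace STree

variable {m : ℕ}

/-- The records of all parallel joins, inner joins first. -/
def recs : STree m → List Rec
  | leaf _ => []
  | ser A B => recs A ++ recs B
  | par A B => recs A ++ recs B ++
      [((A.rep : ℕ), (B.rep : ℕ), A.cut.map Fin.val, B.cut.map Fin.val, B.npar)]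

theorem numer_recs_eq_zero (M : ℕ) (z : ℕ → ℕ) {T : STree m} {e : Fin m} (he : e ∉ T.leaves) :
    numer M z T.recs e = 0 := by
  induction T with
  | leaf e' => rfl
  | ser A B ihA ihB =>
    simp only [leaves, List.mem_append, not_or] at he
    rw [recs, numer_append, ihA he.1, ihB he.2]
  | par A B ihA ihB =>
    simp only [leaves, List.mem_append, not_or] at he
    rw [recs, numer_append, numer_append, ihA he.1, ihB he.2]
    have h1 : e ∉ A.cut := fun h => he.1 (cut_subset A e h)
    have h2 : e ∉ B.cut := fun h => he.2 (cut_subset B e h)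
    simp [numer, Rec.share, Rec.cutA, Rec.cutB, Fin.val_inj, h1, h2]

theorem pathCost_cut_eq_zero {T : STree m} (w : ℝ) {P : List (Fin m)} (hP : ∀ e ∈ P, e ∉ T.leaves) :
    pathCost (fun e => if e ∈ T.cut then w else 0) P = 0 := by
  refine List.sum_eq_zero fun x hx => ?_
  obtain ⟨e, he, rfl⟩ := List.mem_map.1 hx
  rw [if_neg fun h => hP e he (cut_subset T e h)]

theorem pathCost_cut {T : STree m} (hn : T.leaves.Nodup) (w : ℝ) {P : List (Fin m)}
    (hP : P ∈ T.paths) : pathCost (fun e => if e ∈ T.cut then w else 0) P = w := by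
  induction T generalizing P with
  | leaf e =>
    obtain rfl := hP
    simp [pathCost, cut]
  | ser A B ihA ihB =>
    obtain ⟨P₁, h₁, P₂, h₂, rfl⟩ := hP
    obtain ⟨nA, nB, hd⟩ := List.nodup_append.1 hn
    rw [pathCost_append]
    have h3 := pathCost_cut_eq_zero (T := A) w (P := P₂) fun e he hA =>
      hd e hA e (mem_leaves_of_mem_path h₂ e he) rfl
    exact (congrArg₂ (· + ·) (ihA nA h₁) h3).trans (add_zero w)
  | par A B ihA ihB =>
    obtain ⟨nA, nB, hd⟩ := List.nodup_append.1 hn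
    rcases hP with hP | hP
    · refine Eq.trans (congrArg List.sum (List.map_congr_left fun e he => ?_)) (ihA nA hP)
      have h1 : e ∉ B.cut := fun h =>
        hd e (mem_leaves_of_mem_path hP e he) e (cut_subset B e h) rfl
      simp [cut, h1]
    · refine Eq.trans (congrArg List.sum (List.map_congr_left fun e he => ?_)) (ihB nB hP)
      have h1 : e ∉ A.cut := fun h =>
        hd e (cut_subset A e h) e (mem_leaves_of_mem_path hP e he) rfl
      simp [cut, h1]

/-- Cost of a path with the tolls of the joins inside `T` only. -/
noncomputable def innerCost (U M : ℕ) (z : ℕ → ℕ) (c₀ : Fin m → ℝ) (T : STree m)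
    (P : List (Fin m)) : ℝ :=
  pathCost (fun e => c₀ e + (numer M z T.recs e : ℝ) / U) P

variable {U M : ℕ} {z : ℕ → ℕ} {c₀ : Fin m → ℝ} {A B : STree m}

theorem innerCost_ser (hn : (ser A B).leaves.Nodup) {P₁ P₂ : List (Fin m)}
    (h₁ : P₁ ∈ A.paths) (h₂ : P₂ ∈ B.paths) :
    (ser A B).innerCost U M z c₀ (P₁ ++ P₂) = A.innerCost U M z c₀ P₁ + B.innerCost U M z c₀ P₂ := by
  obtain ⟨-, -, hd⟩ := List.nodup_append.1 hn
  rw [innerCost, pathCost_append]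
  congr 1
  · refine congrArg List.sum (List.map_congr_left fun e he => ?_)
    have h1 : e ∉ B.leaves := fun h => hd e (mem_leaves_of_mem_path h₁ e he) e h rfl
    rw [recs, numer_append, numer_recs_eq_zero M z h1, add_zero]
  · refine congrArg List.sum (List.map_congr_left fun e he => ?_)
    have h1 : e ∉ A.leaves := fun h => hd e h e (mem_leaves_of_mem_path h₂ e he) rfl
    rw [recs, numer_append, numer_recs_eq_zero M z h1, zero_add]

theorem numer_par (e : Fin m) : numer M z (par A B).recs e =
    numer M z A.recs e + numer M z B.recs e + ((if e ∈ A.cut then M * (B.npar + 1) else 0) +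
      (if e ∈ B.cut then z B.rep else 0)) := by
  rw [recs, numer_append, numer_append]
  simp [numer, Rec.share, Rec.cutA, Rec.cutB, Rec.nparB, Rec.repB, Fin.val_inj]

theorem innerCost_par_left (hn : (par A B).leaves.Nodup) {P : List (Fin m)} (hP : P ∈ A.paths) :
    (par A B).innerCost U M z c₀ P =
      A.innerCost U M z c₀ P + ((M * (B.npar + 1) : ℕ) : ℝ) / U := by
  obtain ⟨nA, -, hd⟩ := List.nodup_append.1 hn
  rw [← pathCost_cut nA (((M * (B.npar + 1) : ℕ) : ℝ) / U) hP, innerCost, innerCost, ← pathCost_add]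
  refine congrArg List.sum (List.map_congr_left fun e he => ?_)
  have h1 : e ∉ B.leaves := fun h => hd e (mem_leaves_of_mem_path hP e he) e h rfl
  rw [numer_par, numer_recs_eq_zero M z h1, if_neg (fun h => h1 (cut_subset B e h))]
  split_ifs <;> push_cast <;> ring

theorem innerCost_par_right (hn : (par A B).leaves.Nodup) {P : List (Fin m)} (hP : P ∈ B.paths) :
    (par A B).innerCost U M z c₀ P = B.innerCost U M z c₀ P + (z B.rep : ℝ) / U := by
  obtain ⟨-, nB, hd⟩ := List.nodup_append.1 hn
  rw [← pathCost_cut nB ((z B.rep : ℝ) / U) hP, innerCost, innerCost, ← pathCost_add]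
  refine congrArg List.sum (List.map_congr_left fun e he => ?_)
  have h1 : e ∉ A.leaves := fun h => hd e h e (mem_leaves_of_mem_path hP e he) rfl
  rw [numer_par, numer_recs_eq_zero M z h1, if_neg (fun h => h1 (cut_subset A e h))]
  split_ifs <;> push_cast <;> ring

/-- The common cost of all paths through the tree at the target flow, with edge delays `cs` and the
tolls that the algorithm looks for. -/
noncomputable def targetCost (U M : ℕ) (cs : Fin m → ℝ) : STree m → ℝ
  | leaf e => cs e
  | ser A B => targetCost U M cs A + targetCost U M cs B
  | par A B => targetCost U M cs A + ((M * (B.npar + 1) : ℕ) : ℝ) / U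

/-- The tree contains a parallel join named `e` that equalizes its branches when its search variable
is `x`. -/
def IsTarget (U M : ℕ) (cs : Fin m → ℝ) : STree m → ℕ → ℝ → Prop
  | leaf _, _, _ => False
  | ser A B, e, x => IsTarget U M cs A e x ∨ IsTarget U M cs B e x
  | par A B, e, x => IsTarget U M cs A e x ∨ IsTarget U M cs B e x ∨
      (e = B.rep ∧ targetCost U M cs B + x / U = targetCost U M cs (par A B))

theorem targetCost_eq (cs : Fin m → ℝ) (T : STree m) :
    targetCost U M cs T = pathCost cs T.ref + (M : ℝ) * T.npar / U := by
  induction T with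
  | leaf e => simp [targetCost, ref, npar, pathCost]
  | ser A B ihA ihB =>
    simp only [targetCost, ref, npar, ihA, ihB, pathCost_append]
    push_cast; ring
  | par A B ihA ihB =>
    simp only [targetCost, ref, npar, ihA]
    push_cast; ring

theorem IsTarget.mem_leaves {cs : Fin m → ℝ} {T : STree m} {e : ℕ} {x : ℝ}
    (h : IsTarget U M cs T e x) (hn : T.leaves.Nodup) :
    (∃ e' ∈ T.leaves, (e' : ℕ) = e) ∧ e ≠ T.rep := by
  induction T with
  | leaf e => exact h.elim
  | ser A B ihA ihB =>
    obtain ⟨nA, nB, hd⟩ := List.nodup_append.1 hn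
    rcases h with h | h
    · obtain ⟨⟨e', he', h1⟩, h2⟩ := ihA h nA
      exact ⟨⟨e', List.mem_append_left _ he', h1⟩, h2⟩
    · obtain ⟨⟨e', he', h1⟩, h2⟩ := ihB h nB
      refine ⟨⟨e', List.mem_append_right _ he', h1⟩, fun h3 => ?_⟩
      exact hd _ A.rep_mem_leaves _ he' (Fin.ext (h3.symm.trans h1.symm))
  | par A B ihA ihB =>
    obtain ⟨nA, nB, hd⟩ := List.nodup_append.1 hn
    rcases h with h | h | ⟨h, -⟩
    · obtain ⟨⟨e', he', h1⟩, h2⟩ := ihA h nA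
      exact ⟨⟨e', List.mem_append_left _ he', h1⟩, h2⟩
    · obtain ⟨⟨e', he', h1⟩, h2⟩ := ihB h nB
      refine ⟨⟨e', List.mem_append_right _ he', h1⟩, fun h3 => ?_⟩
      exact hd _ A.rep_mem_leaves _ he' (Fin.ext (h3.symm.trans h1.symm))
    · refine ⟨⟨B.rep, List.mem_append_right _ B.rep_mem_leaves, h.symm⟩, fun h3 => ?_⟩
      exact hd _ A.rep_mem_leaves _ B.rep_mem_leaves (Fin.ext (h3.symm.trans h))

/-- Distinct joins have distinct names. -/
theorem IsTarget.unique (hU : 0 < U) {cs : Fin m → ℝ} {T : STree m} (hn : T.leaves.Nodup) {e : ℕ}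
    {x y : ℝ} (hx : IsTarget U M cs T e x) (hy : IsTarget U M cs T e y) : x = y := by
  have hsplit : ∀ {A B : STree m} {x y : ℝ}, (A.leaves ++ B.leaves).Nodup →
      IsTarget U M cs A e x → IsTarget U M cs B e y → False := by
    intro A B x y hn hx hy
    obtain ⟨nA, nB, hd⟩ := List.nodup_append.1 hn
    obtain ⟨⟨a, ha, h1⟩, -⟩ := hx.mem_leaves nA
    obtain ⟨⟨b, hb, h2⟩, -⟩ := hy.mem_leaves nB
    exact hd a ha b hb (Fin.ext (h1.trans h2.symm))
  induction T with
  | leaf e => exact hx.elim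
  | ser A B ihA ihB =>
    obtain ⟨nA, nB, hd⟩ := List.nodup_append.1 hn
    rcases hx with hx | hx <;> rcases hy with hy | hy
    · exact ihA nA hx hy
    · exact (hsplit hn hx hy).elim
    · exact (hsplit hn hy hx).elim
    · exact ihB nB hx hy
  | par A B ihA ihB =>
    obtain ⟨nA, nB, hd⟩ := List.nodup_append.1 hn
    have hA : ∀ x, IsTarget U M cs A e x → e = B.rep → False := by
      intro x hx he
      obtain ⟨⟨a, ha, h1⟩, -⟩ := hx.mem_leaves nA
      exact hd a ha _ B.rep_mem_leaves (Fin.ext (h1.trans he))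
    have hB : ∀ x, IsTarget U M cs B e x → e = B.rep → False := fun x hx he =>
      (hx.mem_leaves nB).2 he
    rcases hx with hx | hx | hx <;> rcases hy with hy | hy | hy
    · exact ihA nA hx hy
    · exact (hsplit hn hx hy).elim
    · exact (hA _ hx hy.1).elim
    · exact (hsplit hn hy hx).elim
    · exact ihB nB hx hy
    · exact (hB _ hx hy.1).elim
    · exact (hA _ hy hx.1).elim
    · exact (hB _ hy hx.1).elim
    · have h1 : x / U = y / U := by linarith [hx.2, hy.2]
      have h2 : (U : ℝ) ≠ 0 := by exact_mod_cast hU.ne'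
      field_simp at h1
      exact h1

theorem val_eq_zero {d : Fin m → ℝ} {T : STree m} (h : ∀ e ∈ T.leaves, d e = 0) : T.val d = 0 := by
  induction T with
  | leaf e => exact h e (by simp [leaves])
  | ser A B ihA _ => exact ihA fun e he => h e (List.mem_append_left _ he)
  | par A B ihA ihB =>
    simp only [val]
    rw [ihA fun e he => h e (List.mem_append_left _ he),
      ihB fun e he => h e (List.mem_append_right _ he), add_zero]

end STree

theorem cmpReal_of_lt {a b : ℝ} (h : a < b) : cmpReal a b = -1 := by simp [cmpReal, h]

theorem cmpReal_of_gt {a b : ℝ} (h : b < a) : cmpReal a b = 1 := by simp [cmpReal, h, h.not_gt]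

theorem cmpReal_self (a : ℝ) : cmpReal a a = 0 := by simp [cmpReal]

/-! ### What an equilibrium tells about the tolls -/

namespace STree

/-- What is known about a tree in which no join fires. The sign of the error at the representative
edge is the sign of the error of the flow value, and in terms of the target cost all paths are too
expensive, or some path is too cheap, or the flow is right. -/
structure Quiet {G : Network} {k : ℕ} (U M : ℕ) (z : ℕ → ℕ) (c₀ cs : Fin G.m → ℝ)
    (h : Fin k → Fin G.m → ℝ) (d : Fin G.m → ℝ) (T : STree G.m) : Prop where
  pos : 0 < d T.rep → 0 < T.val d ∧ ∀ P ∈ T.paths, targetCost U M cs T < T.innerCost U M z c₀ P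
  neg : d T.rep < 0 → T.val d < 0 ∧ ∃ P ∈ T.paths, T.innerCost U M z c₀ P < targetCost U M cs T
  zero : d T.rep = 0 → (∀ e ∈ T.leaves, d e = 0) ∧
    (∃ P ∈ T.paths, T.innerCost U M z c₀ P ≤ targetCost U M cs T) ∧
    ((∃ i, T.Used (h i)) → ∀ P ∈ T.paths, targetCost U M cs T ≤ T.innerCost U M z c₀ P)

variable {G : Network} {k : ℕ} {U M : ℕ} {z : ℕ → ℕ} {c c₀ cs : Fin G.m → ℝ}
  {g h : Fin k → Fin G.m → ℝ} {sg : ℕ → ℚ} {A B T : STree G.m} {κ : ℝ}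

local notation "err" => fun e => total g e - total h e

theorem Quiet.leaf (e : Fin G.m) (hlt : ∀ e, total h e < total g e → cs e < c₀ e)
    (hgt : ∀ e, total g e < total h e → c₀ e < cs e)
    (heq : ∀ e, total g e = total h e → c₀ e = cs e) :
    (STree.leaf e).Quiet U M z c₀ cs h err := by
  have h1 : ∀ P ∈ (STree.leaf e).paths, (STree.leaf e).innerCost U M z c₀ P = c₀ e := by
    rintro P rfl
    simp [innerCost, recs, numer, pathCost]
  refine ⟨fun hd => ⟨hd, fun P hP => ?_⟩, fun hd => ⟨hd, [e], rfl, ?_⟩, fun hd => ⟨?_, ⟨[e], rfl, ?_⟩,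
    fun _ P hP => ?_⟩⟩
  · rw [h1 P hP]; exact hlt e (by simp only [rep] at hd; linarith)
  · rw [h1 _ rfl]; exact hgt e (by simp only [rep] at hd; linarith)
  · intro e' he'
    rw [leaves, List.mem_singleton] at he'
    subst he'
    exact hd
  · rw [h1 _ rfl]; exact (heq e (by simp only [rep] at hd; linarith)).le
  · rw [h1 P hP]; exact (heq e (by simp only [rep] at hd; linarith)).ge

theorem Quiet.ser (H : Comparable G c g h) (hT : (STree.ser A B).Good G h)
    (hn : (STree.ser A B).leaves.Nodup) (hA : A.Quiet U M z c₀ cs h err)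
    (hB : B.Quiet U M z c₀ cs h err) : (STree.ser A B).Quiet U M z c₀ cs h err := by
  have hval := hT.2.2.2 _ H.circ_total
  have hsame : A.val err = B.val err := hval
  have hpos : 0 < A.val err → 0 < (err) B.rep := by
    intro h1
    rcases lt_trichotomy 0 ((err) B.rep) with h2 | h2 | h2
    · exact h2
    · have := val_eq_zero (hB.zero h2.symm).1; linarith
    · have := (hB.neg h2).1; linarith
  have hneg : A.val err < 0 → (err) B.rep < 0 := by
    intro h1
    rcases lt_trichotomy 0 ((err) B.rep) with h2 | h2 | h2
    · have := (hB.pos h2).1; linarith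
    · have := val_eq_zero (hB.zero h2.symm).1; linarith
    · exact h2
  have hzero : A.val err = 0 → (err) B.rep = 0 := by
    intro h1
    rcases lt_trichotomy 0 ((err) B.rep) with h2 | h2 | h2
    · have := (hB.pos h2).1; linarith
    · exact h2.symm
    · have := (hB.neg h2).1; linarith
  refine ⟨fun hd => ?_, fun hd => ?_, fun hd => ?_⟩
  · obtain ⟨h1, h2⟩ := hA.pos hd
    obtain ⟨-, h4⟩ := hB.pos (hpos h1)
    refine ⟨h1, ?_⟩
    rintro _ ⟨P₁, k₁, P₂, k₂, rfl⟩
    rw [innerCost_ser hn k₁ k₂]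
    exact add_lt_add (h2 _ k₁) (h4 _ k₂)
  · obtain ⟨h1, P₁, k₁, h2⟩ := hA.neg hd
    obtain ⟨-, P₂, k₂, h4⟩ := hB.neg (hneg h1)
    refine ⟨h1, _, ⟨P₁, k₁, P₂, k₂, rfl⟩, ?_⟩
    rw [innerCost_ser hn k₁ k₂]
    exact add_lt_add h2 h4
  · obtain ⟨h1, ⟨P₁, k₁, h2⟩, h3⟩ := hA.zero hd
    obtain ⟨h1', ⟨P₂, k₂, h2'⟩, h3'⟩ := hB.zero (hzero (val_eq_zero h1))
    refine ⟨fun e he => (List.mem_append.1 he).elim (h1 e) (h1' e), ⟨_, ⟨P₁, k₁, P₂, k₂, rfl⟩, ?_⟩, ?_⟩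
    · rw [innerCost_ser hn k₁ k₂]
      exact add_le_add h2 h2'
    · rintro ⟨i, _, ⟨Q₁, q₁, Q₂, q₂, rfl⟩, hQ⟩ _ ⟨P₁, k₁, P₂, k₂, rfl⟩
      rw [innerCost_ser hn k₁ k₂]
      exact add_le_add (h3 ⟨i, Q₁, q₁, fun e he => hQ e (List.mem_append_left _ he)⟩ _ k₁)
        (h3' ⟨i, Q₂, q₂, fun e he => hQ e (List.mem_append_right _ he)⟩ _ k₂)

/-- In a parallel join, a tight branch is no more expensive than the other one. -/
theorem Tight.le_right (hT : (STree.par A B).Good G h) (hn : (STree.par A B).leaves.Nodup)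
    (hκ : ∀ P ∈ (STree.par A B).paths, pathCost c P = (STree.par A B).innerCost U M z c₀ P + κ)
    (ht : A.Tight G c) : ∃ P ∈ A.paths, ∀ Q ∈ B.paths,
      A.innerCost U M z c₀ P + ((M * (B.npar + 1) : ℕ) : ℝ) / U ≤
        B.innerCost U M z c₀ Q + (z B.rep : ℝ) / U := by
  obtain ⟨P, hP, ht⟩ := ht
  refine ⟨P, hP, fun Q hQ => ?_⟩
  have h1 := ht Q (by rw [hT.2.2.1, hT.2.2.2.1]; exact hT.2.1.isPath hQ)
  rw [hκ P (.inl hP), hκ Q (.inr hQ), innerCost_par_left hn hP, innerCost_par_right hn hQ] at h1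
  linarith

theorem Tight.le_left (hT : (STree.par A B).Good G h) (hn : (STree.par A B).leaves.Nodup)
    (hκ : ∀ P ∈ (STree.par A B).paths, pathCost c P = (STree.par A B).innerCost U M z c₀ P + κ)
    (ht : B.Tight G c) : ∃ Q ∈ B.paths, ∀ P ∈ A.paths,
      B.innerCost U M z c₀ Q + (z B.rep : ℝ) / U ≤
        A.innerCost U M z c₀ P + ((M * (B.npar + 1) : ℕ) : ℝ) / U := by
  obtain ⟨Q, hQ, ht⟩ := ht
  refine ⟨Q, hQ, fun P hP => ?_⟩
  have h1 := ht P (by rw [← hT.2.2.1, ← hT.2.2.2.1]; exact hT.1.isPath hP)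
  rw [hκ P (.inl hP), hκ Q (.inr hQ), innerCost_par_left hn hP, innerCost_par_right hn hQ] at h1
  linarith

theorem Quiet.par (H : Comparable G c g h) (hT : (STree.par A B).Good G h)
    (hn : (STree.par A B).leaves.Nodup)
    (hκ : ∀ P ∈ (STree.par A B).paths, pathCost c P = (STree.par A B).innerCost U M z c₀ P + κ)
    (hA : A.Quiet U M z c₀ cs h err) (hB : B.Quiet U M z c₀ cs h err)
    (hpos : 0 < (err) A.rep → 0 ≤ (err) B.rep) (hneg : (err) A.rep < 0 → (err) B.rep ≤ 0)
    (hzero : (err) A.rep = 0 → (err) B.rep = 0) :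
    (STree.par A B).Quiet U M z c₀ cs h err := by
  refine ⟨fun hd => ?_, fun hd => ?_, fun hd => ?_⟩
  · obtain ⟨h1, h2⟩ := hA.pos hd
    have h3 : 0 ≤ B.val err := by
      rcases (hpos hd).lt_or_eq with h | h
      · exact (hB.pos h).1.le
      · exact (val_eq_zero (hB.zero h.symm).1).ge
    refine ⟨add_pos_of_pos_of_nonneg h1 h3, ?_⟩
    obtain ⟨P₀, hP₀, ht⟩ := (H.tight_of_val_pos hT.1 h1).le_right hT hn hκ
    have h4 := h2 P₀ hP₀
    rintro P (hP | hP)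
    · rw [innerCost_par_left hn hP, targetCost]
      have := h2 P hP
      linarith
    · rw [innerCost_par_right hn hP, targetCost]
      have := ht P hP
      linarith
  · obtain ⟨h1, P, hP, h2⟩ := hA.neg hd
    have h3 : B.val err ≤ 0 := by
      rcases (hneg hd).lt_or_eq with h | h
      · exact (hB.neg h).1.le
      · exact (val_eq_zero (hB.zero h).1).le
    refine ⟨add_neg_of_neg_of_nonpos h1 h3, P, .inl hP, ?_⟩
    rw [innerCost_par_left hn hP, targetCost]
    linarith
  · obtain ⟨h1, ⟨P, hP, h2⟩, h3⟩ := hA.zero hd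
    obtain ⟨h1', -, -⟩ := hB.zero (hzero hd)
    refine ⟨fun e he => (List.mem_append.1 he).elim (h1 e) (h1' e), ⟨P, .inl hP, ?_⟩, ?_⟩
    · rw [innerCost_par_left hn hP, targetCost]
      linarith
    · rintro ⟨i, Q, hQ, hQ'⟩ P hP
      have hu : ∃ i, A.Used (h i) := by
        rcases hQ with hQ | hQ
        · exact ⟨i, Q, hQ, hQ'⟩
        · exact hT.2.2.2.2 ⟨i, Q, hQ, hQ'⟩
      obtain ⟨P₀, hP₀, ht⟩ := (H.tight_of_used_of_val_nonneg hT.1 hu (val_eq_zero h1).ge).le_right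
        hT hn hκ
      have h4 := h3 hu P₀ hP₀
      rcases hP with hP | hP
      · rw [innerCost_par_left hn hP, targetCost]
        have := h3 hu P hP
        linarith
      · rw [innerCost_par_right hn hP, targetCost]
        have := ht P hP
        linarith

/-- A join whose second branch carries too much flow, while the first one does not, has a toll below
its target. -/
theorem lt_target_of_fires (H : Comparable G c g h) (hT : (STree.par A B).Good G h)
    (hn : (STree.par A B).leaves.Nodup)
    (hκ : ∀ P ∈ (STree.par A B).paths, pathCost c P = (STree.par A B).innerCost U M z c₀ P + κ)
    (hA : A.Quiet U M z c₀ cs h err) (hB : B.Quiet U M z c₀ cs h err)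
    (h1 : 0 < (err) B.rep) (h2 : (err) A.rep ≤ 0) :
    targetCost U M cs B + (z B.rep : ℝ) / U < targetCost U M cs (STree.par A B) := by
  obtain ⟨h3, h4⟩ := hB.pos h1
  obtain ⟨Q, hQ, ht⟩ := (H.tight_of_val_pos hT.2.1 h3).le_left hT hn hκ
  have h5 : ∃ P ∈ A.paths, A.innerCost U M z c₀ P ≤ targetCost U M cs A := by
    rcases h2.lt_or_eq with h | h
    · obtain ⟨-, P, hP, h6⟩ := hA.neg h
      exact ⟨P, hP, h6.le⟩
    · exact (hA.zero h).2.1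
  obtain ⟨P, hP, h6⟩ := h5
  have h7 := ht P hP
  have h8 := h4 Q hQ
  rw [targetCost]
  linarith

/-- A join whose second branch carries too little flow, while the first one does not, has a toll above
its target. -/
theorem target_lt_of_fires (H : Comparable G c g h) (hT : (STree.par A B).Good G h)
    (hn : (STree.par A B).leaves.Nodup)
    (hκ : ∀ P ∈ (STree.par A B).paths, pathCost c P = (STree.par A B).innerCost U M z c₀ P + κ)
    (hA : A.Quiet U M z c₀ cs h err) (hB : B.Quiet U M z c₀ cs h err)
    (h1 : (err) B.rep < 0) (h2 : 0 ≤ (err) A.rep) :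
    targetCost U M cs (STree.par A B) < targetCost U M cs B + (z B.rep : ℝ) / U := by
  obtain ⟨h3, Q, hQ, h4⟩ := hB.neg h1
  have hu := hT.2.2.2.2 (H.used_of_val_neg hT.2.1 h3)
  have h5 : 0 ≤ A.val err ∧ ∀ P ∈ A.paths, targetCost U M cs A ≤ A.innerCost U M z c₀ P := by
    rcases h2.lt_or_eq with h | h
    · obtain ⟨h6, h7⟩ := hA.pos h
      exact ⟨h6.le, fun P hP => (h7 P hP).le⟩
    · obtain ⟨h6, -, h7⟩ := hA.zero h.symm
      exact ⟨(val_eq_zero h6).ge, h7 hu⟩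
  obtain ⟨P, hP, ht⟩ := (H.tight_of_used_of_val_nonneg hT.1 hu h5.1).le_right hT hn hκ
  have h7 := ht Q hQ
  have h8 := h5.2 P hP
  rw [targetCost]
  linarith

/-- The first join that fires reveals on which side of its target its search variable lies. If no join
fires, the tree is quiet. -/
theorem quiet_or_first_fires (H : Comparable G c g h) (hU : 0 < U)
    (hlt : ∀ e, total h e < total g e → cs e < c₀ e)
    (hgt : ∀ e, total g e < total h e → c₀ e < cs e)
    (heq : ∀ e, total g e = total h e → c₀ e = cs e)
    (hsg : ∀ e : Fin G.m, sg e = cmpReal (total g e) (total h e)) :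
    ∀ (T : STree G.m) (κ : ℝ), T.Good G h → T.leaves.Nodup →
      (∀ P ∈ T.paths, pathCost c P = T.innerCost U M z c₀ P + κ) →
      (T.recs.filter (Rec.fires sg) = [] → T.Quiet U M z c₀ cs h err) ∧
      ∀ r rs, T.recs.filter (Rec.fires sg) = r :: rs → ∃ x, IsTarget U M cs T r.repB x ∧
        (sg r.repB = 1 ∧ (z r.repB : ℝ) < x ∨ sg r.repB = -1 ∧ x < z r.repB) := by
  have hU' : (0 : ℝ) < U := by exact_mod_cast hU
  have hdiv : ∀ a b y : ℝ, a + y / U < b → y < (b - a) * U := by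
    intro a b y h1
    have : y / U < b - a := by linarith
    rwa [div_lt_iff₀ hU'] at this
  have hdiv' : ∀ a b y : ℝ, b < a + y / U → (b - a) * U < y := by
    intro a b y h1
    have : b - a < y / U := by linarith
    rwa [lt_div_iff₀ hU'] at this
  intro T
  induction T with
  | leaf e => exact fun κ _ _ _ => ⟨fun _ => .leaf e hlt hgt heq, fun r rs hr => by simp [recs] at hr⟩
  | ser A B ihA ihB =>
    intro κ hT hn hκ
    obtain ⟨nA, nB, -⟩ := List.nodup_append.1 hn
    have hκ' : ∀ P₁ ∈ A.paths, ∀ P₂ ∈ B.paths, pathCost c P₁ + pathCost c P₂ =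
        A.innerCost U M z c₀ P₁ + B.innerCost U M z c₀ P₂ + κ := by
      intro P₁ k₁ P₂ k₂
      rw [← pathCost_append, hκ _ ⟨P₁, k₁, P₂, k₂, rfl⟩, innerCost_ser hn k₁ k₂]
    obtain ⟨iA, jA⟩ := ihA (κ + B.innerCost U M z c₀ B.ref - pathCost c B.ref) hT.1 nA fun P hP => by
      have := hκ' P hP _ B.exists_mem_paths; linarith
    obtain ⟨iB, jB⟩ := ihB (κ + A.innerCost U M z c₀ A.ref - pathCost c A.ref) hT.2.1 nB fun P hP => by
      have := hκ' _ A.exists_mem_paths P hP; linarith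
    rw [recs, List.filter_append]
    refine ⟨fun hf => ?_, fun r rs hr => ?_⟩
    · rw [List.append_eq_nil_iff] at hf
      exact .ser H hT hn (iA hf.1) (iB hf.2)
    · rcases hfA : A.recs.filter (Rec.fires sg) with _ | ⟨a, as⟩
      · rw [hfA, List.nil_append] at hr
        obtain ⟨x, hx, hx'⟩ := jB r rs hr
        exact ⟨x, .inr hx, hx'⟩
      · rw [hfA, List.cons_append, List.cons.injEq] at hr
        obtain ⟨x, hx, hx'⟩ := jA a as hfA
        rw [hr.1] at hx hx'
        exact ⟨x, .inl hx, hx'⟩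
  | par A B ihA ihB =>
    intro κ hT hn hκ
    obtain ⟨nA, nB, -⟩ := List.nodup_append.1 hn
    obtain ⟨iA, jA⟩ := ihA (((M * (B.npar + 1) : ℕ) : ℝ) / U + κ) hT.1 nA fun P hP => by
      rw [hκ P (.inl hP), innerCost_par_left hn hP, add_assoc]
    obtain ⟨iB, jB⟩ := ihB ((z B.rep : ℝ) / U + κ) hT.2.1 nB fun P hP => by
      rw [hκ P (.inr hP), innerCost_par_right hn hP, add_assoc]
    rw [recs, List.filter_append, List.filter_append]
    have hsA := hsg A.rep
    have hsB := hsg B.rep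
    rcases hfA : A.recs.filter (Rec.fires sg) with _ | ⟨a, as⟩
    swap
    · refine ⟨fun hf => by simp at hf, fun r rs hr => ?_⟩
      rw [List.cons_append, List.cons_append, List.cons.injEq] at hr
      obtain ⟨x, hx, hx'⟩ := jA a as hfA
      rw [hr.1] at hx hx'
      exact ⟨x, .inl hx, hx'⟩
    rcases hfB : B.recs.filter (Rec.fires sg) with _ | ⟨b, bs⟩
    swap
    · refine ⟨fun hf => by simp at hf, fun r rs hr => ?_⟩
      rw [List.nil_append, List.cons_append, List.cons.injEq] at hr
      obtain ⟨x, hx, hx'⟩ := jB b bs hfB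
      rw [hr.1] at hx hx'
      exact ⟨x, .inr (.inl hx), hx'⟩
    have qA := iA hfA
    have qB := iB hfB
    rw [List.nil_append, List.nil_append, List.filter_cons, List.filter_nil]
    refine ⟨fun hf => ?_, fun r rs hr => ?_⟩
    · have hno : ¬ (sg B.rep ≠ 0 ∧ sg A.rep ≠ sg B.rep) := by
        rintro ⟨h1, h2⟩
        rw [if_pos (Rec.fires_iff.2 ⟨h1, h2⟩)] at hf
        simp at hf
      refine .par H hT hn hκ qA qB (fun hd => ?_) (fun hd => ?_) (fun hd => ?_)
      all_goals by_contra hcon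
      all_goals apply hno
      all_goals beta_reduce at hd hcon
      · rw [cmpReal_of_gt (by linarith)] at hsA
        rw [cmpReal_of_lt (by linarith)] at hsB
        rw [hsA, hsB]
        norm_num
      · rw [cmpReal_of_lt (by linarith)] at hsA
        rw [cmpReal_of_gt (by linarith)] at hsB
        rw [hsA, hsB]
        norm_num
      · have h1 : sg B.rep ≠ 0 := by
          rw [hsB, Ne, cmpReal_eq_zero_iff]
          exact fun h => hcon (by linarith)
        refine ⟨h1, ?_⟩
        rw [hsA, (cmpReal_eq_zero_iff _ _).2 (by linarith)]
        exact h1.symm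
    · split_ifs at hr with hfire
      simp only [List.cons.injEq] at hr
      obtain ⟨rfl, -⟩ := hr
      replace hfire : sg B.rep ≠ 0 ∧ sg A.rep ≠ sg B.rep := Rec.fires_iff.1 hfire
      refine ⟨(targetCost U M cs (STree.par A B) - targetCost U M cs B) * U,
        .inr (.inr ⟨rfl, ?_⟩), ?_⟩
      · field_simp; ring
      change sg B.rep = 1 ∧ _ ∨ sg B.rep = -1 ∧ _
      rcases lt_trichotomy (total g B.rep) (total h B.rep) with hB | hB | hB
      · right
        rw [hsB, cmpReal_of_lt hB] at hfire ⊢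
        refine ⟨rfl, hdiv' _ _ _ (target_lt_of_fires H hT hn hκ qA qB (by linarith) ?_)⟩
        by_contra hlt
        exact hfire.2 (by rw [hsA, cmpReal_of_lt (by linarith)])
      · rw [hsB, hB, cmpReal_self] at hfire
        exact (hfire.1 rfl).elim
      · left
        rw [hsB, cmpReal_of_gt hB] at hfire ⊢
        refine ⟨rfl, hdiv _ _ _ (lt_target_of_fires H hT hn hκ qA qB (by linarith) ?_)⟩
        by_contra hlt
        exact hfire.2 (by rw [hsA, cmpReal_of_gt (by linarith)])

end STree

end SepaTolls
namespace SepaTolls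

/-! ### The reduction algorithm -/

section Generic

variable {α β : Type}

/-- Replaces two items with ends `uv` by their join. -/
def parAt (key : α → ℕ × ℕ) (join : α → α → α) (uv : ℕ × ℕ) (L : List α) : List α :=
  match L.filter fun a => decide ((key a).1 = uv.1) && decide ((key a).2 = uv.2) with
  | [] => L
  | a :: la => match la with
    | [] => L
    | b :: lb => join a b ::
      (lb ++ L.filter fun a => !(decide ((key a).1 = uv.1) && decide ((key a).2 = uv.2)))

/-- Replaces the items that end or start at the node `v` by their join, if there is one of each and `v`
is not a terminal. -/
def serAt (key : α → ℕ × ℕ) (join : α → α → α) (s t v : ℕ) (L : List α) : List α :=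
  if decide (v = s) || decide (v = t) then L else
  match L.filter fun a => decide ((key a).2 = v) with
  | [] => L
  | a :: la => match la with
    | _ :: _ => L
    | [] => match L.filter fun a => decide ((key a).1 = v) with
      | [] => L
      | b :: lb => match lb with
        | _ :: _ => L
        | [] => join a b :: L.filter fun a => !decide ((key a).2 = v) && !decide ((key a).1 = v)

/-- One step of the reduction: a parallel and a series reduction at the given ends. -/
def reduceAt (key : α → ℕ × ℕ) (jp js : α → α → α) (s t : ℕ) (uv : ℕ × ℕ) (L : List α) : List α :=
  serAt key js s t uv.2 (parAt key jp uv L)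

variable {key : α → ℕ × ℕ} {key' : β → ℕ × ℕ} {D : α → β}

theorem parAt_map {join : α → α → α} {join' : β → β → β} (hk : ∀ a, key' (D a) = key a)
    (hj : ∀ a b, join' (D a) (D b) = D (join a b)) (uv : ℕ × ℕ) (L : List α) :
    parAt key' join' uv (L.map D) = (parAt key join uv L).map D := by
  unfold parAt
  simp only [List.filter_map, Function.comp_def, hk]
  rcases L.filter fun a => decide ((key a).1 = uv.1) && decide ((key a).2 = uv.2) with _ | ⟨a, _ | ⟨b, lb⟩⟩
  · rfl
  · rfl
  · simp [hj]

theorem serAt_map {join : α → α → α} {join' : β → β → β} (hk : ∀ a, key' (D a) = key a)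
    (hj : ∀ a b, join' (D a) (D b) = D (join a b)) (s t v : ℕ) (L : List α) :
    serAt key' join' s t v (L.map D) = (serAt key join s t v L).map D := by
  unfold serAt
  simp only [List.filter_map, Function.comp_def, hk]
  split_ifs
  · rfl
  rcases L.filter fun a => decide ((key a).2 = v) with _ | ⟨a, _ | ⟨a', la⟩⟩
  · rfl
  · rcases L.filter fun a => decide ((key a).1 = v) with _ | ⟨b, _ | ⟨b', lb⟩⟩
    · rfl
    · simp [hj]
    · rfl
  · rfl

theorem parAt_cases (key : α → ℕ × ℕ) (join : α → α → α) (uv : ℕ × ℕ) (L : List α) :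
    ((L.filter fun a => decide ((key a).1 = uv.1) && decide ((key a).2 = uv.2)).length ≤ 1 ∧
      parAt key join uv L = L) ∨
    ∃ a b R, L.Perm (a :: b :: R) ∧ key a = uv ∧ key b = uv ∧ parAt key join uv L = join a b :: R := by
  unfold parAt
  have hp := List.filter_append_perm
    (fun a => decide ((key a).1 = uv.1) && decide ((key a).2 = uv.2)) L
  have hm : ∀ a ∈ L.filter fun a => decide ((key a).1 = uv.1) && decide ((key a).2 = uv.2), key a = uv := by
    intro a ha
    have := (List.mem_filter.1 ha).2
    rw [Bool.and_eq_true, decide_eq_true_iff, decide_eq_true_iff] at this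
    exact Prod.ext this.1 this.2
  rcases h : L.filter fun a => decide ((key a).1 = uv.1) && decide ((key a).2 = uv.2) with
    _ | ⟨a, _ | ⟨b, lb⟩⟩
  · exact .inl ⟨by simp, rfl⟩
  · exact .inl ⟨by simp, rfl⟩
  · rw [h] at hp hm
    exact .inr ⟨a, b, _, hp.symm, hm a (by simp), hm b (by simp), rfl⟩

theorem serAt_cases (key : α → ℕ × ℕ) (join : α → α → α) (s t v : ℕ) (L : List α)
    (hloop : ∀ a ∈ L, (key a).1 ≠ (key a).2) :
    ((v ≠ s → v ≠ t → (L.filter fun a => decide ((key a).2 = v)).length = 1 →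
      (L.filter fun a => decide ((key a).1 = v)).length = 1 → False) ∧ serAt key join s t v L = L) ∨
    ∃ a b R, L.Perm (a :: b :: R) ∧ (key a).2 = v ∧ (key b).1 = v ∧ v ≠ s ∧ v ≠ t ∧
      (∀ x ∈ R, (key x).1 ≠ v ∧ (key x).2 ≠ v) ∧ serAt key join s t v L = join a b :: R := by
  unfold serAt
  split_ifs with hst
  · refine .inl ⟨fun h1 h2 => ?_, rfl⟩
    simp [h1, h2] at hst
  simp only [Bool.or_eq_true, decide_eq_true_eq, not_or] at hst
  have hp := List.filter_append_perm (fun a => decide ((key a).2 = v)) L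
  have hp' := List.filter_append_perm (fun a => decide ((key a).1 = v))
    (L.filter fun a => !decide ((key a).2 = v))
  have hm : ∀ a ∈ L.filter fun a => decide ((key a).2 = v), (key a).2 = v := fun a ha => by
    simpa using (List.mem_filter.1 ha).2
  have hm' : ∀ a ∈ L.filter fun a => decide ((key a).1 = v), (key a).1 = v := fun a ha => by
    simpa using (List.mem_filter.1 ha).2
  have e1 : (L.filter fun a => !decide ((key a).2 = v)).filter (fun a => decide ((key a).1 = v)) =
      L.filter fun a => decide ((key a).1 = v) := by
    rw [List.filter_filter]
    refine List.filter_congr fun a ha => ?_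
    have := hloop a ha
    by_cases h : (key a).1 = v <;> simp [h]
    rintro h'
    exact this (h.trans h'.symm)
  have e2 : (L.filter fun a => !decide ((key a).2 = v)).filter (fun a => !decide ((key a).1 = v)) =
      L.filter fun a => !decide ((key a).2 = v) && !decide ((key a).1 = v) := by
    rw [List.filter_filter]
    refine List.filter_congr fun a _ => ?_
    rw [Bool.and_comm]
  rcases h : L.filter fun a => decide ((key a).2 = v) with _ | ⟨a, _ | ⟨a', la⟩⟩
  · exact .inl ⟨by simp, rfl⟩
  · rcases h' : L.filter fun a => decide ((key a).1 = v) with _ | ⟨b, _ | ⟨b', lb⟩⟩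
    · exact .inl ⟨by simp, rfl⟩
    · right
      rw [h] at hp hm
      rw [e1, e2, h'] at hp'
      rw [h'] at hm'
      refine ⟨a, b, _, (hp.symm.trans ?_), hm a (by simp), hm' b (by simp), hst.1, hst.2, ?_, rfl⟩
      · exact (hp'.symm.cons a)
      · intro x hx
        have := (List.mem_filter.1 hx).2
        simp only [Bool.and_eq_true, Bool.not_eq_true', decide_eq_false_iff_not] at this
        exact ⟨this.2, this.1⟩
    · exact .inl ⟨by simp, rfl⟩
  · exact .inl ⟨by simp, rfl⟩

end Generic

namespace STree

variable {m : ℕ}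

/-- The commodities that use a path through the tree; `us` lists those that use an edge. -/
def users (us : Fin m → List ℕ) : STree m → List ℕ
  | leaf e => us e
  | ser A B => (users us A).filter fun i => decide (i ∈ users us B)
  | par A B => users us A ++ users us B

/-- A parallel join whose first branch is used, if possible. -/
def joinPar (us : Fin m → List ℕ) (A B : STree m) : STree m :=
  match users us A with
  | [] => par B A
  | _ :: _ => par A B

variable {G : Network} {k : ℕ}

/-- The ends of a tree as numbers. -/
def ends (G : Network) (T : STree G.m) : ℕ × ℕ := (T.src G, T.snk G)

theorem mem_users {us : Fin G.m → List ℕ} {h : Fin k → Fin G.m → ℝ}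
    (hus : ∀ e i, i ∈ us e ↔ ∃ j : Fin k, (j : ℕ) = i ∧ 0 < h j e) {T : STree G.m} {i : ℕ} :
    i ∈ T.users us ↔ ∃ j : Fin k, (j : ℕ) = i ∧ T.Used (h j) := by
  induction T with
  | leaf e =>
    rw [users, hus]
    refine exists_congr fun j => and_congr_right fun _ => ⟨fun h => ⟨[e], rfl, by simpa using h⟩, ?_⟩
    rintro ⟨_, rfl, h⟩
    exact h e (by simp)
  | ser A B ihA ihB =>
    rw [users, List.mem_filter, decide_eq_true_iff, ihA, ihB]
    constructor
    · rintro ⟨⟨j, rfl, P, hP, h1⟩, ⟨j', hj', Q, hQ, h2⟩⟩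
      obtain rfl := Fin.ext hj'
      exact ⟨j', rfl, _, ⟨P, hP, Q, hQ, rfl⟩, fun e he => (List.mem_append.1 he).elim (h1 e) (h2 e)⟩
    · rintro ⟨j, rfl, _, ⟨P, hP, Q, hQ, rfl⟩, h1⟩
      exact ⟨⟨j, rfl, P, hP, fun e he => h1 e (List.mem_append_left _ he)⟩,
        ⟨j, rfl, Q, hQ, fun e he => h1 e (List.mem_append_right _ he)⟩⟩
  | par A B ihA ihB =>
    rw [users, List.mem_append, ihA, ihB]
    constructor
    · rintro (⟨j, rfl, P, hP, h1⟩ | ⟨j, rfl, P, hP, h1⟩)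
      · exact ⟨j, rfl, P, .inl hP, h1⟩
      · exact ⟨j, rfl, P, .inr hP, h1⟩
    · rintro ⟨j, rfl, P, hP | hP, h1⟩
      · exact .inl ⟨j, rfl, P, hP, h1⟩
      · exact .inr ⟨j, rfl, P, hP, h1⟩

theorem exists_edge (T : STree G.m) : (∃ e, T.src G = G.tail e) ∧ ∃ e, T.snk G = G.head e := by
  induction T with
  | leaf e => exact ⟨⟨e, rfl⟩, ⟨e, rfl⟩⟩
  | ser A B ihA ihB => exact ⟨ihA.1, ihB.2⟩
  | par A B ihA _ => exact ihA

end STree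

open STree

/-- The net outflow at `w` of a unit of flow from `x` to `y`. -/
def dip {n : ℕ} (x y w : Fin n) : ℝ := (if x = w then 1 else 0) - (if y = w then 1 else 0)

/-- The trees in the list describe parts of the network that make up the whole of it. -/
structure Partial (G : Network) (s t : Fin G.n) {k : ℕ} (h : Fin k → Fin G.m → ℝ)
    (L : List (STree G.m)) : Prop where
  good : ∀ T ∈ L, T.Good G h
  sp : SP (L.map fun T => (T.src G, T.snk G) : Multiset (Fin G.n × Fin G.n)) s t
  perm : (L.flatMap leaves).Perm (List.finRange G.m)
  circ : ∀ d : Fin G.m → ℝ, (∀ v, G.netOut d v = 0) → ∀ w, (L.map fun T =>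
    T.val d * dip (T.src G) (T.snk G) w).sum = 0

namespace Partial

variable {G : Network} {s t : Fin G.n} {k : ℕ} {h : Fin k → Fin G.m → ℝ} {L L' : List (STree G.m)}
  {us : Fin G.m → List ℕ}

theorem of_perm (H : Partial G s t h L) (hp : L.Perm L') : Partial G s t h L' where
  good T hT := H.good T (hp.mem_iff.2 hT)
  sp := by
    have := Multiset.coe_eq_coe.2 (hp.map fun T => (T.src G, T.snk G))
    rw [← this]
    exact H.sp
  perm := (hp.flatMap_right leaves).symm.trans H.perm
  circ d hd w := by
    rw [← (hp.map _).sum_eq]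
    exact H.circ d hd w

theorem leaves_list (hG : G.IsSepa s t) : Partial G s t h ((List.finRange G.m).map leaf) where
  good T hT := by
    obtain ⟨e, -, rfl⟩ := List.mem_map.1 hT
    trivial
  sp := by
    have := hG.1.sp
    rw [Fin.univ_def] at this
    rw [List.map_map]
    exact this
  perm := by
    rw [List.flatMap_map]
    simp [leaves]
  circ d hd w := by
    refine Eq.trans ?_ (hd w)
    rw [List.map_map, Network.netOut, Finset.sum_filter, Finset.sum_filter,
      ← Finset.sum_sub_distrib, ← List.sum_ofFn, List.ofFn_eq_map]
    refine congrArg List.sum (List.map_congr_left fun e _ => ?_)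
    change d e * dip (G.tail e) (G.head e) w = _
    by_cases h1 : G.tail e = w <;> by_cases h2 : G.head e = w <;> simp [dip, h1, h2]

variable {a b : STree G.m} {R : List (STree G.m)}

theorem merge_parallel (H : Partial G s t h (a :: b :: R)) (hsrc : a.src G = b.src G)
    (hsnk : a.snk G = b.snk G) (hu : (∃ i, b.Used (h i)) → ∃ i, a.Used (h i)) :
    Partial G s t h (par a b :: R) where
  good T hT := by
    rcases List.mem_cons.1 hT with rfl | hT
    · exact ⟨H.good a (by simp), H.good b (by simp), hsrc, hsnk, hu⟩
    · exact H.good T (by simp [hT])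
  sp := by
    refine H.sp.merge_parallel (a.src G) (a.snk G) (R.map fun T => (T.src G, T.snk G)) ?_
    rw [List.map_cons, List.map_cons, ← hsrc, ← hsnk]
    rfl
  perm := by
    have := H.perm
    simpa [List.flatMap_cons, leaves] using this
  circ d hd w := by
    have := H.circ d hd w
    simp only [List.map_cons, List.sum_cons, val, src, snk] at this ⊢
    rw [← hsrc, ← hsnk] at this
    linarith [add_mul (val d a) (val d b) (dip (a.src G) (a.snk G) w)]

theorem joinPar (H : Partial G s t h (a :: b :: R)) (hsrc : a.src G = b.src G)
    (hsnk : a.snk G = b.snk G) (hus : ∀ e i, i ∈ us e ↔ ∃ j : Fin k, (j : ℕ) = i ∧ 0 < h j e) :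
    Partial G s t h (joinPar us a b :: R) := by
  unfold STree.joinPar
  rcases hu : users us a with _ | ⟨i, l⟩
  · refine (H.of_perm (List.Perm.swap b a R)).merge_parallel hsrc.symm hsnk.symm ?_
    rintro ⟨i, hi⟩
    have := (mem_users hus (T := a)).2 ⟨i, rfl, hi⟩
    rw [hu] at this
    simp at this
  · refine H.merge_parallel hsrc hsnk fun _ => ?_
    have hi : i ∈ users us a := by rw [hu]; simp
    obtain ⟨j, -, hj⟩ := (mem_users hus).1 hi
    exact ⟨j, hj⟩

theorem src_ne_snk (H : Partial G s t h L) {T : STree G.m} (hT : T ∈ L) : T.src G ≠ T.snk G :=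
  (H.sp.arc _ _ (Multiset.mem_coe.2 (List.mem_map_of_mem hT))).1

theorem merge_series (H : Partial G s t h (a :: b :: R)) (hv : a.snk G = b.src G)
    (hR : ∀ T ∈ R, T.src G ≠ b.src G ∧ T.snk G ≠ b.src G) (hs : b.src G ≠ s) (ht : b.src G ≠ t) :
    Partial G s t h (ser a b :: R) := by
  have ha := H.src_ne_snk (T := a) (by simp)
  have hb := H.src_ne_snk (T := b) (by simp)
  have hval : ∀ d : Fin G.m → ℝ, (∀ v, G.netOut d v = 0) → val d a = val d b := by
    intro d hd
    have h1 := H.circ d hd (b.src G)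
    have h2 : (R.map fun T => T.val d * dip (T.src G) (T.snk G) (b.src G)).sum = 0 := by
      refine List.sum_eq_zero fun x hx => ?_
      obtain ⟨T, hT, rfl⟩ := List.mem_map.1 hx
      simp [dip, hR T hT]
    simp only [List.map_cons, List.sum_cons, h2] at h1
    rw [hv] at ha
    simp only [dip, hv, if_neg ha, if_neg hb.symm, if_true] at h1
    linarith
  refine ⟨fun T hT => ?_, ?_, ?_, fun d hd w => ?_⟩
  · rcases List.mem_cons.1 hT with rfl | hT
    · exact ⟨H.good a (by simp), H.good b (by simp), hv, hval⟩
    · exact H.good T (by simp [hT])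
  · refine H.sp.merge_series (a.src G) (b.src G) (b.snk G) (R.map fun T => (T.src G, T.snk G)) ?_ ?_ hs ht
    · rw [List.map_cons, List.map_cons, hv]
      rfl
    · rintro ⟨x, hx, hx'⟩
      obtain ⟨T, hT, rfl⟩ := List.mem_map.1 (Multiset.mem_coe.1 hx)
      exact hx'.elim (hR T hT).1 (hR T hT).2
  · have := H.perm
    simpa [List.flatMap_cons, leaves] using this
  · have := H.circ d hd w
    simp only [List.map_cons, List.sum_cons, val, src, snk] at this ⊢
    rw [← hval d hd, hv] at this
    have h1 : dip (a.src G) (b.snk G) w = dip (a.src G) (b.src G) w + dip (b.src G) (b.snk G) w := by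
      unfold dip; ring
    rw [h1]
    linarith

/-- A reduction step keeps the invariant, and it changes the list only by shortening it. -/
theorem reduceAt (H : Partial G s t h L)
    (hus : ∀ e i, i ∈ us e ↔ ∃ j : Fin k, (j : ℕ) = i ∧ 0 < h j e) (uv : ℕ × ℕ) :
    Partial G s t h (reduceAt (ends G) (STree.joinPar us) ser s t uv L) ∧
    (SepaTolls.reduceAt (ends G) (STree.joinPar us) ser s t uv L = L ∧
      (L.filter fun a => decide ((ends G a).1 = uv.1) && decide ((ends G a).2 = uv.2)).length ≤ 1 ∧
      (uv.2 ≠ s → uv.2 ≠ t → (L.filter fun a => decide ((ends G a).2 = uv.2)).length = 1 →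
        (L.filter fun a => decide ((ends G a).1 = uv.2)).length = 1 → False) ∨
    (SepaTolls.reduceAt (ends G) (STree.joinPar us) ser s t uv L).length < L.length) := by
  have hpar : Partial G s t h (parAt (ends G) (STree.joinPar us) uv L) ∧
      (parAt (ends G) (STree.joinPar us) uv L = L ∧
      (L.filter fun a => decide ((ends G a).1 = uv.1) && decide ((ends G a).2 = uv.2)).length ≤ 1 ∨
      (parAt (ends G) (STree.joinPar us) uv L).length < L.length) := by
    rcases parAt_cases (ends G) (STree.joinPar us) uv L with ⟨h1, h2⟩ | ⟨a, b, R, h1, h2, h3, h4⟩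
    · rw [h2]
      exact ⟨H, .inl ⟨rfl, h1⟩⟩
    · rw [h4]
      have h5 := h2.trans h3.symm
      simp only [ends, Prod.mk.injEq, Fin.val_inj] at h5
      refine ⟨(H.of_perm h1).joinPar h5.1 h5.2 hus, .inr ?_⟩
      rw [h1.length_eq]
      simp
  obtain ⟨H', hpar⟩ := hpar
  unfold SepaTolls.reduceAt
  rcases serAt_cases (ends G) ser s t uv.2 (parAt (ends G) (STree.joinPar us) uv L)
    (fun T hT hl => H'.src_ne_snk hT (Fin.ext hl)) with ⟨h1, h2⟩ | ⟨a, b, R, h1, h2, h3, h4, h5, h6, h7⟩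
  · rw [h2]
    refine ⟨H', hpar.imp (fun hp => ?_) fun hp => hp⟩
    rw [hp.1] at h1
    exact ⟨hp.1, hp.2, h1⟩
  · rw [h7]
    have h8 : a.snk G = b.src G := Fin.ext (h2.trans h3.symm)
    refine ⟨(H'.of_perm h1).merge_series h8 (fun T hT => ?_) ?_ ?_, .inr ?_⟩
    · have := h6 T hT
      rw [← h3] at this
      simpa [ends, Fin.val_inj] using this
    · rintro rfl; exact h4 h3.symm
    · rintro rfl; exact h5 h3.symm
    · have h9 : (parAt (ends G) (STree.joinPar us) uv L).length ≤ L.length := by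
        rcases hpar with hp | hp
        · rw [hp.1]
        · exact hp.le
      rw [h1.length_eq] at h9
      simp only [List.length_cons] at h9 ⊢
      omega

/-- As long as there are two items, one of the reductions is possible. -/
theorem exists_reduceAt (H : Partial G s t h L)
    (hus : ∀ e i, i ∈ us e ↔ ∃ j : Fin k, (j : ℕ) = i ∧ 0 < h j e) (hL : L.length ≠ 1) :
    ∃ e e', (SepaTolls.reduceAt (ends G) (STree.joinPar us) ser s t ((G.tail e : ℕ), (G.head e' : ℕ)) L).length
      < L.length := by
  have hmem : ∀ u v, (u, v) ∈ (L.map fun T => (T.src G, T.snk G) : Multiset (Fin G.n × Fin G.n)) →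
      ∃ e e', u = G.tail e ∧ v = G.head e' := by
    intro u v huv
    obtain ⟨T, -, hT⟩ := List.mem_map.1 (Multiset.mem_coe.1 huv)
    simp only [Prod.mk.injEq] at hT
    obtain ⟨⟨e, he⟩, ⟨e', he'⟩⟩ := T.exists_edge
    exact ⟨e, e', hT.1.symm.trans he, hT.2.symm.trans he'⟩
  have hcount : ∀ (p : Fin G.n × Fin G.n → Bool), (L.filter fun T => p (T.src G, T.snk G)).length =
      Multiset.countP (fun x => p x = true) (L.map fun T => (T.src G, T.snk G)) := by
    intro p
    rw [Multiset.coe_countP, List.countP_map, ← List.countP_eq_length_filter]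
    simp [Function.comp_def]
  rcases H.sp.exists_reduction with h1 | ⟨u, v, M', h1⟩ | ⟨u, v, w, M', h1, h2, h3, h4⟩
  · have := congrArg Multiset.card h1
    simp only [Multiset.coe_card, List.length_map, Multiset.card_singleton] at this
    exact (hL this).elim
  · obtain ⟨e, e', rfl, rfl⟩ := hmem u v (by rw [h1]; simp)
    refine ⟨e, e', ?_⟩
    rcases (H.reduceAt hus ((G.tail e : ℕ), (G.head e' : ℕ))).2 with ⟨-, h5, -⟩ | h5
    · have := hcount fun x => decide ((x.1 : ℕ) = G.tail e) && decide ((x.2 : ℕ) = G.head e')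
      have h6 := this.symm.trans_le h5
      rw [h1, Multiset.countP_cons_of_pos _ (by simp), Multiset.countP_cons_of_pos _ (by simp)] at h6
      omega
    · exact h5
  · obtain ⟨e, e', rfl, rfl⟩ := hmem u v (by rw [h1]; simp)
    refine ⟨e, e', ?_⟩
    have harc := H.sp.arc
    rw [h1] at harc
    have huv := (harc (G.tail e) (G.head e') (by simp)).1
    have hvw := (harc (G.head e') w (by simp)).1
    rcases (H.reduceAt hus ((G.tail e : ℕ), (G.head e' : ℕ))).2 with ⟨-, -, h5⟩ | h5
    · have c1 := hcount fun x => decide ((x.2 : ℕ) = G.head e')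
      have c2 := hcount fun x => decide ((x.1 : ℕ) = G.head e')
      rw [h1] at c1 c2
      rw [Multiset.countP_cons_of_pos _ (by simp), Multiset.countP_cons_of_neg _
        (by simpa [Fin.val_inj] using hvw.symm), Multiset.countP_eq_zero.2] at c1
      · rw [Multiset.countP_cons_of_neg _ (by simpa [Fin.val_inj] using huv),
          Multiset.countP_cons_of_pos _ (by simp), Multiset.countP_eq_zero.2] at c2
        · refine (h5 ?_ ?_ c1 c2).elim
          · exact fun h => h3 (Fin.ext h)
          · exact fun h => h4 (Fin.ext h)
        · intro x hx hx'
          rw [decide_eq_true_iff, Fin.val_inj] at hx'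
          exact h2 ⟨x, hx, .inl hx'⟩
      · intro x hx hx'
        rw [decide_eq_true_iff, Fin.val_inj] at hx'
        exact h2 ⟨x, hx, .inr hx'⟩
    · exact h5

theorem foldl (H : Partial G s t h L)
    (hus : ∀ e i, i ∈ us e ↔ ∃ j : Fin k, (j : ℕ) = i ∧ 0 < h j e) (ops : List (ℕ × ℕ)) :
    Partial G s t h (ops.foldl (fun L uv => SepaTolls.reduceAt (ends G) (STree.joinPar us) ser s t uv L) L) ∧
    ((ops.foldl (fun L uv => SepaTolls.reduceAt (ends G) (STree.joinPar us) ser s t uv L) L).length < L.length ∨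
      ∀ uv ∈ ops, SepaTolls.reduceAt (ends G) (STree.joinPar us) ser s t uv L = L) ∧
    (ops.foldl (fun L uv => SepaTolls.reduceAt (ends G) (STree.joinPar us) ser s t uv L) L).length ≤
      L.length := by
  induction ops generalizing L with
  | nil => exact ⟨H, .inr (by simp), le_rfl⟩
  | cons uv ops ih =>
    obtain ⟨H', h1⟩ := H.reduceAt hus uv
    obtain ⟨H'', h2, h3⟩ := ih H'
    refine ⟨H'', ?_, h3.trans ?_⟩
    · rcases h1 with ⟨h1, -⟩ | h1
      · rw [List.foldl_cons]
        rw [h1] at h2 ⊢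
        refine h2.imp id fun h2 x hx => ?_
        rcases List.mem_cons.1 hx with rfl | hx
        · exact h1
        · exact h2 x hx
      · exact .inl (h3.trans_lt h1)
    · rcases h1 with ⟨h1, -⟩ | h1
      · rw [h1]
      · exact h1.le

end Partial

/-- The order in which reductions are tried: for every edge, once at all possible ends. -/
def schedule (E : List (ℕ × ℕ)) : List (ℕ × ℕ) :=
  E.flatMap fun _ => E.flatMap fun e => E.map fun e' => (e.1, e'.2)

/-- The schedule reduces a series-parallel network to a single tree. -/
theorem Partial.reduce {G : Network} {s t : Fin G.n} {k : ℕ} {h : Fin k → Fin G.m → ℝ}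
    (hG : G.IsSepa s t) {us : Fin G.m → List ℕ}
    (hus : ∀ e i, i ∈ us e ↔ ∃ j : Fin k, (j : ℕ) = i ∧ 0 < h j e) :
    ∃ T, (schedule (List.ofFn fun e => ((G.tail e : ℕ), (G.head e : ℕ)))).foldl
      (fun L uv => SepaTolls.reduceAt (ends G) (STree.joinPar us) ser s t uv L)
      ((List.finRange G.m).map leaf) = [T] ∧ Partial G s t h [T] := by
  set E := List.ofFn fun e => ((G.tail e : ℕ), (G.head e : ℕ)) with hE
  set R := E.flatMap fun e => E.map fun e' => (e.1, e'.2) with hR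
  have key : ∀ (l : List (ℕ × ℕ)) (L : List (STree G.m)), Partial G s t h L →
      Partial G s t h ((l.flatMap fun _ => R).foldl
        (fun L uv => SepaTolls.reduceAt (ends G) (STree.joinPar us) ser s t uv L) L) ∧
      (((l.flatMap fun _ => R).foldl
        (fun L uv => SepaTolls.reduceAt (ends G) (STree.joinPar us) ser s t uv L) L).length = 1 ∨
      ((l.flatMap fun _ => R).foldl
        (fun L uv => SepaTolls.reduceAt (ends G) (STree.joinPar us) ser s t uv L) L).length + l.length
          ≤ L.length) := by
    intro l
    induction l with
    | nil => intro L HL; exact ⟨HL, .inr (by simp)⟩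
    | cons x l ih =>
      intro L HL
      rw [List.flatMap_cons, List.foldl_append]
      obtain ⟨H', h1, h2⟩ := HL.foldl hus R
      obtain ⟨H'', h3⟩ := ih _ H'
      refine ⟨H'', ?_⟩
      rcases h3 with h3 | h3
      · exact .inl h3
      rcases h1 with h1 | h1
      · right
        rw [List.length_cons]
        omega
      · by_cases hL : L.length = 1
        · left
          have h4 := (H'.foldl hus (l.flatMap fun _ => R)).2.2
          have h5 := H''.sp.on.1
          obtain ⟨y, hy, -⟩ := h5
          obtain ⟨T, hT, -⟩ := List.mem_map.1 (Multiset.mem_coe.1 hy)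
          have := List.length_pos_of_mem hT
          omega
        · obtain ⟨e, e', h4⟩ := HL.exists_reduceAt hus hL
          rw [h1 _ ?_] at h4
          · exact (lt_irrefl _ h4).elim
          · rw [hR, List.mem_flatMap]
            refine ⟨((G.tail e : ℕ), (G.head e : ℕ)), List.mem_ofFn.2 ⟨e, rfl⟩, List.mem_map.2
              ⟨((G.tail e' : ℕ), (G.head e' : ℕ)), List.mem_ofFn.2 ⟨e', rfl⟩, rfl⟩⟩
  obtain ⟨H, h1⟩ := key E _ (Partial.leaves_list hG)
  have h2 : ((E.flatMap fun _ => R).foldl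
      (fun L uv => SepaTolls.reduceAt (ends G) (STree.joinPar us) ser s t uv L)
      ((List.finRange G.m).map leaf)).length = 1 := by
    rcases h1 with h1 | h1
    · exact h1
    · obtain ⟨y, hy, -⟩ := H.sp.on.1
      obtain ⟨T, hT, -⟩ := List.mem_map.1 (Multiset.mem_coe.1 hy)
      have := List.length_pos_of_mem hT
      have hEm : E.length = G.m := List.length_ofFn
      rw [List.length_map, List.length_finRange] at h1
      omega
  obtain ⟨T, hT⟩ := List.length_eq_one_iff.1 h2
  refine ⟨T, hT, ?_⟩
  rw [hT] at H
  exact H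

/-- A single tree that makes up the network spans its terminals, and circulations have value zero. -/
theorem Partial.single {G : Network} {s t : Fin G.n} {k : ℕ} {h : Fin k → Fin G.m → ℝ}
    {T : STree G.m} (H : Partial G s t h [T]) :
    T.Good G h ∧ T.src G = s ∧ T.snk G = t ∧ T.leaves.Nodup ∧ (∀ e, e ∈ T.leaves) ∧
      T.leaves.length = G.m ∧ ∀ d : Fin G.m → ℝ, (∀ v, G.netOut d v = 0) → T.val d = 0 := by
  have hp := H.perm
  simp only [List.flatMap_singleton] at hp
  have hst : T.src G = s ∧ T.snk G = t := by
    have h1 := H.sp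
    rcases h1.exists_reduction with h2 | ⟨u, v, M', h2⟩ | ⟨u, v, w, M', h2, -⟩
    · simpa using h2
    · have := congrArg Multiset.card h2
      simp at this
    · have := congrArg Multiset.card h2
      simp at this
  refine ⟨H.good T (by simp), hst.1, hst.2, hp.nodup_iff.2 (List.nodup_finRange _),
    fun e => hp.mem_iff.2 (List.mem_finRange e), by rw [hp.length_eq, List.length_finRange],
    fun d hd => ?_⟩
  have h1 := H.circ d hd (T.src G)
  have h2 := H.src_ne_snk (T := T) (by simp)
  simpa [dip, h2.symm] using h1

end SepaTolls
namespace SepaTolls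

/-! ### The reduction algorithm on data -/

/-- What the algorithm stores about a tree: source, sink, representative edge, cut, number of parallel
joins, users, records. -/
abbrev Item : Type := ℕ × ℕ × ℕ × List ℕ × ℕ × List ℕ × List Rec

namespace Item

/-- The source and the sink of the item. -/
def key (a : Item) : ℕ × ℕ := (a.1, a.2.1)

/-- The representative edge. -/
def rep (a : Item) : ℕ := a.2.2.1

/-- The edges that leave the source. -/
def cut (a : Item) : List ℕ := a.2.2.2.1

/-- The number of parallel joins. -/
def npar (a : Item) : ℕ := a.2.2.2.2.1

/-- The commodities that use the item in the target flow. -/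
def users (a : Item) : List ℕ := a.2.2.2.2.2.1

/-- The records of the parallel joins, inner joins first. -/
def recs (a : Item) : List Rec := a.2.2.2.2.2.2

/-- Series join. -/
def ser (a b : Item) : Item :=
  (a.key.1, b.key.2, a.rep, a.cut, a.npar + b.npar,
    a.users.filter fun i => decide (i ∈ b.users), a.recs ++ b.recs)

/-- Parallel join with reference branch `a`. -/
def par (a b : Item) : Item :=
  (a.key.1, a.key.2, a.rep, a.cut ++ b.cut, a.npar + b.npar + 1, a.users ++ b.users,
    a.recs ++ b.recs ++ [(a.rep, b.rep, a.cut, b.cut, b.npar)])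

/-- Parallel join whose reference branch is used, if possible. -/
def joinPar (a b : Item) : Item :=
  match a.users with
  | [] => par b a
  | _ :: _ => par a b

end Item

namespace STree

variable {G : Network}

/-- The item that represents a tree. -/
def data (G : Network) (us : Fin G.m → List ℕ) (T : STree G.m) : Item :=
  (T.src G, T.snk G, T.rep, T.cut.map Fin.val, T.npar, T.users us, T.recs)

theorem data_joinPar (us : Fin G.m → List ℕ) (A B : STree G.m) :
    Item.joinPar (A.data G us) (B.data G us) = (joinPar us A B).data G us := by
  unfold Item.joinPar joinPar
  have h : (A.data G us).users = A.users us := rfl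
  rw [h]
  rcases A.users us with _ | ⟨i, l⟩ <;>
    simp [data, Item.par, Item.key, Item.rep, Item.cut, Item.npar, Item.users, Item.recs, src, snk,
      rep, cut, npar, users, recs]

theorem data_ser (us : Fin G.m → List ℕ) (A B : STree G.m) :
    Item.ser (A.data G us) (B.data G us) = (ser A B).data G us := rfl

end STree

theorem foldl_reduceAt_data {G : Network} (us : Fin G.m → List ℕ) (s t : ℕ) (ops : List (ℕ × ℕ))
    (L : List (STree G.m)) :
    ops.foldl (fun L uv => reduceAt Item.key Item.joinPar Item.ser s t uv L) (L.map (STree.data G us)) =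
      (ops.foldl (fun L uv => reduceAt (STree.ends G) (STree.joinPar us) STree.ser s t uv L) L).map
        (STree.data G us) := by
  induction ops generalizing L with
  | nil => rfl
  | cons uv ops ih =>
    rw [List.foldl_cons, List.foldl_cons, ← ih]
    congr 1
    unfold reduceAt
    rw [parAt_map (D := STree.data G us) (key := STree.ends G) (fun _ => rfl) (STree.data_joinPar us),
      serAt_map (D := STree.data G us) (key := STree.ends G) (fun _ => rfl) (STree.data_ser us)]

section

variable {γ : Type} [Enc γ]

theorem PT.itemKey {a : γ → Item} (ha : PT a) : PT (fun c => (a c).key) := ha.fst.mk ha.snd.fst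

theorem PT.itemRep {a : γ → Item} (ha : PT a) : PT (fun c => (a c).rep) := ha.snd.snd.fst

theorem PT.itemCut {a : γ → Item} (ha : PT a) : PT (fun c => (a c).cut) := ha.snd.snd.snd.fst

theorem PT.itemNpar {a : γ → Item} (ha : PT a) : PT (fun c => (a c).npar) := ha.snd.snd.snd.snd.fst

theorem PT.itemUsers {a : γ → Item} (ha : PT a) : PT (fun c => (a c).users) :=
  ha.snd.snd.snd.snd.snd.fst

theorem PT.itemRecs {a : γ → Item} (ha : PT a) : PT (fun c => (a c).recs) :=
  ha.snd.snd.snd.snd.snd.snd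

theorem PT.itemSer {a b : γ → Item} (ha : PT a) (hb : PT b) : PT (fun c => (a c).ser (b c)) :=
  ha.itemKey.fst.mk (hb.itemKey.snd.mk (ha.itemRep.mk (ha.itemCut.mk ((ha.itemNpar.natAdd hb.itemNpar).mk
    ((ha.itemUsers.filter (f := fun x => decide (x.2 ∈ (b x.1).users))
      ((hb.itemUsers.comp PT.id.fst).natMem PT.id.snd)).mk (ha.itemRecs.append hb.itemRecs))))))

theorem PT.itemPar {a b : γ → Item} (ha : PT a) (hb : PT b) : PT (fun c => (a c).par (b c)) :=
  ha.itemKey.fst.mk (ha.itemKey.snd.mk (ha.itemRep.mk ((ha.itemCut.append hb.itemCut).mk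
    (((ha.itemNpar.natAdd hb.itemNpar).natAdd (PT.constNat 1)).mk
      ((ha.itemUsers.append hb.itemUsers).mk ((ha.itemRecs.append hb.itemRecs).append
        ((ha.itemRep.mk (hb.itemRep.mk (ha.itemCut.mk (hb.itemCut.mk hb.itemNpar)))).cons PT.nil)))))))

theorem PT.itemJoinPar {a b : γ → Item} (ha : PT a) (hb : PT b) :
    PT (fun c => (a c).joinPar (b c)) := by
  refine (ha.itemUsers.listCases (hb.itemPar ha) (g := fun x => (a x.1).par (b x.1))
    ((ha.comp PT.id.fst).itemPar (hb.comp PT.id.fst))).of_eq fun c => ?_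
  unfold Item.joinPar
  rcases (a c).users with _ | ⟨i, l⟩ <;> rfl

theorem PT.parAt {L : γ → List Item} {uv : γ → ℕ × ℕ} (hL : PT L) (huv : PT uv) :
    PT (fun c => parAt Item.key Item.joinPar (uv c) (L c)) := by
  have hp : PT fun x : γ × Item =>
      decide (x.2.key.1 = (uv x.1).1) && decide (x.2.key.2 = (uv x.1).2) :=
    (PT.id.snd.itemKey.fst.natEq (huv.comp PT.id.fst).fst).and
      (PT.id.snd.itemKey.snd.natEq (huv.comp PT.id.fst).snd)
  have h1 := PT.listCases (γ := γ × Item × List Item) (l := fun x => x.2.2) (f := fun x => L x.1)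
    (g := fun y => y.1.2.1.joinPar y.2.1 :: (y.2.2 ++ (L y.1.1).filter fun a =>
      !(decide (a.key.1 = (uv y.1.1).1) && decide (a.key.2 = (uv y.1.1).2))))
    PT.id.snd.snd (hL.comp PT.id.fst) ((PT.id.fst.snd.fst.itemJoinPar PT.id.snd.fst).cons
      (PT.id.snd.snd.append ((hL.filter hp.not).comp PT.id.fst.fst)))
  refine ((hL.filter hp).listCases hL h1).of_eq fun c => ?_
  unfold SepaTolls.parAt
  rcases hF : (L c).filter fun a => decide (a.key.1 = (uv c).1) && decide (a.key.2 = (uv c).2) with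
    _ | ⟨a, _ | ⟨b, lb⟩⟩ <;> simp only [hF]

set_option synthInstance.maxSize 512 in
set_option synthInstance.maxHeartbeats 100000 in
theorem PT.serAt {L : γ → List Item} {s t v : γ → ℕ} (hL : PT L) (hs : PT s) (ht : PT t) (hv : PT v) :
    PT (fun c => serAt Item.key Item.ser (s c) (t c) (v c) (L c)) := by
  have h1 : PT fun x : γ × Item => decide (x.2.key.1 = v x.1) :=
    PT.id.snd.itemKey.fst.natEq (hv.comp PT.id.fst)
  have h2 : PT fun x : γ × Item => decide (x.2.key.2 = v x.1) :=
    PT.id.snd.itemKey.snd.natEq (hv.comp PT.id.fst)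
  have h3 := PT.listCases (γ := (γ × Item × List Item) × Item × List Item) (l := fun x => x.2.2)
    (f := fun y => y.1.2.1.ser y.2.1 :: (L y.1.1).filter fun a =>
      !decide (a.key.2 = v y.1.1) && !decide (a.key.1 = v y.1.1))
    (g := fun y => L y.1.1.1)
    PT.id.snd.snd ((PT.id.fst.snd.fst.itemSer PT.id.snd.fst).cons
      ((hL.filter (h2.not.and h1.not)).comp PT.id.fst.fst)) (hL.comp PT.id.fst.fst.fst)
  have h4 := ((hL.filter h1).comp (PT.id (α := γ × Item × List Item)).fst).listCases
    (hL.comp PT.id.fst) h3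
  have h5 := PT.listCases (γ := γ × Item × List Item) (l := fun x => x.2.2) PT.id.snd.snd h4
    (g := fun y => L y.1.1) (hL.comp PT.id.fst.fst)
  refine (((hv.natEq hs).or (hv.natEq ht)).ite hL ((hL.filter h2).listCases hL h5)).of_eq fun c => ?_
  unfold SepaTolls.serAt
  refine if_congr Iff.rfl rfl ?_
  rcases hF : (L c).filter fun a => decide (a.key.2 = v c) with _ | ⟨a, _ | ⟨a', la⟩⟩
  · simp only [hF]
  · rcases hF' : (L c).filter fun a => decide (a.key.1 = v c) with _ | ⟨b, _ | ⟨b', lb⟩⟩ <;>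
      simp only [hF, hF']
  · simp only [hF]

theorem PT.reduceAt {L : γ → List Item} {s t : γ → ℕ} {uv : γ → ℕ × ℕ} (hL : PT L) (hs : PT s)
    (ht : PT t) (huv : PT uv) :
    PT (fun c => reduceAt Item.key Item.joinPar Item.ser (s c) (t c) (uv c) (L c)) :=
  (hL.parAt huv).serAt hs ht huv.snd

theorem PT.schedule {E : γ → List (ℕ × ℕ)} (hE : PT E) : PT (fun c => schedule (E c)) := by
  have h1 : PT fun y : (γ × (ℕ × ℕ)) × (ℕ × ℕ) => (E y.1.1).map fun e' => (y.2.1, e'.2) :=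
    (hE.comp PT.id.fst.fst).map (f := fun z : ((γ × (ℕ × ℕ)) × (ℕ × ℕ)) × (ℕ × ℕ) => (z.1.2.1, z.2.2))
      (PT.id.fst.snd.fst.mk PT.id.snd.snd)
  have h2 : PT fun x : γ × (ℕ × ℕ) => (E x.1).flatMap fun e => (E x.1).map fun e' => (e.1, e'.2) :=
    (hE.comp PT.id.fst).flatMap h1
  exact hE.flatMap h2

end

end SepaTolls
namespace SepaTolls
open Enc (enc)

/-! ### Instances as data -/

/-- Valid instances, as arguments of polynomial-time functions. -/
abbrev ValidInput : Type := {I : Input // I.Valid}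

instance : Enc ValidInput := ⟨fun I => I.1.encode⟩

/-- An instance in terms of lists and pairs. -/
def Input.raw (I : Input) : ℕ × List (ℕ × ℕ) × ℕ × ℕ × List (ℕ × ℕ × ℚ × Unit) × List (List ℚ) ×
    ℕ × Unit :=
  (I.G.n, List.ofFn fun e => ((I.G.tail e : ℕ), (I.G.head e : ℕ)), I.s, I.t,
    List.ofFn fun i => ((I.source i : ℕ), (I.sink i : ℕ), I.demand i, ()),
    List.ofFn fun i => List.ofFn (I.target i), I.U, ())

theorem enc_list {α : Type} [Enc α] (l : List α) : enc l = Val.ofList (l.map enc) := rfl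

theorem enc_ofFn {α : Type} [Enc α] {m : ℕ} (f : Fin m → α) :
    enc (List.ofFn f) = Val.ofList (List.ofFn fun e => enc (f e)) := by
  rw [enc_list, List.map_ofFn]; rfl

theorem tollVal_eq {m : ℕ} (τ : Fin m → ℚ) : tollVal τ = enc (List.ofFn τ) := by
  rw [enc_ofFn]; rfl

theorem flowVal_eq {m : ℕ} (x : Fin m → ℝ) : flowVal x = enc (List.ofFn x) := by
  rw [enc_ofFn]; rfl

theorem Input.enc_raw (I : Input) : enc I.raw = I.encode := by
  have h1 : ∀ (a : ℕ) (b : List (ℕ × ℕ)) (c d : ℕ) (e : List (ℕ × ℕ × ℚ × Unit)) (f : List (List ℚ))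
      (g : ℕ), enc (a, b, c, d, e, f, g, ()) =
        Val.ofList [enc a, enc b, enc c, enc d, enc e, enc f, enc g] := fun _ _ _ _ _ _ _ => rfl
  rw [Input.raw, h1, Input.encode, enc_ofFn, enc_ofFn, enc_ofFn]
  simp only [tollVal_eq]
  rfl

theorem PT.raw : PT (fun I : ValidInput => I.1.raw) := PT.cast fun I => I.1.enc_raw

namespace Input

/-- The edges as pairs of tail and head. -/
def edges (I : Input) : List (ℕ × ℕ) := List.ofFn fun e => ((I.G.tail e : ℕ), (I.G.head e : ℕ))

/-- The target flow, one list for each commodity. -/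
def targets (I : Input) : List (List ℚ) := List.ofFn fun i => List.ofFn (I.target i)

/-- The total target flow of each edge. -/
def totals (I : Input) : List ℚ := List.ofFn fun e => ∑ i, I.target i e

/-- The commodities that use the edge `e` in the target flow. -/
def usersAt (I : Input) (e : ℕ) : List ℕ :=
  ((I.targets.mapIdx fun i l => (i, l.getD e 0)).filter fun x => decide (0 < x.2)).map Prod.fst

theorem mem_usersAt (I : Input) (e : Fin I.G.m) (i : ℕ) :
    i ∈ I.usersAt e ↔ ∃ j : Fin I.k, (j : ℕ) = i ∧ 0 < I.targetFlow j e := by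
  simp only [usersAt, List.mem_map, List.mem_filter, List.mem_mapIdx, decide_eq_true_eq, targets,
    targetFlow, Rat.cast_pos]
  constructor
  · rintro ⟨x, ⟨⟨j, hj, rfl⟩, hx⟩, rfl⟩
    simp only [List.length_ofFn] at hj
    refine ⟨⟨j, hj⟩, rfl, ?_⟩
    simpa [List.getD_eq_getElem?_getD] using hx
  · rintro ⟨j, rfl, hj⟩
    refine ⟨(j, I.target j e), ⟨⟨j, by simp, ?_⟩, hj⟩, rfl⟩
    simp [List.getD_eq_getElem?_getD]

/-- The items that represent single edges. -/
def items (I : Input) : List Item :=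
  I.edges.mapIdx fun e x => (x.1, x.2, e, [e], 0, I.usersAt e, [])

theorem items_eq (I : Input) : I.items =
    ((List.finRange I.G.m).map STree.leaf).map (STree.data I.G fun e => I.usersAt e) := by
  apply List.ext_getElem
  · simp [items, edges]
  · intro i h1 h2
    simp [items, edges, STree.data, STree.src, STree.snk, STree.rep, STree.cut, STree.npar,
      STree.users, STree.recs]

/-- The records of the parallel joins of a decomposition of the network. -/
def recs (I : Input) : List Rec :=
  match (schedule I.edges).foldl (fun L uv => reduceAt Item.key Item.joinPar Item.ser I.s I.t uv L)
    I.items with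
  | [] => []
  | a :: _ => a.recs

theorem recs_eq {I : Input} (hI : I.Valid) :
    ∃ T, I.recs = T.recs ∧ Partial I.G I.s I.t I.targetFlow [T] := by
  obtain ⟨T, hT, hP⟩ := Partial.reduce (h := I.targetFlow) hI.1 (us := fun e => I.usersAt e)
    I.mem_usersAt
  refine ⟨T, ?_, hP⟩
  have h1 := foldl_reduceAt_data (fun e => I.usersAt e) I.s I.t (schedule I.edges)
    ((List.finRange I.G.m).map STree.leaf)
  rw [← items_eq, edges, hT] at h1
  rw [recs, edges, h1]
  rfl

end Input

end SepaTolls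
namespace SepaTolls
open Enc (enc)

theorem Input.sz_raw (I : Input) : sz I.raw = I.encode.size := by
  rw [sz, I.enc_raw]

namespace STree

variable {G : Network} {us : Fin G.m → List ℕ} {N : ℕ}

theorem length_cut_le (T : STree G.m) : T.cut.length ≤ T.leaves.length := by
  induction T with
  | leaf e => simp [cut, leaves]
  | ser A B ihA _ => simp only [cut, leaves, List.length_append]; omega
  | par A B ihA ihB => simp only [cut, leaves, List.length_append]; omega

theorem length_recs (T : STree G.m) : T.recs.length = T.npar := by
  induction T with
  | leaf e => rfl
  | ser A B ihA ihB => simp [recs, npar, ihA, ihB]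
  | par A B ihA ihB => simp [recs, npar, ihA, ihB]; omega

theorem length_users_le (h : ∀ e, (us e).length ≤ N) (T : STree G.m) :
    (T.users us).length ≤ T.leaves.length * N := by
  induction T with
  | leaf e => simpa [users, leaves] using h e
  | ser A B ihA _ =>
    have := List.length_filter_le (fun i => decide (i ∈ users us B)) (users us A)
    simp only [users, leaves, List.length_append, add_mul]
    omega
  | par A B ihA ihB => simp only [users, leaves, List.length_append, add_mul]; omega

theorem lt_of_mem_users (h : ∀ e, ∀ i ∈ us e, i < N) (T : STree G.m) : ∀ i ∈ T.users us, i < N := by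
  induction T with
  | leaf e => exact h e
  | ser A B ihA _ => exact fun i hi => ihA i (List.mem_filter.1 hi).1
  | par A B ihA ihB => exact fun i hi => (List.mem_append.1 hi).elim (ihA i) (ihB i)

theorem sz_nats_le {l : List ℕ} {n : ℕ} (hn : l.length ≤ n) (h : ∀ i ∈ l, i < N) :
    sz l ≤ 1 + n * (N + 3) := by
  refine (sz_list_le (b := N + 2) fun i hi => ?_).trans ?_
  · exact (sz_nat_le i).trans (by have := h i hi; omega)
  · exact Nat.add_le_add_left (Nat.mul_le_mul_right (N + 3) hn) 1

theorem sz_cut_le (hm : G.m ≤ N) (T : STree G.m) (hT : T.leaves.length ≤ N) :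
    sz (T.cut.map Fin.val) ≤ 1 + N * (N + 3) := by
  refine sz_nats_le ?_ fun i hi => ?_
  · rw [List.length_map]; exact T.length_cut_le.trans hT
  · obtain ⟨e, -, rfl⟩ := List.mem_map.1 hi
    exact e.2.trans_le hm

theorem sz_fin_le (hm : G.m ≤ N) (e : Fin G.m) : sz (e : ℕ) ≤ N + 2 :=
  (sz_nat_le _).trans (by have := e.2; omega)

theorem sz_rec_le (hm : G.m ≤ N) (T : STree G.m) (hT : T.leaves.length ≤ N) :
    ∀ r ∈ T.recs, sz r ≤ 4 + 3 * (N + 2) + 2 * (1 + N * (N + 3)) := by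
  induction T with
  | leaf e => simp [recs]
  | ser A B ihA ihB =>
    simp only [leaves, List.length_append] at hT
    exact fun r hr => (List.mem_append.1 hr).elim (ihA (by omega) r) (ihB (by omega) r)
  | par A B ihA ihB =>
    simp only [leaves, List.length_append] at hT
    intro r hr
    simp only [recs, List.mem_append, List.mem_singleton] at hr
    rcases hr with (hr | hr) | rfl
    · exact ihA (by omega) r hr
    · exact ihB (by omega) r hr
    · have h1 := sz_fin_le hm A.rep
      have h2 := sz_fin_le hm B.rep
      have h3 := sz_cut_le hm A (by omega)
      have h4 := sz_cut_le hm B (by omega)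
      have h5 := sz_nat_le B.npar
      have h6 := B.npar_lt_length
      simp only [sz_pair]
      omega

theorem sz_recs_le (hm : G.m ≤ N) (T : STree G.m) (hT : T.leaves.length ≤ N) :
    sz T.recs ≤ 1 + N * (4 + 3 * (N + 2) + 2 * (1 + N * (N + 3)) + 1) := by
  refine (sz_list_le (sz_rec_le hm T hT)).trans ?_
  have h1 := T.length_recs
  have h2 := T.npar_lt_length
  have := Nat.mul_le_mul_right (4 + 3 * (N + 2) + 2 * (1 + N * (N + 3)) + 1)
    (show T.recs.length ≤ N by omega)
  omega

/-- A bound on the length of the item of a tree, in terms of a bound on all parameters of the network. -/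
def itemBound (N : ℕ) : ℕ :=
  6 + N + N + (N + 2) + (1 + N * (N + 3)) + (N + 2) + (1 + N * N * (N + 3)) +
      (1 + N * (4 + 3 * (N + 2) + 2 * (1 + N * (N + 3)) + 1))

/-- The item that represents a tree has polynomial length. -/
theorem sz_data_le (hm : G.m ≤ N) (hn : ∀ v : Fin G.n, sz (v : ℕ) ≤ N) (h : ∀ e, (us e).length ≤ N)
    (h' : ∀ e, ∀ i ∈ us e, i < N) (T : STree G.m) (hT : T.leaves.length ≤ N) :
    sz (T.data G us) ≤ itemBound N := by
  have h1 := hn (T.src G)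
  have h2 := hn (T.snk G)
  have h3 := sz_fin_le hm T.rep
  have h4 := sz_cut_le hm T hT
  have h5 := sz_nat_le T.npar
  have h6 := T.npar_lt_length
  have h7 := sz_nats_le ((T.length_users_le h).trans (Nat.mul_le_mul_right N hT))
    (T.lt_of_mem_users h')
  have h8 := sz_recs_le hm T hT
  simp only [data, sz_pair, itemBound]
  omega

end STree

theorem Partial.length_leaves_le {G : Network} {s t : Fin G.n} {k : ℕ} {h : Fin k → Fin G.m → ℝ}
    {L : List (STree G.m)} (H : Partial G s t h L) {T : STree G.m} (hT : T ∈ L) :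
    T.leaves.length ≤ G.m := by
  have h1 : (L.flatMap STree.leaves).Nodup := H.perm.nodup_iff.2 (List.nodup_finRange _)
  simpa using ((List.nodup_flatMap.1 h1).1 T hT).length_le_card

namespace Input

theorem m_le_size (I : Input) : I.G.m ≤ I.encode.size := by
  rw [← sz_raw]
  have h1 := length_le_sz I.edges
  simp only [raw, sz_pair]
  rw [edges, List.length_ofFn] at h1
  omega

theorem k_le_size (I : Input) : I.k ≤ I.encode.size := by
  rw [← sz_raw]
  have h1 := length_le_sz I.targets
  simp only [raw, sz_pair]
  rw [targets, List.length_ofFn] at h1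
  omega

theorem sz_node_le (I : Input) (v : Fin I.G.n) : sz (v : ℕ) ≤ I.encode.size := by
  rw [← sz_raw]
  have h1 := sz_nat_mono v.2.le
  simp only [raw, sz_pair]
  omega

theorem length_usersAt_le (I : Input) (e : ℕ) : (I.usersAt e).length ≤ I.encode.size := by
  refine le_trans ?_ I.k_le_size
  rw [usersAt, List.length_map]
  exact (List.length_filter_le _ _).trans (by simp [targets])

theorem lt_of_mem_usersAt (I : Input) (e : Fin I.G.m) : ∀ i ∈ I.usersAt e, i < I.encode.size := by
  intro i hi
  obtain ⟨j, rfl, -⟩ := (I.mem_usersAt e i).1 hi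
  exact j.2.trans_le I.k_le_size

end Input

theorem PT.edges : PT (fun I : ValidInput => I.1.edges) := PT.raw.snd.fst

theorem PT.targets : PT (fun I : ValidInput => I.1.targets) := PT.raw.snd.snd.snd.snd.snd.fst

theorem PT.totals : PT (fun I : ValidInput => I.1.totals) := by
  refine (PT.edges.mapIdx (f := fun x => (x.1.1.targets.map fun l => l.getD x.2.1 0).sum)
    (((PT.targets.comp PT.id.fst).map (f := fun y : (ValidInput × ℕ × ℕ × ℕ) × List ℚ =>
      y.2.getD y.1.2.1 0)
      (PT.id.snd.getD PT.id.fst.snd.fst (PT.constRat 0))).sum)).of_eq fun I => ?_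
  apply List.ext_getElem
  · simp [Input.edges, Input.totals]
  · intro i h1 h2
    have hi : i < I.1.G.m := by simpa [Input.totals] using h2
    simp only [Input.totals, Input.targets, List.getElem_mapIdx, List.getElem_ofFn, List.map_ofFn,
      List.sum_ofFn, Function.comp_apply]
    refine Finset.sum_congr rfl fun j _ => ?_
    simp [List.getD_eq_getElem?_getD, hi]

theorem PT.usersAt {γ : Type} [Enc γ] {I : γ → ValidInput} {e : γ → ℕ} (hI : PT I) (he : PT e) :
    PT (fun c => (I c).1.usersAt (e c)) := by
  have h1 : PT fun x : γ × ℕ × List ℚ => (x.2.1, x.2.2.getD (e x.1) 0) :=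
    PT.id.snd.fst.mk (PT.id.snd.snd.getD (he.comp PT.id.fst) (PT.constRat 0))
  have h2 : PT fun x : γ × ℕ × ℚ => decide (0 < x.2.2) := (PT.constRat 0).ratLt PT.id.snd.snd
  have h3 : PT fun x : γ × ℕ × ℚ => x.2.1 := PT.id.snd.fst
  exact (((PT.targets.comp hI).mapIdx h1).filter h2).map h3

theorem PT.items : PT (fun I : ValidInput => I.1.items) := by
  have h1 : PT fun x : ValidInput × ℕ × ℕ × ℕ =>
      ((x.2.2.1, x.2.2.2, x.2.1, [x.2.1], 0, x.1.1.usersAt x.2.1, []) : Item) :=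
    PT.id.snd.snd.fst.mk (PT.id.snd.snd.snd.mk (PT.id.snd.fst.mk ((PT.id.snd.fst.cons PT.nil).mk
      ((PT.constNat 0).mk ((PT.usersAt PT.id.fst PT.id.snd.fst).mk PT.nil)))))
  exact PT.edges.mapIdx h1

theorem PBdd.itemBound : PBdd (fun I : ValidInput => STree.itemBound (SepaTolls.sz I)) := by
  have h2 := (PBdd.sz (γ := ValidInput)).add (PBdd.const 2)
  have h3 := PBdd.sz.mul ((PBdd.sz (γ := ValidInput)).add (PBdd.const 3))
  have h4 := (PBdd.sz.mul PBdd.sz).mul ((PBdd.sz (γ := ValidInput)).add (PBdd.const 3))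
  exact ((((((((PBdd.const 6).add PBdd.sz).add PBdd.sz).add h2).add ((PBdd.const 1).add h3)).add h2).add
    ((PBdd.const 1).add h4)).add ((PBdd.const 1).add (PBdd.sz.mul ((((PBdd.const 4).add
      ((PBdd.const 3).mul h2)).add ((PBdd.const 2).mul ((PBdd.const 1).add h3))).add (PBdd.const 1)))))

theorem PT.recs : PT (fun I : ValidInput => I.1.recs) := by
  have h1 : PT fun I : ValidInput => (SepaTolls.schedule I.1.edges).foldl
      (fun L uv => SepaTolls.reduceAt Item.key Item.joinPar Item.ser I.1.s I.1.t uv L) I.1.items := by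
    refine PT.foldl (step := fun x => SepaTolls.reduceAt Item.key Item.joinPar Item.ser
        x.1.1.s x.1.1.t x.2.2 x.2.1) PT.edges.schedule PT.items
      (PT.id.snd.fst.reduceAt (s := fun x : ValidInput × List Item × ℕ × ℕ => x.1.1.s)
        (t := fun x => x.1.1.t) (PT.raw.snd.snd.fst.comp PT.id.fst)
        (PT.raw.snd.snd.snd.fst.comp PT.id.fst) PT.id.snd.snd)
      (F := fun I => 1 + sz I * (STree.itemBound (sz I) + 1))
      ((PBdd.const 1).add (PBdd.sz.mul (PBdd.itemBound.add (PBdd.const 1)))) fun I l' _ => ?_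
    · simp only
      rw [Input.items_eq, foldl_reduceAt_data]
      obtain ⟨H, -, hlen⟩ := (Partial.leaves_list (h := I.1.targetFlow) I.2.1).foldl
        I.1.mem_usersAt l'
      rw [List.length_map, List.length_finRange] at hlen
      refine (sz_list_le (b := STree.itemBound (sz I)) fun a ha => ?_).trans ?_
      · obtain ⟨T, hT, rfl⟩ := List.mem_map.1 ha
        exact STree.sz_data_le (N := sz I) I.1.m_le_size I.1.sz_node_le
          (fun e => I.1.length_usersAt_le e) I.1.lt_of_mem_usersAt T
          ((H.length_leaves_le hT).trans I.1.m_le_size)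
      · rw [List.length_map]
        have h2 : I.1.G.m ≤ sz I := I.1.m_le_size
        exact Nat.add_le_add_left (Nat.mul_le_mul_right _ (hlen.trans h2)) 1
  refine (h1.listCases PT.nil (g := fun x => x.2.1.recs) PT.id.snd.fst.itemRecs).of_eq fun I => ?_
  unfold Input.recs
  rcases List.foldl _ _ _ with _ | ⟨a, l⟩ <;> rfl

theorem PT.inputM : PT (fun I : ValidInput => I.1.G.m) :=
  PT.edges.length.of_eq fun I => by simp [Input.edges]

theorem PT.inputU : PT (fun I : ValidInput => I.1.U) := PT.raw.snd.snd.snd.snd.snd.snd.fst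

end SepaTolls
namespace SepaTolls
open Enc (enc)

/-! ### The search -/

/-- The state of the search: the records, the total target flow, the offset `M` and the accuracy `U`,
lower and upper bounds for the search variables, and a flag that is cleared when no join fires. The
search variable of a join is stored at the position of the edge that names the join. -/
abbrev State : Type := (List Rec × List ℚ × ℕ × ℕ) × List ℕ × List ℕ × Bool

namespace State

/-- The records of the parallel joins. -/
def recs (S : State) : List Rec := S.1.1

/-- The total target flow of each edge. -/
def totals (S : State) : List ℚ := S.1.2.1

/-- The offset `M`. -/
def offset (S : State) : ℕ := S.1.2.2.1

/-- The accuracy `U`. -/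
def accuracy (S : State) : ℕ := S.1.2.2.2

/-- Lower bounds for the search variables. -/
def lo (S : State) : List ℕ := S.2.1

/-- Exclusive upper bounds for the search variables. -/
def hi (S : State) : List ℕ := S.2.2.1

/-- The flag that is cleared when no join fires. -/
def active (S : State) : Bool := S.2.2.2

/-- The current value of a search variable. -/
def mid (S : State) (e : ℕ) : ℕ := (S.lo.getD e 0 + S.hi.getD e 0) / 2

/-- The tolls for the current values of the search variables. -/
def tolls (S : State) : List ℚ :=
  S.totals.mapIdx fun e _ => (numer S.offset S.mid S.recs e : ℚ) / S.accuracy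

/-- The sign of the flow error on an edge. -/
noncomputable def sign (S : State) (ans : List ℝ) (e : ℕ) : ℚ :=
  (ans.mapIdx fun e x => cmpReal x (S.totals.getD e 0 : ℚ)).getD e 0

/-- Bisection for the first join that fires. -/
noncomputable def step (S : State) (ans : List ℝ) : State :=
  match S.recs.filter (Rec.fires (S.sign ans)) with
  | [] => (S.1, S.lo, S.hi, false)
  | r :: _ =>
    if decide (0 < S.sign ans r.repB) then (S.1, S.lo.set r.repB (S.mid r.repB + 1), S.hi, true)
    else (S.1, S.lo, S.hi.set r.repB (S.mid r.repB), true)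

end State

/-- The initial state. -/
def Input.start (I : Input) : State :=
  ((I.recs, I.totals, I.G.m * (I.U * I.U), I.U), I.edges.map fun _ => 0,
    I.edges.map fun _ => I.G.m * (I.U * I.U) * (I.G.m + 1) + 1, true)

section

variable {γ : Type} [Enc γ] {S : γ → State}

theorem PT.mid (hS : PT S) {e : γ → ℕ} (he : PT e) : PT (fun c => (S c).mid (e c)) :=
  ((hS.snd.fst.getD he (PT.constNat 0)).natAdd (hS.snd.snd.fst.getD he (PT.constNat 0))).half

theorem PT.share {M z : γ → ℕ} {r : γ → Rec} {e : γ → ℕ} {f : γ → ℕ → ℕ} (hM : PT M) (hr : PT r) (he : PT e)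
    (hz : PT z) (hf : ∀ c, f c (r c).repB = z c) : PT (fun c => (r c).share (M c) (f c) (e c)) := by
  refine (((hr.snd.snd.fst.natMem he).ite (hM.natMul (hr.snd.snd.snd.snd.natAdd (PT.constNat 1)))
    (PT.constNat 0)).natAdd ((hr.snd.snd.snd.fst.natMem he).ite hz (PT.constNat 0))).of_eq fun c => ?_
  rw [← hf]
  rfl

theorem PT.numer (hS : PT S) {e : γ → ℕ} (he : PT e) :
    PT (fun c => (numer (S c).offset (S c).mid (S c).recs (e c) : ℚ)) := by
  have h1 : PT fun x : γ × Rec => (x.2.share (S x.1).offset (S x.1).mid (e x.1) : ℚ) :=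
    (PT.share (f := fun x : γ × Rec => (S x.1).mid) (z := fun x => (S x.1).mid x.2.repB) (hS.comp PT.id.fst).fst.snd.snd.fst PT.id.snd (he.comp PT.id.fst)
      ((hS.comp PT.id.fst).mid PT.id.snd.snd.fst) fun _ => rfl).natCast
  refine ((hS.fst.fst.map h1).sum).of_eq fun c => ?_
  rw [SepaTolls.numer, Nat.cast_list_sum, List.map_map]
  rfl

theorem PT.tolls (hS : PT S) : PT (fun c => (S c).tolls) := by
  have h1 : PT fun x : γ × ℕ × ℚ =>
      (SepaTolls.numer (S x.1).offset (S x.1).mid (S x.1).recs x.2.1 : ℚ) / ((S x.1).accuracy : ℚ) :=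
    ((hS.comp PT.id.fst).numer PT.id.snd.fst).ratDiv (hS.comp PT.id.fst).fst.snd.snd.snd.natCast
  exact hS.fst.snd.fst.mapIdx h1

theorem PT.sign (hS : PT S) {ans : γ → List ℝ} (ha : PT ans) {e : γ → ℕ} (he : PT e) :
    PT (fun c => (S c).sign (ans c) (e c)) := by
  have h1 : PT fun x : γ × ℕ × ℝ => cmpReal x.2.2 ((S x.1).totals.getD x.2.1 0 : ℚ) :=
    PT.id.snd.snd.cmpRealRat ((hS.comp PT.id.fst).fst.snd.fst.getD PT.id.snd.fst (PT.constRat 0))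
  exact (ha.mapIdx h1).getD he (PT.constRat 0)

theorem PT.step (hS : PT S) {ans : γ → List ℝ} (ha : PT ans) : PT (fun c => (S c).step (ans c)) := by
  have h1 : PT fun x : γ × Rec => x.2.fires ((S x.1).sign (ans x.1)) :=
    (((hS.comp PT.id.fst).sign (ha.comp PT.id.fst) PT.id.snd.snd.fst).ratEq (PT.constRat 0)).not.and
      (((hS.comp PT.id.fst).sign (ha.comp PT.id.fst) PT.id.snd.fst).ratEq
        ((hS.comp PT.id.fst).sign (ha.comp PT.id.fst) PT.id.snd.snd.fst)).not
  have hS' : PT fun x : γ × Rec × List Rec => S x.1 := hS.comp PT.id.fst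
  have h2 : PT fun x : γ × Rec × List Rec =>
      (if decide (0 < (S x.1).sign (ans x.1) x.2.1.repB) then
        ((S x.1).1, (S x.1).lo.set x.2.1.repB ((S x.1).mid x.2.1.repB + 1), (S x.1).hi, true)
      else ((S x.1).1, (S x.1).lo, (S x.1).hi.set x.2.1.repB ((S x.1).mid x.2.1.repB), true) : State) :=
    ((PT.constRat 0).ratLt (hS'.sign (ha.comp PT.id.fst) PT.id.snd.fst.snd.fst)).ite
      (hS'.fst.mk ((hS'.snd.fst.set PT.id.snd.fst.snd.fst
        ((hS'.mid PT.id.snd.fst.snd.fst).natAdd (PT.constNat 1))).mk (hS'.snd.snd.fst.mk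
          (PT.constBool true))))
      (hS'.fst.mk (hS'.snd.fst.mk ((hS'.snd.snd.fst.set PT.id.snd.fst.snd.fst
        (hS'.mid PT.id.snd.fst.snd.fst)).mk (PT.constBool true))))
  refine ((hS.fst.fst.filter h1).listCases (hS.fst.mk (hS.snd.fst.mk (hS.snd.snd.fst.mk
    (PT.constBool false)))) h2).of_eq fun c => ?_
  unfold State.step State.recs
  rcases hF : (S c).1.1.filter fun a => a.fires ((S c).sign (ans c)) with _ | ⟨r, l⟩ <;>
    simp only [hF]
  all_goals rfl

end

theorem PT.start : PT (fun I : ValidInput => I.1.start) := by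
  have hM := PT.inputM.natMul (PT.inputU.natMul PT.inputU)
  have h1 : PT fun x : ValidInput × ℕ × ℕ => 0 := PT.constNat 0
  have h2 : PT fun x : ValidInput × ℕ × ℕ => x.1.1.G.m * (x.1.1.U * x.1.1.U) * (x.1.1.G.m + 1) + 1 :=
    ((hM.natMul (PT.inputM.natAdd (PT.constNat 1))).natAdd (PT.constNat 1)).comp PT.id.fst
  exact (PT.recs.mk (PT.totals.mk (hM.mk PT.inputU))).mk
    ((PT.edges.map h1).mk ((PT.edges.map h2).mk (PT.constBool true)))

/-- A loop whose potential decreases, with one query in each iteration. -/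
theorem exists_run_loop {σ : Type} [Enc σ] {active : σ → Bool} {next : σ → σ} {C B : Prog} {b m : ℕ}
    {O : (Fin m → ℚ) → Fin m → ℝ} (Inv : σ → Prop) (μ : σ → ℕ)
    (hC : ∀ S, Inv S → ∃ t, t ≤ b ∧ Run O C (enc S) (enc (active S)) t 0)
    (hB : ∀ S, Inv S → active S = true → ∃ t, t ≤ b ∧ Run O B (enc S) (enc (next S)) t 1)
    (hinv : ∀ S, Inv S → active S = true → Inv (next S) ∧ μ (next S) < μ S) (S : σ) (hS : Inv S) :
    ∃ S' t q, Inv S' ∧ active S' = false ∧ Run O (.loop C B) (enc S) (enc S') t q ∧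
      t ≤ (μ S + 1) * (2 * b + 1) ∧ q ≤ μ S := by
  induction h : μ S using Nat.strong_induction_on generalizing S with
  | _ n ih =>
  obtain ⟨tc, htc, hrc⟩ := hC S hS
  cases ha : active S with
  | false =>
    rw [ha] at hrc
    have hrc' : Run O C (enc S) (.num 0) tc 0 := by simpa [enc] using hrc
    refine ⟨S, _, _, hS, ha, Run.loop_stop hrc', ?_, Nat.zero_le _⟩
    have := Nat.mul_le_mul_right (2 * b + 1) (Nat.succ_le_succ (Nat.zero_le n))
    simp only [Nat.succ_eq_add_one] at this
    omega
  | true =>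
    obtain ⟨tb, htb, hrb⟩ := hB S hS ha
    obtain ⟨h1, h2⟩ := hinv S hS ha
    obtain ⟨S', t, q, h3, h4, h5, h6, h7⟩ := ih _ (h ▸ h2) (next S) h1 rfl
    rw [ha] at hrc
    refine ⟨S', _, _, h3, h4, Run.loop_step hrc (by simp [enc]) hrb h5, ?_, by omega⟩
    have h8 := Nat.mul_le_mul_right (2 * b + 1) (show μ (next S) + 1 + 1 ≤ n + 1 by omega)
    rw [Nat.add_mul _ 1] at h8
    omega

end SepaTolls
namespace SepaTolls
open Enc (enc)

/-! ### Target values of the search variables -/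

namespace Input

variable {I : Input} {l : Fin I.G.m → ℝ → ℝ} {g h : Fin I.k → Fin I.G.m → ℝ}

theorem IsWardrop.comparable (hI : I.Valid) (hg : I.IsWardrop l g) (hh : I.Feasible h) :
    Comparable I.G (fun e => l e (total g e)) g h where
  nonneg i e := (hg.1 i).1 e
  nonneg' i e := (hh i).1 e
  circ i v := hg.1.netOut_sub hh i v
  segment i _ _ _ _ hP0 hP hQ hpos := hg.segment hI.1 hI.2.1 i hP0 hP hQ hpos

theorem Feasible.total_nonneg (hg : I.Feasible g) (e : Fin I.G.m) : 0 ≤ total g e :=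
  Finset.sum_nonneg fun i _ => (hg i).1 e

/-- Every path between two nodes extends to a path between the terminals, so the promise on delays
holds for all pairs of paths with the same ends. -/
theorem DelaysOnGrid.segment (hI : I.Valid) (hl : I.DelaysOnGrid l) {u v : Fin I.G.n}
    {P Q : List (Fin I.G.m)} (hP : I.G.IsPath u v P) (hQ : I.G.IsPath u v Q) :
    ∃ z : ℤ, |z| ≤ ((I.G.m * (I.U * I.U) : ℕ) : ℤ) ∧
      pathCost (fun e => l e (total I.targetFlow e)) P -
        pathCost (fun e => l e (total I.targetFlow e)) Q = z / I.U := by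
  have hmem : ∀ w, w ∈ I.G.verts Finset.univ := fun w => by rw [hI.1.2]; exact Finset.mem_univ w
  obtain ⟨⟨R, hR⟩, -⟩ := hI.1.1.reach u (hmem u)
  obtain ⟨-, R', hR'⟩ := hI.1.1.reach v (hmem v)
  obtain ⟨z, hz, h1⟩ := hl _ _ (hR.append (hP.append hR')) (hR.append (hQ.append hR'))
  refine ⟨z, hz.trans_eq (by push_cast; ring), ?_⟩
  simp only [pathCost_append] at h1
  linarith

end Input

/-- The target values are natural numbers of moderate size. -/
theorem STree.IsTarget.exists_nat {G : Network} {k : ℕ} {h : Fin k → Fin G.m → ℝ} {U M : ℕ}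
    (hU : 0 < U) {cs : Fin G.m → ℝ}
    (hcs : ∀ u v P Q, G.IsPath u v P → G.IsPath u v Q →
      ∃ z : ℤ, |z| ≤ (M : ℤ) ∧ pathCost cs P - pathCost cs Q = z / U)
    {T : STree G.m} (hT : T.Good G h) {e : ℕ} {x : ℝ} (hx : T.IsTarget U M cs e x) :
    ∃ n : ℕ, n ≤ M * (T.leaves.length + 1) ∧ x = n := by
  have hmono : ∀ {n a b : ℕ}, a ≤ b → n ≤ M * (a + 1) → n ≤ M * (b + 1) := fun hab hn =>
    hn.trans (Nat.mul_le_mul_left M (Nat.succ_le_succ hab))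
  induction T with
  | leaf e => exact hx.elim
  | ser A B ihA ihB =>
    rw [leaves, List.length_append]
    rcases hx with hx | hx
    · obtain ⟨n, hn, h1⟩ := ihA hT.1 hx
      exact ⟨n, hmono (Nat.le_add_right _ _) hn, h1⟩
    · obtain ⟨n, hn, h1⟩ := ihB hT.2.1 hx
      exact ⟨n, hmono (Nat.le_add_left _ _) hn, h1⟩
  | par A B ihA ihB =>
    rw [leaves, List.length_append]
    rcases hx with hx | hx | ⟨-, hx⟩
    · obtain ⟨n, hn, h1⟩ := ihA hT.1 hx
      exact ⟨n, hmono (Nat.le_add_right _ _) hn, h1⟩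
    · obtain ⟨n, hn, h1⟩ := ihB hT.2.1 hx
      exact ⟨n, hmono (Nat.le_add_left _ _) hn, h1⟩
    · have hB := hT.2.1.isPath B.exists_mem_paths
      rw [← hT.2.2.1, ← hT.2.2.2.1] at hB
      obtain ⟨z, hz, h1⟩ := hcs _ _ _ _ (hT.1.isPath A.exists_mem_paths) hB
      have hU' : (U : ℝ) ≠ 0 := by exact_mod_cast hU.ne'
      have h2 : x = z + M * (A.npar + 1) := by
        rw [targetCost_eq, targetCost_eq] at hx
        simp only [ref, npar] at hx
        push_cast at hx
        have h3 : x / U = z / U + M * (A.npar + 1) / U := by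
          rw [← h1]
          linear_combination hx
        rw [← add_div] at h3
        field_simp at h3
        exact h3
      obtain ⟨h4, h5⟩ := abs_le.1 hz
      have h6 : 0 ≤ z + M * (A.npar + 1) := by
        have : (0 : ℤ) ≤ M * A.npar := by positivity
        linarith
      refine ⟨(z + M * (A.npar + 1)).toNat, ?_, ?_⟩
      · have h7 := A.npar_lt_length
        have h8 : M * (A.npar + 2) ≤ M * (A.leaves.length + B.leaves.length + 1) :=
          Nat.mul_le_mul_left M (by omega)
        refine le_trans ?_ h8
        zify
        rw [Int.toNat_of_nonneg h6]
        linarith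
      · rw [h2]
        have := congrArg (Int.cast : ℤ → ℝ) (Int.toNat_of_nonneg h6)
        push_cast at this
        exact this.symm

/-! ### Correctness of the search -/

namespace State

/-- The toll of an edge for the current values of the search variables. -/
def toll (S : State) (e : ℕ) : ℚ := (numer S.offset S.mid S.recs e : ℚ) / S.accuracy

theorem toll_nonneg (S : State) (e : ℕ) : 0 ≤ S.toll e := by
  unfold toll
  positivity

/-- Bit length of the search intervals that are left. -/
def potential (m : ℕ) (S : State) : ℕ :=
  ∑ e ∈ Finset.range m, Nat.size (S.hi.getD e 0 - S.lo.getD e 0) + if S.active then 1 else 0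

end State

/-- The invariant of the search for a decomposition tree `T` of the network: search intervals contain
target values. -/
structure Bracketed (I : Input) (cs : Fin I.G.m → ℝ) (T : STree I.G.m) (S : State) : Prop where
  ctx : S.1 = (T.recs, I.totals, I.G.m * (I.U * I.U), I.U)
  length_lo : S.lo.length = I.G.m
  length_hi : S.hi.length = I.G.m
  lo_le : ∀ e, S.lo.getD e 0 ≤ I.G.m * (I.U * I.U) * (I.G.m + 1) + 1
  hi_le : ∀ e, S.hi.getD e 0 ≤ I.G.m * (I.U * I.U) * (I.G.m + 1) + 1
  lo_le_target : ∀ e x, T.IsTarget I.U (I.G.m * (I.U * I.U)) cs e x → (S.lo.getD e 0 : ℝ) ≤ x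
  target_lt_hi : ∀ e x, T.IsTarget I.U (I.G.m * (I.U * I.U)) cs e x → x < (S.hi.getD e 0 : ℝ)

theorem getD_set {l : List ℕ} {i : ℕ} (hi : i < l.length) (v j : ℕ) :
    (l.set i v).getD j 0 = if i = j then v else l.getD j 0 := by
  rw [List.getD_eq_getElem?_getD, List.getD_eq_getElem?_getD, List.getElem?_set]
  split_ifs with h
  · rfl
  · rfl

theorem size_lt_size {a b : ℕ} (hb : 0 < b) (h : 2 * a ≤ b) : Nat.size a < Nat.size b := by
  have h1 := Nat.size_pos.2 hb
  have h2 : Nat.size a ≤ Nat.size b - 1 := by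
    rw [Nat.size_le]
    have h3 := Nat.lt_size_self b
    have h4 : 2 ^ Nat.size b = 2 * 2 ^ (Nat.size b - 1) := by
      rw [← pow_succ', Nat.sub_add_cancel h1]
    omega
  omega

namespace Bracketed

variable {I : Input} {cs : Fin I.G.m → ℝ} {T : STree I.G.m} {S : State}

theorem tolls_eq (H : Bracketed I cs T S) : S.tolls = List.ofFn fun e : Fin I.G.m => S.toll e := by
  have h1 : S.totals = I.totals := congrArg (fun x => x.2.1) H.ctx
  apply List.ext_getElem
  · simp [State.tolls, h1, Input.totals]
  · intro i h2 h3
    simp [State.tolls, State.toll]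

theorem sign_eq (H : Bracketed I cs T S) (x : Fin I.G.m → ℝ) (e : Fin I.G.m) :
    S.sign (List.ofFn x) e = cmpReal (x e) (total I.targetFlow e) := by
  have h1 : S.totals = I.totals := congrArg (fun x => x.2.1) H.ctx
  have h2 : ((∑ i, I.target i e : ℚ) : ℝ) = total I.targetFlow e := by
    simp [total, Input.targetFlow]
  simp [State.sign, List.getD_eq_getElem?_getD, h1, Input.totals, ← h2]

theorem start (hT : I.recs = T.recs) (hI : ∀ e x, T.IsTarget I.U (I.G.m * (I.U * I.U)) cs e x →
      e < I.G.m ∧ ∃ n : ℕ, n ≤ I.G.m * (I.U * I.U) * (I.G.m + 1) ∧ x = n) :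
    Bracketed I cs T I.start where
  ctx := by rw [← hT]; rfl
  length_lo := by simp [Input.start, State.lo, Input.edges]
  length_hi := by simp [Input.start, State.hi, Input.edges]
  lo_le e := by
    simp only [Input.start, State.lo, Input.edges, List.getD_eq_getElem?_getD, List.getElem?_map]
    rcases (List.ofFn fun e => ((I.G.tail e : ℕ), (I.G.head e : ℕ)))[e]? <;> simp
  hi_le e := by
    simp only [Input.start, State.hi, Input.edges, List.getD_eq_getElem?_getD, List.getElem?_map]
    rcases (List.ofFn fun e => ((I.G.tail e : ℕ), (I.G.head e : ℕ)))[e]? <;> simp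
  lo_le_target e x hx := by
    obtain ⟨he, n, -, rfl⟩ := hI e x hx
    simp [Input.start, State.lo, Input.edges, List.getD_eq_getElem?_getD, he]
  target_lt_hi e x hx := by
    obtain ⟨he, n, hn, rfl⟩ := hI e x hx
    simp only [Input.start, State.hi, Input.edges, List.getD_eq_getElem?_getD, List.getElem?_map,
      List.getElem?_ofFn, he, dite_true, Option.map_some, Option.getD_some]
    exact_mod_cast Nat.lt_succ_of_le hn

theorem potential_start (hT : I.start.active = true) : I.start.potential I.G.m =
    I.G.m * Nat.size (I.G.m * (I.U * I.U) * (I.G.m + 1) + 1) + 1 := by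
  rw [State.potential, if_pos hT]
  congr 1
  rw [Finset.sum_congr rfl fun e he => ?_, Finset.sum_const, Finset.card_range, smul_eq_mul]
  have he := Finset.mem_range.1 he
  simp [Input.start, State.lo, State.hi, Input.edges, List.getD_eq_getElem?_getD, he]

theorem lt_hi (H : Bracketed I cs T S) {e : ℕ} {x : ℝ}
    (hx : T.IsTarget I.U (I.G.m * (I.U * I.U)) cs e x) : S.lo.getD e 0 < S.hi.getD e 0 := by
  exact_mod_cast (H.lo_le_target e x hx).trans_lt (H.target_lt_hi e x hx)

theorem sz_le (H : Bracketed I cs T S) (hT : I.recs = T.recs) : sz S ≤ sz I.start.1 + 6 +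
    2 * (1 + I.G.m * (sz (I.G.m * (I.U * I.U) * (I.G.m + 1) + 1) + 1)) := by
  have h1 : S.1 = I.start.1 := by rw [H.ctx, ← hT]; rfl
  have hl : ∀ l : List ℕ, l.length = I.G.m →
      (∀ e, l.getD e 0 ≤ I.G.m * (I.U * I.U) * (I.G.m + 1) + 1) →
      sz l ≤ 1 + I.G.m * (sz (I.G.m * (I.U * I.U) * (I.G.m + 1) + 1) + 1) := by
    intro l hl hb
    rw [← hl]
    refine sz_list_le fun a ha => ?_
    obtain ⟨i, hi, rfl⟩ := List.getElem_of_mem ha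
    have := hb i
    rw [List.getD_eq_getElem?_getD, List.getElem?_eq_getElem hi, Option.getD_some] at this
    rw [hl] at *
    exact sz_nat_mono this
  have h2 := hl _ H.length_lo H.lo_le
  have h3 := hl _ H.length_hi H.hi_le
  have h4 : sz S = 1 + sz S.1 + (1 + sz S.lo + (1 + sz S.hi + sz S.active)) := rfl
  have h5 := sz_bool_le S.active
  rw [← h1, h4]
  omega

theorem mid_le (H : Bracketed I cs T S) {e : ℕ} {x : ℝ}
    (hx : T.IsTarget I.U (I.G.m * (I.U * I.U)) cs e x) :
    S.lo.getD e 0 ≤ S.mid e ∧ S.mid e < S.hi.getD e 0 := by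
  have := H.lt_hi hx
  unfold State.mid
  omega

theorem set_lo (H : Bracketed I cs T S) (hU : 0 < I.U) (hn : T.leaves.Nodup) {e : ℕ} {x : ℝ}
    (hx : T.IsTarget I.U (I.G.m * (I.U * I.U)) cs e x) (he : e < I.G.m) (hle : (S.mid e : ℝ) + 1 ≤ x) :
    Bracketed I cs T (S.1, S.lo.set e (S.mid e + 1), S.hi, true) := by
  have hget := getD_set (he.trans_eq H.length_lo.symm) (S.mid e + 1)
  refine ⟨H.ctx, List.length_set.trans H.length_lo, H.length_hi, fun j => ?_, H.hi_le, fun j y hy => ?_,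
    H.target_lt_hi⟩
  · simp only [State.lo] at hget ⊢
    rw [hget]
    split_ifs with h
    · have := (H.mid_le hx).2
      have := H.hi_le e
      omega
    · exact H.lo_le j
  · simp only [State.lo] at hget ⊢
    rw [hget]
    split_ifs with h
    · subst h
      rw [← hx.unique hU hn hy]
      exact_mod_cast hle
    · exact H.lo_le_target j y hy

theorem set_hi (H : Bracketed I cs T S) (hU : 0 < I.U) (hn : T.leaves.Nodup) {e : ℕ} {x : ℝ}
    (hx : T.IsTarget I.U (I.G.m * (I.U * I.U)) cs e x) (he : e < I.G.m) (hlt : x < S.mid e) :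
    Bracketed I cs T (S.1, S.lo, S.hi.set e (S.mid e), true) := by
  have hget := getD_set (he.trans_eq H.length_hi.symm) (S.mid e)
  refine ⟨H.ctx, H.length_lo, List.length_set.trans H.length_hi, H.lo_le, fun j => ?_, H.lo_le_target,
    fun j y hy => ?_⟩
  · simp only [State.hi] at hget ⊢
    rw [hget]
    split_ifs with h
    · have := (H.mid_le hx).2
      have := H.hi_le e
      omega
    · exact H.hi_le j
  · simp only [State.hi] at hget ⊢
    rw [hget]
    split_ifs with h
    · subst h
      rw [← hx.unique hU hn hy]
      exact hlt
    · exact H.target_lt_hi j y hy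

theorem potential_set_lo (H : Bracketed I cs T S) (ha : S.active = true) {e : ℕ} {x : ℝ}
    (hx : T.IsTarget I.U (I.G.m * (I.U * I.U)) cs e x) (he : e < I.G.m) :
    State.potential I.G.m (S.1, S.lo.set e (S.mid e + 1), S.hi, true) < S.potential I.G.m := by
  have hget := getD_set (he.trans_eq H.length_lo.symm) (S.mid e + 1)
  have hlt := H.lt_hi hx
  have ha' : S.2.2.2 = true := ha
  simp only [State.potential, ha', if_true, State.lo, State.hi, State.active, State.mid] at hget hlt ⊢
  refine Nat.add_lt_add_right (Finset.sum_lt_sum (fun j _ => ?_) ⟨e, Finset.mem_range.2 he, ?_⟩) 1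
  · rw [hget]
    split_ifs with h
    · subst h; exact Nat.size_le_size (by omega)
    · exact le_rfl
  · rw [hget, if_pos rfl]
    exact size_lt_size (by omega) (by omega)

theorem potential_set_hi (H : Bracketed I cs T S) (ha : S.active = true) {e : ℕ} {x : ℝ}
    (hx : T.IsTarget I.U (I.G.m * (I.U * I.U)) cs e x) (he : e < I.G.m) :
    State.potential I.G.m (S.1, S.lo, S.hi.set e (S.mid e), true) < S.potential I.G.m := by
  have hget := getD_set (he.trans_eq H.length_hi.symm) (S.mid e)
  have hlt := H.lt_hi hx
  have ha' : S.2.2.2 = true := ha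
  simp only [State.potential, ha', if_true, State.lo, State.hi, State.active, State.mid] at hget hlt ⊢
  refine Nat.add_lt_add_right (Finset.sum_lt_sum (fun j _ => ?_) ⟨e, Finset.mem_range.2 he, ?_⟩) 1
  · rw [hget]
    split_ifs with h
    · subst h; exact Nat.size_le_size (by omega)
    · exact le_rfl
  · rw [hget, if_pos rfl]
    exact size_lt_size (by omega) (by omega)

end Bracketed

theorem IsDelay.lt_iff {f : ℝ → ℝ} (hf : IsDelay f) {x y : ℝ} (hx : 0 ≤ x) (hy : 0 ≤ y) :
    f x < f y ↔ x < y := hf.2.2.lt_iff_lt hx hy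

/-- Tolls for which the target flow is one equilibrium induce it. -/
theorem Partial.enforces {I : Input} (hI : I.Valid) {l : Fin I.G.m → ℝ → ℝ} (hl : ∀ e, IsDelay (l e))
    {T : STree I.G.m} (hT : Partial I.G I.s I.t I.targetFlow [T]) {τ : Fin I.G.m → ℚ}
    {g : Fin I.k → Fin I.G.m → ℝ} (hg : I.IsWardrop (tolled l τ) g)
    (heq : total g = total I.targetFlow) : I.Enforces l τ := by
  refine ⟨⟨g, hg⟩, fun g' hg' => ?_⟩
  obtain ⟨hgood, -, -, -, hleaf, -, hval⟩ := hT.single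
  have H := hg'.comparable hI hg.1
  have H' := hg.comparable hI hg'.1
  rw [← heq]
  funext e
  refine STree.total_eq_of_val_eq_zero H H' (fun e he => ?_) (fun e he => ?_) hgood
    (hval _ H.circ_total) e (hleaf e)
  · have := ((hl e).lt_iff (hg.1.total_nonneg e) (hg'.1.total_nonneg e)).2 he
    simpa [tolled] using this
  · have := ((hl e).lt_iff (hg'.1.total_nonneg e) (hg.1.total_nonneg e)).2 he
    simpa [tolled] using this

/-- An iteration of the search keeps the invariant and decreases the potential, and the search stops
only if the current tolls induce the target flow. -/
theorem Bracketed.step {I : Input} (hI : I.Valid) {l : Fin I.G.m → ℝ → ℝ} (hl : ∀ e, IsDelay (l e))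
    {T : STree I.G.m} (hT : Partial I.G I.s I.t I.targetFlow [T])
    (hnat : ∀ e x, T.IsTarget I.U (I.G.m * (I.U * I.U)) (fun e => l e (total I.targetFlow e)) e x →
      e < I.G.m ∧ ∃ n : ℕ, n ≤ I.G.m * (I.U * I.U) * (I.G.m + 1) ∧ x = n) {S : State}
    (H : Bracketed I (fun e => l e (total I.targetFlow e)) T S) (ha : S.active = true)
    {g : Fin I.k → Fin I.G.m → ℝ} (hg : I.IsWardrop (tolled l fun e => S.toll e) g) :
    Bracketed I (fun e => l e (total I.targetFlow e)) T (S.step (List.ofFn (total g))) ∧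
    ((S.step (List.ofFn (total g))).active = false →
      I.Enforces l fun e => (S.step (List.ofFn (total g))).toll e) ∧
    (S.step (List.ofFn (total g))).potential I.G.m < S.potential I.G.m := by
  obtain ⟨hgood, -, -, hnodup, hleaf, -, hval⟩ := hT.single
  have hU := hI.2.2.2
  have C := hg.comparable hI hI.2.2.1
  have hrecs : S.recs = T.recs := congrArg (fun x => x.1) H.ctx
  have hM : S.offset = I.G.m * (I.U * I.U) := congrArg (fun x => x.2.2.1) H.ctx
  have hacc : S.accuracy = I.U := congrArg (fun x => x.2.2.2) H.ctx
  have key := STree.quiet_or_first_fires (U := I.U) (M := I.G.m * (I.U * I.U)) (z := S.mid)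
    (c₀ := fun e => l e (total g e)) (cs := fun e => l e (total I.targetFlow e))
    (sg := S.sign (List.ofFn (total g))) C hU
    (fun e he => ((hl e).lt_iff (hI.2.2.1.total_nonneg e) (hg.1.total_nonneg e)).2 he)
    (fun e he => ((hl e).lt_iff (hg.1.total_nonneg e) (hI.2.2.1.total_nonneg e)).2 he)
    (fun e he => by rw [he]) (H.sign_eq (total g)) T 0 hgood hnodup (fun P _ => by
      rw [add_zero, STree.innerCost]
      congr 1
      funext e
      simp [tolled, State.toll, hrecs, hM, hacc])
  unfold State.step
  rw [hrecs]
  rcases hF : T.recs.filter (Rec.fires (S.sign (List.ofFn (total g)))) with _ | ⟨r, rs⟩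
  · refine ⟨⟨H.ctx, H.length_lo, H.length_hi, H.lo_le, H.hi_le, H.lo_le_target, H.target_lt_hi⟩,
      fun _ => ?_, ?_⟩
    · refine hT.enforces hI hl hg (funext fun e => ?_)
      have q := key.1 hF
      have hv := hval _ C.circ_total
      have h0 : total g T.rep - total I.targetFlow T.rep = 0 := by
        rcases lt_trichotomy 0 (total g T.rep - total I.targetFlow T.rep) with h | h | h
        · exact absurd hv (q.pos h).1.ne'
        · exact h.symm
        · exact absurd hv (q.neg h).1.ne
      exact sub_eq_zero.1 ((q.zero h0).1 e (hleaf e))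
    · have h1 : State.potential I.G.m (S.1, S.lo, S.hi, false) + 1 = S.potential I.G.m := by
        have ha' : S.2.2.2 = true := ha
        simp [State.potential, ha', State.lo, State.hi, State.active]
      exact Nat.lt_of_succ_le h1.le
  · obtain ⟨x, hx, h1⟩ := key.2 r rs hF
    obtain ⟨he, n, -, rfl⟩ := hnat _ _ hx
    rcases h1 with ⟨h1, h2⟩ | ⟨h1, h2⟩
    · have h3 : decide (0 < S.sign (List.ofFn (total g)) r.repB) = true := by rw [h1]; decide
      simp only [h3, if_true]
      refine ⟨H.set_lo hU hnodup hx he ?_, fun h => by simp [State.active] at h,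
        H.potential_set_lo ha hx he⟩
      exact_mod_cast Nat.succ_le_of_lt (by exact_mod_cast h2)
    · have h3 : decide (0 < S.sign (List.ofFn (total g)) r.repB) = false := by rw [h1]; decide
      simp only [h3, Bool.false_eq_true, if_false]
      exact ⟨H.set_hi hU hnodup hx he h2, fun h => by simp [State.active] at h,
        H.potential_set_hi ha hx he⟩

end SepaTolls
namespace SepaTolls
open Enc (enc)

/-! ### The algorithm -/

theorem size_le_of_log {m U : ℕ} (hm : 0 < m) (hU : 0 < U) :
    m * Nat.size (m * (U * U) * (m + 1) + 1) + 1 ≤ 5 * m * (Nat.log 2 (m * U) + 1) := by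
  have h1 : m * U < 2 ^ (Nat.log 2 (m * U) + 1) := Nat.lt_pow_succ_log_self one_lt_two _
  have h2 : Nat.size (m * (U * U) * (m + 1) + 1) ≤ 2 * Nat.log 2 (m * U) + 4 := by
    rw [Nat.size_le]
    have h3 : m * U * (m * U) < 2 ^ (Nat.log 2 (m * U) + 1) * 2 ^ (Nat.log 2 (m * U) + 1) :=
      Nat.mul_lt_mul'' h1 h1
    have h4 : 2 ^ (2 * Nat.log 2 (m * U) + 4) =
        4 * (2 ^ (Nat.log 2 (m * U) + 1) * 2 ^ (Nat.log 2 (m * U) + 1)) := by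
      rw [← pow_add, show 2 * Nat.log 2 (m * U) + 4 =
        2 + (Nat.log 2 (m * U) + 1 + (Nat.log 2 (m * U) + 1)) by ring, pow_add]
      norm_num
    have h5 : m * (U * U) * (m + 1) + 1 ≤ 3 * (m * U * (m * U)) := by
      have : 1 ≤ m * (U * U) := Nat.mul_pos hm (Nat.mul_pos hU hU)
      have : m * (U * U) ≤ m * U * (m * U) := by nlinarith
      nlinarith
    omega
  calc m * Nat.size (m * (U * U) * (m + 1) + 1) + 1 ≤ m * (2 * Nat.log 2 (m * U) + 4) + m :=
        add_le_add (Nat.mul_le_mul_left m h2) hm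
    _ ≤ 5 * m * (Nat.log 2 (m * U) + 1) := by nlinarith [Nat.zero_le (m * Nat.log 2 (m * U))]

theorem sz_answer_le {m : ℕ} (x : Fin m → ℝ) : sz (List.ofFn x) ≤ 1 + m * 2 := by
  refine (sz_list_le (b := 1) fun a _ => le_rfl).trans ?_
  rw [List.length_ofFn]

/-- For delays on a grid, the search solves every instance. -/
theorem exists_solver : ∃ (A : Prog) (p : Polynomial ℕ), ∀ (I : Input) (l : Fin I.G.m → ℝ → ℝ),
    I.Valid → (∀ e, IsDelay (l e)) → I.DelaysOnGrid l → I.SolvedBy l A p 5 := by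
  obtain ⟨Pstart, Tstart, hTstart, hstart⟩ := PT.start
  obtain ⟨Pact, Tact, ⟨qact, hqact⟩, hact⟩ := (PT.id (α := State)).snd.snd.snd
  obtain ⟨Ptolls, Ttolls, ⟨qtolls, hqtolls⟩, htolls⟩ := PT.tolls (PT.id (α := State))
  obtain ⟨Pstep, Tstep, ⟨qstep, hqstep⟩, hstep⟩ :=
    PT.step (PT.id (α := State × List ℝ)).fst (PT.id (α := State × List ℝ)).snd
  have hM := PT.inputM.natMul (PT.inputU.natMul PT.inputU)
  let B : ValidInput → ℕ := fun I => I.1.G.m * (I.1.U * I.1.U) * (I.1.G.m + 1) + 1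
  have hB : PBdd fun I => sz (B I) :=
    ((hM.natMul (PT.inputM.natAdd (PT.constNat 1))).natAdd (PT.constNat 1)).pbdd
  have hm : PBdd fun I : ValidInput => I.1.G.m := PBdd.sz.mono fun I => I.1.m_le_size
  let F : ValidInput → ℕ := fun I => sz I.1.start.1 + 6 + 2 * (1 + I.1.G.m * (sz (B I) + 1))
  have hF : PBdd F := ((PT.start.fst.pbdd).add (PBdd.const 6)).add
    ((PBdd.const 2).mul ((PBdd.const 1).add (hm.mul (hB.add (PBdd.const 1)))))
  let b : ValidInput → ℕ := fun I => 20 + 2 * F I + 2 * qtolls.eval (F I) + 2 * I.1.G.m +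
    qstep.eval (2 + F I + I.1.G.m * 2) + qact.eval (F I)
  have hb : PBdd b := (((((PBdd.const 20).add ((PBdd.const 2).mul hF)).add
    ((PBdd.const 2).mul (hF.eval qtolls))).add ((PBdd.const 2).mul hm)).add
    ((((PBdd.const 2).add hF).add (hm.mul (PBdd.const 2))).eval qstep)).add (hF.eval qact)
  obtain ⟨p, hp⟩ : PBdd fun I : ValidInput => Tstart I +
      (((I.1.G.m * sz (B I) + 2) * (2 * b I + 1) + qtolls.eval (F I)) + 2) :=
    hTstart.add (((((hm.mul hB).add (PBdd.const 2)).mul (((PBdd.const 2).mul hb).add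
      (PBdd.const 1))).add (hF.eval qtolls)).add (PBdd.const 2))
  refine ⟨.comp Pstart (.comp (.loop Pact (.comp (.pair (.prim .ident) (.comp Ptolls .query)) Pstep))
    Ptolls), p, fun I l hI hl hgrid O hO => ?_⟩
  obtain ⟨T, hT, hP⟩ := Input.recs_eq hI
  obtain ⟨hgood, -, -, hnodup, -, hlen, -⟩ := hP.single
  have hnat : ∀ e x, T.IsTarget I.U (I.G.m * (I.U * I.U)) (fun e => l e (total I.targetFlow e)) e x →
      e < I.G.m ∧ ∃ n : ℕ, n ≤ I.G.m * (I.U * I.U) * (I.G.m + 1) ∧ x = n := by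
    intro e x hx
    obtain ⟨⟨e', -, he'⟩, -⟩ := hx.mem_leaves hnodup
    refine ⟨he' ▸ e'.2, ?_⟩
    obtain ⟨n, hn, h1⟩ := hx.exists_nat hI.2.2.2 (fun _ _ _ _ => hgrid.segment hI) hgood
    rw [hlen] at hn
    exact ⟨n, hn, h1⟩
  have hquery : ∀ S : State,
      ∃ g, I.IsWardrop (tolled l fun e => S.toll e) g ∧ total g = O fun e => S.toll e := fun S =>
    hO _ fun e => S.toll_nonneg e
  have hsz : ∀ S : State, Bracketed I (fun e => l e (total I.targetFlow e)) T S → sz S ≤ F ⟨I, hI⟩ :=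
    fun S H => H.sz_le hT
  obtain ⟨S, t, q, ⟨hS, hdone⟩, hSa, hrun, ht, hq⟩ := exists_run_loop (O := O) (b := b ⟨I, hI⟩)
    (active := fun S : State => S.2.2.2) (next := fun S => S.step (List.ofFn (O fun e => S.toll e)))
    (C := Pact) (B := .comp (.pair (.prim .ident) (.comp Ptolls .query)) Pstep)
    (fun S => Bracketed I (fun e => l e (total I.targetFlow e)) T S ∧
      (S.active = false → I.Enforces l fun e => S.toll e)) (State.potential I.G.m)
    (fun S ⟨H, _⟩ => by
      obtain ⟨t, ht, hr⟩ := hact S O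
      have := (hqact S).trans (eval_nat_mono qact (hsz S H))
      exact ⟨t, by simp only [b]; omega, hr⟩)
    (fun S ⟨H, _⟩ _ => by
      obtain ⟨t, ht, hr⟩ := htolls S O
      obtain ⟨t', ht', hr'⟩ := hstep (S, List.ofFn (O fun e => S.toll e)) O
      beta_reduce at hr
      rw [H.tolls_eq, ← tollVal_eq] at hr
      have hqu := Run.query (O := O) (fun e => S.toll e) fun e => S.toll_nonneg e
      have h1 := hr.size_le.2
      have h2 : (flowVal (O fun e => S.toll e)).size ≤ 1 + I.G.m * 2 := by
        rw [flowVal_eq]; exact sz_answer_le _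
      have h3 := (hqtolls S).trans (eval_nat_mono qtolls (hsz S H))
      have h4 := hsz S H
      have h5 := (hqstep (S, List.ofFn (O fun e => S.toll e))).trans (eval_nat_mono qstep
        (show _ ≤ 2 + F ⟨I, hI⟩ + I.G.m * 2 by
          rw [sz_pair]
          have := sz_answer_le (O fun e => S.toll e)
          omega))
      have h6 : (enc S).size = sz S := rfl
      rw [flowVal_eq] at hqu h2
      have h7 := Run.comp (Run.pair (Run.prim (O := O) .ident (enc S)) (Run.comp hr hqu)) hr'
      simp only [Nat.zero_add, Nat.add_zero] at h7
      refine ⟨_, ?_, h7⟩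
      simp only [Prim.eval, h6, b]
      omega)
    (fun S ⟨H, _⟩ ha => by
      obtain ⟨g, hg, hgO⟩ := hquery S
      have := H.step hI hl hP hnat ha hg
      rw [hgO] at this
      exact ⟨⟨this.1, this.2.1⟩, this.2.2⟩)
    I.start ⟨Bracketed.start hT hnat, fun h => by simp [Input.start, State.active] at h⟩
  obtain ⟨t₀, ht₀, hr₀⟩ := hstart ⟨I, hI⟩ O
  obtain ⟨t₁, ht₁, hr₁⟩ := htolls S O
  beta_reduce at hr₁
  rw [hS.tolls_eq, ← tollVal_eq] at hr₁
  have hpot := Bracketed.potential_start (I := I) rfl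
  rw [hpot] at ht hq
  refine ⟨fun e => S.toll e, _, _, Run.comp hr₀ (Run.comp hrun hr₁), fun e => S.toll_nonneg e,
    hdone hSa, ?_, ?_⟩
  · refine le_trans ?_ (hp ⟨I, hI⟩)
    have h1 := (hqtolls S).trans (eval_nat_mono qtolls (hsz S hS))
    have h2 : Nat.size (I.G.m * (I.U * I.U) * (I.G.m + 1) + 1) ≤ sz (B ⟨I, hI⟩) := by
      rw [sz_nat]; exact Nat.le_add_left _ _
    have h3 := Nat.mul_le_mul_right (2 * b ⟨I, hI⟩ + 1)
      (Nat.add_le_add_right (Nat.mul_le_mul_left I.G.m h2) 2)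
    simp only [add_assoc, Nat.reduceAdd] at ht h3 ⊢
    omega
  · have hm : 0 < I.G.m := T.rep.pos
    simp only [Nat.zero_add, Nat.add_zero]
    exact hq.trans (size_le_of_log hm hI.2.2.2)

end SepaTolls
namespace SepaTolls
open Enc (enc)

/-! ### Standard linear delays -/

/-- Paths of a series-parallel network do not repeat edges. -/
theorem Network.IsSepa.nodup_of_isPath {G : Network} {s t : Fin G.n} (hG : G.IsSepa s t)
    {u v : Fin G.n} {P : List (Fin G.m)} (hP : G.IsPath u v P) : P.Nodup := by
  obtain ⟨ρ, -, hρ⟩ := hG.exists_rank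
  suffices h : (∀ e ∈ P, ρ u ≤ ρ (G.tail e)) ∧ P.Nodup from h.2
  induction hP with
  | nil v => simp
  | cons e _ ih =>
    have he := hρ e
    refine ⟨fun e' he' => ?_, List.nodup_cons.2 ⟨fun h => ?_, ih.2⟩⟩
    · rcases List.mem_cons.1 he' with rfl | h
      · exact le_rfl
      · exact he.le.trans (ih.1 e' h)
    · exact (ih.1 e h).not_gt he

/-- If all delays at the target flow are integers between `0` and `U ^ 2`, in units of `1 / U`, then
the promise on differences of path delays holds. -/
theorem Input.delaysOnGrid_of_forall {I : Input} (hG : I.G.IsSepa I.s I.t)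
    {l : Fin I.G.m → ℝ → ℝ} (w : Fin I.G.m → ℤ) (h0 : ∀ e, 0 ≤ w e) (h1 : ∀ e, w e ≤ (I.U : ℤ) ^ 2)
    (hw : ∀ e, l e (total I.targetFlow e) = w e / I.U) : I.DelaysOnGrid l := by
  have hcost : ∀ P : List (Fin I.G.m), pathCost (fun e => l e (total I.targetFlow e)) P =
      ((P.map w).sum : ℤ) / I.U := by
    intro P
    induction P with
    | nil => simp [pathCost]
    | cons e P ih =>
      rw [pathCost_cons, ih, hw]
      push_cast [List.map_cons, List.sum_cons]
      ring
  have hbound : ∀ P, I.G.IsPath I.s I.t P → 0 ≤ (P.map w).sum ∧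
      (P.map w).sum ≤ I.G.m * (I.U : ℤ) ^ 2 := by
    intro P hP
    have hn := hG.nodup_of_isPath hP
    rw [← List.sum_toFinset w hn]
    refine ⟨Finset.sum_nonneg fun e _ => h0 e, ?_⟩
    refine (Finset.sum_le_sum_of_subset_of_nonneg (Finset.subset_univ _) fun e _ _ => h0 e).trans ?_
    refine (Finset.sum_le_sum fun e _ => h1 e).trans ?_
    simp
  intro P Q hP hQ
  refine ⟨(P.map w).sum - (Q.map w).sum, ?_, ?_⟩
  · obtain ⟨h2, h3⟩ := hbound P hP
    obtain ⟨h4, h5⟩ := hbound Q hQ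
    exact abs_le.2 ⟨by linarith, by linarith⟩
  · rw [hcost, hcost]
    push_cast
    ring

/-- The same instance with a finer accuracy. -/
def Input.refine (I : Input) : Input := { I with U := 2 * (I.U * I.U) }

namespace Input

theorem Valid.refine {I : Input} (hI : I.Valid) : I.refine.Valid :=
  ⟨hI.1, hI.2.1, hI.2.2.1, Nat.mul_pos two_pos (Nat.mul_pos hI.2.2.2 hI.2.2.2)⟩

/-- A product of two multiples of `1 / U` in `[0, U]`, plus a third one, is a multiple of `1 / (2 U ^ 2)`
in `[0, 2 U ^ 2]`. -/
theorem StandardLinear.delaysOnGrid {I : Input} (hI : I.Valid) {l : Fin I.G.m → ℝ → ℝ}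
    (hl : I.StandardLinear l) : I.refine.DelaysOnGrid l := by
  obtain ⟨hf, a, b, hab⟩ := hl
  have hU : (0 : ℝ) < I.U := by exact_mod_cast hI.2.2.2
  have hU1 : (1 : ℝ) ≤ I.U := by exact_mod_cast hI.2.2.2
  have key : ∀ e, ∃ w : ℤ, l e (total I.targetFlow e) = w / (2 * (I.U * I.U)) ∧ 0 ≤ w ∧
      w ≤ (2 * ((I.U : ℤ) * I.U)) ^ 2 := by
    intro e
    obtain ⟨hf0, hfU, zf, hzf⟩ := hf e
    obtain ⟨-, ⟨ha0, haU, za, hza⟩, ⟨hb0, hbU, zb, hzb⟩, hle⟩ := hab e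
    have h1 : l e (total I.targetFlow e) =
        ((2 * (za * zf + zb * I.U) : ℤ) : ℝ) / (2 * (I.U * I.U)) := by
      rw [hle _ hf0, hza, hzf, hzb]
      push_cast
      field_simp
    have h2 : 0 ≤ l e (total I.targetFlow e) := by rw [hle _ hf0]; positivity
    have h3 : l e (total I.targetFlow e) ≤ 2 * (I.U * I.U) := by
      rw [hle _ hf0]
      have := mul_le_mul haU hfU hf0 hU.le
      nlinarith
    have h4 : (0 : ℝ) < 2 * (I.U * I.U) := by positivity
    refine ⟨_, h1, ?_, ?_⟩
    · rw [h1] at h2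
      have := (div_nonneg_iff.1 h2).resolve_right fun h => h4.not_ge h.2
      exact_mod_cast this.1
    · rw [h1, div_le_iff₀ h4, ← sq] at h3
      exact_mod_cast h3
  choose w hw h0 h1 using key
  refine delaysOnGrid_of_forall (I := I.refine) hI.1 w h0 (fun e => ?_) fun e => ?_
  · exact (h1 e).trans_eq (by simp [Input.refine])
  · exact (hw e).trans (by simp [Input.refine])

theorem StandardLinear.isDelay {I : Input} {l : Fin I.G.m → ℝ → ℝ} (hl : I.StandardLinear l)
    (e : Fin I.G.m) : IsDelay (l e) := by
  obtain ⟨-, a, b, hab⟩ := hl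
  obtain ⟨ha, -, hb, hle⟩ := hab e
  refine ⟨fun x hx => ?_, ?_, fun x hx y hy hxy => ?_⟩
  · rw [hle x hx]
    have := hb.1
    positivity
  · exact (Continuous.continuousOn (by fun_prop : Continuous fun x => a e * x + b e)).congr hle
  · rw [hle x hx, hle y hy]
    have := mul_lt_mul_of_pos_left hxy ha
    linarith

end Input

theorem PT.refine : PT (fun I : ValidInput => (⟨I.1.refine, I.2.refine⟩ : ValidInput)) := by
  have h1 : PT fun I : ValidInput => I.1.refine.raw :=
    PT.raw.fst.mk (PT.raw.snd.fst.mk (PT.raw.snd.snd.fst.mk (PT.raw.snd.snd.snd.fst.mk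
      (PT.raw.snd.snd.snd.snd.fst.mk (PT.raw.snd.snd.snd.snd.snd.fst.mk
        (((PT.constNat 2).natMul (PT.inputU.natMul PT.inputU)).mk
          PT.raw.snd.snd.snd.snd.snd.snd.snd))))))
  obtain ⟨P, T, hT, hP⟩ := h1
  refine ⟨P, T, hT, fun I m O => ?_⟩
  have := hP I O
  rw [Input.enc_raw] at this
  exact this

theorem log_refine_le (m U : ℕ) (hm : 0 < m) (hU : 0 < U) :
    Nat.log 2 (m * (2 * (U * U))) + 1 ≤ 3 * (Nat.log 2 (m * U) + 1) := by
  have h1 : m * U < 2 ^ (Nat.log 2 (m * U) + 1) := Nat.lt_pow_succ_log_self one_lt_two _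
  have h2 : m * (2 * (U * U)) < 2 ^ (2 * Nat.log 2 (m * U) + 3) := by
    have h3 : m * U * (m * U) < 2 ^ (Nat.log 2 (m * U) + 1) * 2 ^ (Nat.log 2 (m * U) + 1) :=
      Nat.mul_lt_mul'' h1 h1
    have h4 : 2 ^ (2 * Nat.log 2 (m * U) + 3) =
        2 * (2 ^ (Nat.log 2 (m * U) + 1) * 2 ^ (Nat.log 2 (m * U) + 1)) := by
      rw [← pow_add, show 2 * Nat.log 2 (m * U) + 3 =
        1 + (Nat.log 2 (m * U) + 1 + (Nat.log 2 (m * U) + 1)) by ring, pow_add, pow_one]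
    have h5 : m * (2 * (U * U)) ≤ 2 * (m * U * (m * U)) := by
      have := Nat.mul_le_mul_right (m * (U * U)) hm
      nlinarith
    omega
  have h6 := Nat.log_lt_of_lt_pow (Nat.mul_pos hm (Nat.mul_pos two_pos (Nat.mul_pos hU hU))).ne' h2
  omega

/-- Standard linear delays are on a grid of squared accuracy. -/
theorem exists_solver_linear : ∃ (A : Prog) (p : Polynomial ℕ), ∀ (I : Input) (l : Fin I.G.m → ℝ → ℝ),
    I.Valid → I.StandardLinear l → I.SolvedBy l A p 15 := by
  obtain ⟨A, p, hA⟩ := exists_solver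
  have hPT := PT.refine
  have hsz := hPT.pbdd
  obtain ⟨P, T, hT, hP⟩ := hPT
  obtain ⟨p', hp'⟩ := (hT.add (hsz.eval p)).add (PBdd.const 1)
  refine ⟨.comp P A, p', fun I l hI hl O hO => ?_⟩
  obtain ⟨τ, t, q, hr, hτ, henf, ht, hq⟩ := hA I.refine l hI.refine hl.isDelay
    (hl.delaysOnGrid hI) O hO
  obtain ⟨t', ht', hr'⟩ := hP ⟨I, hI⟩ O
  refine ⟨τ, _, _, Run.comp hr' hr, hτ, henf, ?_, ?_⟩
  · refine le_trans ?_ (hp' ⟨I, hI⟩)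
    have h1 : sz (⟨I.refine, hI.refine⟩ : ValidInput) = I.refine.encode.size := rfl
    rw [← h1] at ht
    simp only
    omega
  · rw [Nat.zero_add]
    refine hq.trans ?_
    rcases Nat.eq_zero_or_pos I.G.m with hm | hm
    · have : I.refine.G.m = 0 := hm
      simp [this]
    · have h1 := log_refine_le I.G.m I.U hm hI.2.2.2
      calc 5 * I.G.m * (Nat.log 2 (I.G.m * (2 * (I.U * I.U))) + 1)
          ≤ 5 * I.G.m * (3 * (Nat.log 2 (I.G.m * I.U) + 1)) := Nat.mul_le_mul_left _ h1
        _ = 15 * I.G.m * (Nat.log 2 (I.G.m * I.U) + 1) := by ring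

end SepaTolls
theorem mainTheorem3 :
    (∃ (A : SepaTolls.Prog) (p : Polynomial ℕ) (C : ℕ),
      ∀ (I : SepaTolls.Input) (l : Fin I.G.m → ℝ → ℝ),
        I.Valid → (∀ e, SepaTolls.IsDelay (l e)) → I.DelaysOnGrid l → I.SolvedBy l A p C) ∧
    (∃ (A : SepaTolls.Prog) (p : Polynomial ℕ) (C : ℕ),
      ∀ (I : SepaTolls.Input) (l : Fin I.G.m → ℝ → ℝ),
        I.Valid → I.StandardLinear l → I.SolvedBy l A p C) := by
  obtain ⟨A, p, hA⟩ := SepaTolls.exists_solver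
  obtain ⟨A', p', hA'⟩ := SepaTolls.exists_solver_linear
  exact ⟨⟨A, p, 5, hA⟩, ⟨A', p', 15, hA'⟩⟩
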